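/- **Setting.** Let $\gamma\in(-1,1)$, $e_1=(1,0,0)$, let $B_1\subset\mathbb R^2$ be the open unit disk and $\Sigma=\mathbb R\times B_1\subset\mathbb R^3$. Write $m'=(m_2,m_3)$, $\nabla'=(\partial_2,\partial_3)$ and $\|m\|_{\mathcal H^1(\Sigma)}=\|\nabla m\|_{L^2(\Sigma)}+\|m'\|_{L^2(\Sigma)}$. We say that $m_n\rightharpoonup m_0$ weakly in $\mathcal H^1(\Sigma)$ if $\nabla m_n\rightharpoonup\nabla m_0$ and $m_n'\rightharpoonup m_0'$ weakly in $L^2(\Sigma)$. Let $L,R,d,Q>0$ and $D=(D_{k,l})\in\mathbb R^{3\times3}$, with rows $D_1,D_2,D_3$, be functions of a parameter $\eta>0$ such that, with $\rho=d/\sqrt Q$, one has $R/\rho=\eta$ for all small $\eta$ and, as $\eta\to0$, $$\frac{\rho}{L}\to0,\qquad \frac{\rho L}{d^2}\to0,\qquad \frac{\rho}{d^2}D_{1,1}\to-2\gamma,$$ $$\frac{\rho}{d^2}\big(|D_{1,2}|+|D_{1,3}|+|D_{2,1}|+|D_{3,1}|\big)\to0,\qquad \frac{\sqrt{\rho L}}{d^2}\big(|D_{2,2}|+|D_{2,3}|+|D_{3,2}|+|D_{3,3}|\big)\to0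 .$$ Let $\Sigma_\eta=(-L/\rho,L/\rho)\times B_1$ and $$\mathcal M_\eta=\{m:\Sigma\to\mathbb S^2:\ \|m\|_{\mathcal H^1(\Sigma)}<\infty,\ m'=0\text{ if }|x_1|\ge L/\rho\},$$ and, for $m\in\mathcal M_\eta$, $$E_\eta(m)=\int_\Sigma|\partial_1m|^2+\Big|\frac1\eta\nabla'm\Big|^2+1-m_1^2+\frac{\rho}{d^2}\Big(D_1\cdot(\partial_1m\wedge m)+\sum_{k=2}^3D_k\cdot\Big(\frac1\eta\partial_km\wedge m\Big)\Big)\,dX+\frac{R^2}{d^2}\int_{\mathbb R^3}\Big|\Big(\partial_1,\frac1\eta\nabla'\Big)U\Big|^2\,dX,$$ where $U$ is the unique element of $\dot H^1(\mathbb R^3)$ such that for all $\zeta\in C_c^\infty(\mathbb R^3)$ $$\int_{\mathbb R^3}\Big(\partial_1,\frac1\eta\nabla'\Big)U\cdot\Big(\partial_1,\frac1\eta\nabla'\Big)\zeta\,dX=\frac1\eta\int_{\Sigma_\eta}m\cdot\Big(\partial_1,\frac1\eta\nabla'\Big)\zeta\,dX .$$ Let $\mathcal M_0=\{m:\Sigma\to\mathbb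 S^2:\ m=m(x_1),\ \|m\|_{\mathcal H^1(\Sigma)}<\infty\}$ (its elements are identified with their continuous representatives) and $$E_0(m)=\int_\Sigma|\partial_1m|^2+1-m_1^2-2\gamma\,e_1\cdot(\partial_1m\wedge m)\,dX .$$ **Corollary (convergence of minimisers).** For every sequence $\eta\to0^+$ and all minimisers $m_\eta$ of $E_\eta$ over $\{m\in\mathcal M_\eta:\ m(x_1,\cdot)=\pm e_1\text{ for }\pm x_1\ge L/\rho\}$, after passing to a subsequence there exist $x_{1,\eta}\in(-L/\rho,L/\rho)$ such that $$m_\eta(\cdot+x_{1,\eta}e_1)\rightharpoonup m_0\quad\text{weakly in }\mathcal H^1(\Sigma),$$ where $m_0\in\mathcal M_0$ is a minimiser of $E_0$ over $\{m\in\mathcal M_0:\ m(\pm\infty)=\pm e_1\}$ and $e_1\cdot m_0(0)=0$. -/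

import Mathlib

open MeasureTheory Filter Set
open scoped Topology ContDiff ENNReal Matrix

namespace Nanowire

/-- `ℝ³` with its Euclidean norm. The coordinates `x₁, x₂, x₃` are `x 0, x 1, x 2`. -/
abbrev E3 : Type := EuclideanSpace ℝ (Fin 3)

/-- The unit vector `e₁`. -/
noncomputable def e1 : E3 := EuclideanSpace.single 0 1

/-- The infinite cylinder `Σ = ℝ × B₁`, with `B₁` the open unit disk of the `(e₂, e₃)` plane. -/
def cyl : Set E3 := {x | x 1 ^ 2 + x 2 ^ 2 < 1}

/-- Lebesgue measure on the cylinder `Σ`. -/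
noncomputable abbrev volCyl : Measure E3 := volume.restrict cyl

/-! ### Weak derivatives -/

/-- The classical partial derivative `∂ᵢ f`. -/
noncomputable def partialD (i : Fin 3) (f : E3 → ℝ) (x : E3) : ℝ :=
  fderiv ℝ f x (EuclideanSpace.single i 1)

/-- `φ ∈ C_c^∞(Ω)`. -/
structure IsTestFn (Ω : Set E3) (φ : E3 → ℝ) : Prop where
  smooth : ContDiff ℝ ∞ φ
  compact : HasCompactSupport φ
  support : tsupport φ ⊆ Ω

/-- `g` is the weak partial derivative `∂ᵢ f` of `f` in `Ω`. -/
structure HasWeakPartial (Ω : Set E3) (i : Fin 3) (f g : E3 → ℝ) : Prop where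
  locInt : LocallyIntegrableOn f Ω
  locInt' : LocallyIntegrableOn g Ω
  parts : ∀ φ, IsTestFn Ω φ →
    ∫ x in Ω, f x * partialD i φ x = - ∫ x in Ω, g x * φ x

open Classical in
/-- The weak partial derivative `∂ᵢ f` in the cylinder `Σ` (unique almost everywhere; the default
value `0` is never met for the maps in the classes below). -/
noncomputable def wD (i : Fin 3) (f : E3 → ℝ) : E3 → ℝ :=
  if h : ∃ g, HasWeakPartial cyl i f g then h.choose else 0

/-! ### Magnetisations -/

/-- Maps `m : Σ → 𝕊²` with `‖∇m‖_{L²(Σ)} + ‖m'‖_{L²(Σ)} < ∞`, where `m' = (m₂, m₃)`. -/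
structure MemH1 (m : E3 → E3) : Prop where
  meas : AEStronglyMeasurable m volCyl
  sphere : ∀ᵐ x ∂volCyl, ‖m x‖ = 1
  grad : ∀ i j : Fin 3, ∃ g, HasWeakPartial cyl i (fun x => m x j) g ∧ MemLp g 2 volCyl
  transverse : ∀ j : Fin 3, j ≠ 0 → MemLp (fun x => m x j) 2 volCyl

/-- Weak convergence `f n ⇀ f₀` in `L²(Σ)`. -/
def WeakL2Tendsto (f : ℕ → E3 → ℝ) (f₀ : E3 → ℝ) : Prop :=
  ∀ g, MemLp g 2 volCyl →
    Tendsto (fun n => ∫ x in cyl, f n x * g x) atTop (𝓝 (∫ x in cyl, f₀ x * g x))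

/-- Weak convergence in `𝓗¹(Σ)`: `∇(m n) ⇀ ∇m₀` and `(m n)' ⇀ m₀'` weakly in `L²(Σ)`. -/
def WeakH1Tendsto (m : ℕ → E3 → E3) (m₀ : E3 → E3) : Prop :=
  (∀ i j : Fin 3, WeakL2Tendsto (fun n => wD i (fun x => m n x j)) (wD i (fun x => m₀ x j))) ∧
    ∀ j : Fin 3, j ≠ 0 → WeakL2Tendsto (fun n x => m n x j) (fun x => m₀ x j)

/-! ### Parameters of the wire -/

/-- Physical parameters: length `L`, thickness `R`, exchange length `d`, quality factor `Q` and
Dzyaloshinskii-Moriya tensor `D` (with rows `D₁, D₂, D₃`). -/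
structure Params where
  L : ℝ
  R : ℝ
  d : ℝ
  Q : ℝ
  D : Matrix (Fin 3) (Fin 3) ℝ
  L_pos : 0 < L
  R_pos : 0 < R
  d_pos : 0 < d
  Q_pos : 0 < Q

namespace Params

/-- The length scale `ρ = d / √Q`. -/
noncomputable def rho (p : Params) : ℝ := p.d / √p.Q

/-- `η = R / ρ`. -/
noncomputable def eta (p : Params) : ℝ := p.R / p.rho

/-- The rescaled half length `L / ρ`. -/
noncomputable def len (p : Params) : ℝ := p.L / p.rho

/-- The coefficients of the rescaled gradient `(∂₁, η⁻¹ ∂₂, η⁻¹ ∂₃)`. -/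
noncomputable def scale (p : Params) (i : Fin 3) : ℝ := if i = 0 then 1 else 1 / p.eta

end Params

/-- The asymptotic regime for parameters `P η` as `η → 0⁺`, with `η = R / ρ` and
`ρ D₁₁ / d² → -2γ`. -/
structure Regime (P : ℝ → Params) (γ : ℝ) : Prop where
  eta_eq : ∀ᶠ η in 𝓝[>] (0 : ℝ), (P η).eta = η
  rho_L : Tendsto (fun η => (P η).rho / (P η).L) (𝓝[>] 0) (𝓝 0)
  rho_L_d : Tendsto (fun η => (P η).rho * (P η).L / (P η).d ^ 2) (𝓝[>] 0) (𝓝 0)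
  D11 : Tendsto (fun η => (P η).rho / (P η).d ^ 2 * (P η).D 0 0) (𝓝[>] 0) (𝓝 (-2 * γ))
  D_small : Tendsto (fun η => (P η).rho / (P η).d ^ 2 *
    (|(P η).D 0 1| + |(P η).D 0 2| + |(P η).D 1 0| + |(P η).D 2 0|)) (𝓝[>] 0) (𝓝 0)
  D_perp_small : Tendsto (fun η => √((P η).rho * (P η).L) / (P η).d ^ 2 *
    (|(P η).D 1 1| + |(P η).D 1 2| + |(P η).D 2 1| + |(P η).D 2 2|)) (𝓝[>] 0) (𝓝 0)

/-! ### The stray field -/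

/-- `U` belongs to the homogeneous Sobolev space `Ḣ¹(ℝ³)` (the completion of `C_c^∞(ℝ³)` for
`‖∇·‖_{L²}`, a space of functions in `L⁶(ℝ³)`) and has gradient `G`. -/
structure IsHomSobolev (U : E3 → ℝ) (G : Fin 3 → E3 → ℝ) : Prop where
  memLp : MemLp U 6 volume
  memLp_grad : ∀ i, MemLp (G i) 2 volume
  approx : ∃ ζ : ℕ → E3 → ℝ, (∀ n, IsTestFn univ (ζ n)) ∧
    Tendsto (fun n => eLpNorm (ζ n - U) 6 volume) atTop (𝓝 0) ∧
    ∀ i, Tendsto (fun n => eLpNorm (partialD i (ζ n) - G i) 2 volume) atTop (𝓝 0)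

/-- The rescaled nanowire `Σ_η = (-L/ρ, L/ρ) × B₁`. -/
def wire (p : Params) : Set E3 := {x | x ∈ cyl ∧ |x 0| < p.len}

/-- `U ∈ Ḣ¹(ℝ³)`, with gradient `G`, is the stray-field potential of `m`: for all `ζ ∈ C_c^∞(ℝ³)`,
`∫ (∂₁, η⁻¹∇')U · (∂₁, η⁻¹∇')ζ = η⁻¹ ∫_{Σ_η} m · (∂₁, η⁻¹∇')ζ`. -/
structure IsStrayPotential (p : Params) (m : E3 → E3) (U : E3 → ℝ) (G : Fin 3 → E3 → ℝ) :
    Prop where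
  sobolev : IsHomSobolev U G
  eqn : ∀ ζ, IsTestFn univ ζ →
    ∫ x, ∑ i, (p.scale i * G i x) * (p.scale i * partialD i ζ x) =
      1 / p.eta * ∫ x in wire p, ∑ i, m x i * (p.scale i * partialD i ζ x)

open Classical in
/-- The stray-field energy `∫_{ℝ³} |∂₁U|² + |η⁻¹∇'U|²`, with `U` the unique stray-field potential
of `m`. The potential exists by the Lax-Milgram theorem whenever `m ∈ L²(Σ_η)`, so that the
default value `0` is never met for the maps in the classes below. -/
noncomputable def strayEnergy (p : Params) (m : E3 → E3) : ℝ :=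
  if h : ∃ G : Fin 3 → E3 → ℝ, ∃ U, IsStrayPotential p m U G then
    ∫ x, ∑ i, (p.scale i * h.choose i x) ^ 2
  else 0

/-! ### Energies and admissible classes -/

/-- The vector `∂ₖm ∧ m`. -/
noncomputable def dkCross (k : Fin 3) (m : E3 → E3) (x : E3) : Fin 3 → ℝ :=
  (fun j => wD k (fun y => m y j) x) ⨯₃ (fun j => m x j)

/-- The 3D micromagnetic energy `E_η` (with `R² / d²` in front of the stray-field energy). -/
noncomputable def energyEta (p : Params) (m : E3 → E3) : ℝ :=
  (∫ x in cyl,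
    ((∑ i, ∑ j, (p.scale i * wD i (fun y => m y j) x) ^ 2) + (1 - m x 0 ^ 2)
      + p.rho / p.d ^ 2 * ∑ k, p.D k ⬝ᵥ (p.scale k • dkCross k m x)))
    + p.R ^ 2 / p.d ^ 2 * strayEnergy p m

/-- The reduced energy `E₀(m) = ∫_Σ |∂₁m|² + (1 - m₁²) - 2γ e₁ · (∂₁m ∧ m)`. -/
noncomputable def energyZero (γ : ℝ) (m : E3 → E3) : ℝ :=
  ∫ x in cyl,
    ((∑ j, wD 0 (fun y => m y j) x ^ 2) + (1 - m x 0 ^ 2) - 2 * γ * dkCross 0 m x 0)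

/-- The class `𝓜_η`: `m' = 0` for `|x₁| ≥ L/ρ`. -/
def MEta (p : Params) : Set (E3 → E3) :=
  {m | MemH1 m ∧ ∀ᵐ x ∂volCyl, p.len ≤ |x 0| → m x 1 = 0 ∧ m x 2 = 0}

/-- The set of `m ∈ 𝓜_η` with `m(x₁, ·) = ± e₁` for `± x₁ ≥ L/ρ`. -/
def wallsEta (p : Params) : Set (E3 → E3) :=
  {m | m ∈ MEta p ∧ ∀ᵐ x ∂volCyl, (p.len ≤ x 0 → m x = e1) ∧ (p.len ≤ -x 0 → m x = -e1)}

/-- The class `𝓜₀`: maps depending only on `x₁`. -/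
def MZero : Set (E3 → E3) :=
  {m | MemH1 m ∧ ∃ u : ℝ → E3, ∀ᵐ x ∂volCyl, m x = u (x 0)}

/-- `u` is the continuous representative, as a function of `x₁`, of a map `m` on `Σ`. -/
def IsProfile (m : E3 → E3) (u : ℝ → E3) : Prop :=
  Continuous u ∧ ∀ᵐ x ∂volCyl, m x = u (x 0)

/-- The set of `m ∈ 𝓜₀` with `m(±∞) = ± e₁`. -/
def wallsZero : Set (E3 → E3) :=
  {m | m ∈ MZero ∧ ∃ u, IsProfile m u ∧ Tendsto u atTop (𝓝 e1) ∧ Tendsto u atBot (𝓝 (-e1))}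

/-- `m` minimises `E` over the set `S`. -/
def IsMinimiser (E : (E3 → E3) → ℝ) (S : Set (E3 → E3)) (m : E3 → E3) : Prop :=
  m ∈ S ∧ IsMinOn E S m

end Nanowire

/-! The proof has two halves: in the limit `E_η` is `E₀` plus a penalty on transverse variation, and
the minimum of `E₀` is the explicit number `4√(1-γ²)|B₁|`. A sequence that reaches this number
asymptotically cannot lose part of its wall at infinity.

Reduction. Up to errors, `E_η` equals `E₀ + η⁻² ∫|∇'m|²` (`MemH1.mainEnergy_eq`). By
`MEta.abs_energyEta_sub_le` the errors are at most a vanishing factor times one plus the exchange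
and anisotropy energy. The stray field is controlled by testing its equation with the potential
itself. The Dzyaloshinskii-Moriya terms are controlled by Young's inequality, by an integration by
parts along the axis, or at the price of the square root of the wire length, which is how the three
smallness hypotheses on `D` enter.

Minimal value. Since `m` is orthogonal to `∂₁m`, the density of `E₀` dominates `2√(1-γ²)|∂₁m₁|`
(`two_mul_abs_le_reduced`), and `m₁` runs from `-1` to `1`. Conversely, twisted walls of finite
length come arbitrarily close (`exists_competitor`). They are admissible for small `η`, so
minimisers have reduced energy at most `4√(1-γ²)|B₁| + o(1)`, and coercivity makes `∫|∇'m|²` tend to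
zero.

Compactness. The averages of `m` over sections are continuous and equi-Hölder, and a Poincaré
inequality compares `m` with them. Translate so that the average of `m₁` vanishes at the origin and
extract a pointwise limit of the averages. It has unit length because the Poincaré error vanishes.
Near-optimal energy leaves the average of `m₁` a total variation of nearly `2`, the least needed to
go from `-1` to `1`, so the limit of these averages is monotone (`WallSeq.limit_mono`). Finite
energy and the value zero at the origin then force the limits `±e₁`. Writing `E₀` as a sum of
squares gives lower semicontinuity, so the limit has at most the minimal energy. -/

namespace Nanowire

/-! ### The Hilbert space `L²` -/

section L2

variable {α : Type*} [MeasurableSpace α] {μ : Measure α}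

theorem MemLp_mul_integrable {f g : α → ℝ} (hf : MemLp f 2 μ) (hg : MemLp g 2 μ) :
    Integrable (fun x => f x * g x) μ :=
  hf.integrable_mul hg

theorem inner_toLp {f g : α → ℝ} (hf : MemLp f 2 μ) (hg : MemLp g 2 μ) :
    inner ℝ (hf.toLp f) (hg.toLp g) = ∫ x, f x * g x ∂μ := by
  rw [L2.inner_def]
  refine integral_congr_ae ?_
  filter_upwards [hf.coeFn_toLp, hg.coeFn_toLp] with x h1 h2
  simp [h1, h2, mul_comm]

theorem norm_toLp_sq {f : α → ℝ} (hf : MemLp f 2 μ) :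
    ‖hf.toLp f‖ ^ 2 = ∫ x, f x ^ 2 ∂μ := by
  rw [← real_inner_self_eq_norm_sq, inner_toLp hf hf]
  simp [sq]

theorem norm_toLp_eq_sqrt {f : α → ℝ} (hf : MemLp f 2 μ) :
    ‖hf.toLp f‖ = √(∫ x, f x ^ 2 ∂μ) := by
  rw [← norm_toLp_sq hf, Real.sqrt_sq (norm_nonneg _)]

theorem abs_integral_mul_le {f g : α → ℝ} (hf : MemLp f 2 μ) (hg : MemLp g 2 μ) :
    |∫ x, f x * g x ∂μ| ≤ √(∫ x, f x ^ 2 ∂μ) * √(∫ x, g x ^ 2 ∂μ) := by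
  rw [← inner_toLp hf hg, ← norm_toLp_eq_sqrt hf, ← norm_toLp_eq_sqrt hg]
  exact abs_real_inner_le_norm _ _

theorem Lp_inner_eq (u : Lp ℝ 2 μ) {g : α → ℝ} (hg : MemLp g 2 μ) :
    inner ℝ u (hg.toLp g) = ∫ x, u x * g x ∂μ := by
  have := inner_toLp (Lp.memLp u) hg
  rwa [Lp.toLp_coeFn] at this

end L2

/-! ### Test functions -/

theorem isOpen_cyl : IsOpen cyl := by
  unfold cyl
  apply isOpen_lt <;> fun_prop

theorem measurableSet_cyl : MeasurableSet cyl := isOpen_cyl.measurableSet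

namespace IsTestFn

variable {Ω : Set E3} {φ ψ : E3 → ℝ}

theorem mono {Ω' : Set E3} (h : IsTestFn Ω φ) (hs : Ω ⊆ Ω') : IsTestFn Ω' φ :=
  ⟨h.smooth, h.compact, h.support.trans hs⟩

theorem continuous (h : IsTestFn Ω φ) : Continuous φ := h.smooth.continuous

theorem eq_zero (h : IsTestFn Ω φ) {x : E3} (hx : x ∉ Ω) : φ x = 0 :=
  image_eq_zero_of_notMem_tsupport fun h' => hx (h.support h')

theorem memLp (h : IsTestFn Ω φ) (p : ℝ≥0∞) (μ : Measure E3) [IsFiniteMeasureOnCompacts μ] :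
    MemLp φ p μ :=
  h.continuous.memLp_of_hasCompactSupport h.compact

theorem integrable (h : IsTestFn Ω φ) (μ : Measure E3) [IsFiniteMeasureOnCompacts μ] :
    Integrable φ μ :=
  h.continuous.integrable_of_hasCompactSupport h.compact

theorem exists_bound (h : IsTestFn Ω φ) : ∃ C, 0 ≤ C ∧ ∀ x, |φ x| ≤ C := by
  obtain ⟨C, hC⟩ := h.compact.exists_bound_of_continuous h.continuous
  exact ⟨C, (norm_nonneg _).trans (hC 0), hC⟩

theorem fderiv_apply (h : IsTestFn Ω φ) (v : E3) : IsTestFn Ω fun x => fderiv ℝ φ x v := by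
  refine ⟨?_, ?_, ?_⟩
  · exact (h.smooth.fderiv_right (m := ∞) (by simp)).clm_apply contDiff_const
  · exact h.compact.fderiv_apply ℝ v
  · exact (tsupport_fderiv_apply_subset ℝ v).trans h.support

theorem partialD (h : IsTestFn Ω φ) (i : Fin 3) : IsTestFn Ω (partialD i φ) :=
  h.fderiv_apply _

theorem add (h : IsTestFn Ω φ) (h' : IsTestFn Ω ψ) : IsTestFn Ω (φ + ψ) :=
  ⟨h.smooth.add h'.smooth, h.compact.add h'.compact,
    (tsupport_add φ ψ).trans (union_subset h.support h'.support)⟩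

theorem const_smul (h : IsTestFn Ω φ) (c : ℝ) : IsTestFn Ω (c • φ) :=
  ⟨contDiff_const.smul h.smooth, h.compact.smul_left (f := fun _ => c),
    (tsupport_smul_subset_right (fun _ => c) φ).trans h.support⟩

theorem zero : IsTestFn Ω (0 : E3 → ℝ) :=
  ⟨contDiff_const, HasCompactSupport.zero, by simp [tsupport]⟩

theorem mul_left (h : IsTestFn Ω φ) {χ : E3 → ℝ} (hχ : ContDiff ℝ ∞ χ) :
    IsTestFn Ω fun x => χ x * φ x :=
  ⟨hχ.mul h.smooth, h.compact.mul_left, (tsupport_mul_subset_right (f := χ)).trans h.support⟩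

theorem comp_sub (h : IsTestFn Ω φ) {Ω' : Set E3} {v : E3}
    (hv : ∀ x ∈ Ω, x + v ∈ Ω') : IsTestFn Ω' fun x => φ (x - v) := by
  have he : (fun x => φ (x - v)) = φ ∘ (Homeomorph.subRight v) := rfl
  refine ⟨h.smooth.comp (contDiff_id.sub contDiff_const), ?_, ?_⟩
  · rw [he]; exact h.compact.comp_homeomorph _
  · rw [he, tsupport_comp_eq_preimage]
    intro x hx
    have := hv _ (h.support hx)
    simpa using this

theorem setIntegral_mul (h : IsTestFn Ω φ) (f : E3 → ℝ) :
    ∫ x in Ω, f x * φ x = ∫ x, f x * φ x :=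
  setIntegral_eq_integral_of_forall_compl_eq_zero fun x hx => by rw [h.eq_zero hx, mul_zero]

theorem setIntegral_mul_of_subset (h : IsTestFn Ω φ) {Ω' : Set E3} (hs : Ω ⊆ Ω') (f : E3 → ℝ) :
    ∫ x in Ω', f x * φ x = ∫ x in Ω, f x * φ x := by
  rw [h.setIntegral_mul, (h.mono hs).setIntegral_mul]

end IsTestFn

/-! ### Uniqueness of weak derivatives -/

theorem ae_eq_of_forall_test {Ω : Set E3} (hΩ : IsOpen Ω) {f g : E3 → ℝ}
    (hf : LocallyIntegrableOn f Ω) (hg : LocallyIntegrableOn g Ω)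
    (h : ∀ φ, IsTestFn Ω φ → ∫ x in Ω, f x * φ x = ∫ x in Ω, g x * φ x) :
    f =ᵐ[volume.restrict Ω] g := by
  have := hΩ.ae_eq_zero_of_integral_contDiff_smul_eq_zero (hf.sub hg) (μ := volume) ?_
  · rw [EventuallyEq, ae_restrict_iff' hΩ.measurableSet]
    filter_upwards [this] with x hx hxΩ
    exact sub_eq_zero.1 (hx hxΩ)
  · intro φ h1 h2 h3
    have hφ : IsTestFn Ω φ := ⟨h1, h2, h3⟩
    have key : ∀ k : E3 → ℝ, LocallyIntegrableOn k Ω → Integrable (fun x => k x * φ x) := by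
      intro k hk
      have hK : IntegrableOn k (tsupport φ) := hk.integrableOn_compact_subset h3 h2
      have h4 : IntegrableOn (fun x => k x * φ x) (tsupport φ) :=
        hK.mul_continuousOn hφ.continuous.continuousOn h2
      refine (integrableOn_iff_integrable_of_support_subset ?_).1 h4
      exact (Function.support_mul_subset_right _ _).trans (subset_tsupport φ)
    have h4 := h φ hφ
    rw [hφ.setIntegral_mul, hφ.setIntegral_mul] at h4
    have h5 : ∀ x, φ x • (f - g) x = f x * φ x - g x * φ x := fun x => by
      simp only [Pi.sub_apply, smul_eq_mul]; ring
    simp_rw [h5]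
    rw [integral_sub (key f hf) (key g hg), h4, sub_self]

theorem HasWeakPartial.mono {Ω Ω' : Set E3} {i : Fin 3} {f g : E3 → ℝ}
    (h : HasWeakPartial Ω i f g) (hs : Ω' ⊆ Ω) : HasWeakPartial Ω' i f g where
  locInt := h.locInt.mono_set hs
  locInt' := h.locInt'.mono_set hs
  parts φ hφ := by
    rw [← (hφ.partialD i).setIntegral_mul_of_subset hs, ← hφ.setIntegral_mul_of_subset hs]
    exact h.parts φ (hφ.mono hs)

theorem HasWeakPartial.unique {Ω : Set E3} (hΩ : IsOpen Ω) {i : Fin 3} {f f' g g' : E3 → ℝ}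
    (h : HasWeakPartial Ω i f g) (h' : HasWeakPartial Ω i f' g')
    (hf : f =ᵐ[volume.restrict Ω] f') : g =ᵐ[volume.restrict Ω] g' := by
  refine ae_eq_of_forall_test hΩ h.locInt' h'.locInt' fun φ hφ => ?_
  have h1 := h.parts φ hφ
  have h2 := h'.parts φ hφ
  have h3 : ∫ x in Ω, f x * Nanowire.partialD i φ x = ∫ x in Ω, f' x * Nanowire.partialD i φ x :=
    integral_congr_ae (by filter_upwards [hf] with x hx; rw [hx])
  linarith

theorem locallyIntegrableOn_of_bound {f : E3 → ℝ} {Ω : Set E3}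
    (hf : AEStronglyMeasurable f (volume.restrict Ω)) {C : ℝ}
    (h : ∀ᵐ x ∂volume.restrict Ω, |f x| ≤ C) : LocallyIntegrableOn f Ω := by
  refine locallyIntegrableOn_of_locallyIntegrable_restrict ?_
  exact (locallyIntegrable_const C).mono hf (by
    filter_upwards [h] with x hx
    exact hx.trans (le_abs_self C))

/-- Lipschitz regularity covers both uses: constants, and the competitor walls, which have corners
where they are truncated. -/
theorem hasWeakPartial_of_lipschitz (Ω : Set E3) (i : Fin 3) {f : E3 → ℝ} {C : NNReal}
    (hf : LipschitzWith C f) :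
    HasWeakPartial Ω i f fun x => lineDeriv ℝ f x (EuclideanSpace.single i 1) where
  locInt := hf.continuous.locallyIntegrable.locallyIntegrableOn Ω
  locInt' := locallyIntegrableOn_of_bound
    (measurable_lineDeriv hf.continuous).aestronglyMeasurable (C := C * 1) (by
      filter_upwards with x
      refine (norm_lineDeriv_le_of_lipschitz ℝ hf).trans ?_
      simp)
  parts φ hφ := by
    obtain ⟨D, hD⟩ := ContDiff.lipschitzWith_of_hasCompactSupport hφ.compact hφ.smooth (by simp)
    rw [(hφ.partialD i).setIntegral_mul, hφ.setIntegral_mul]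
    rw [hf.integral_lineDeriv_mul_eq hD hφ.compact, ← integral_neg]
    refine integral_congr_ae (Eventually.of_forall fun x => ?_)
    have hd : DifferentiableAt ℝ φ x := hφ.smooth.differentiable (by simp) x
    simp only [Nanowire.partialD]
    rw [hd.lineDeriv_eq_fderiv]
    simp [mul_comm]

/-- Uniqueness makes the choice inside `wD` harmless: any weak derivative at hand may replace it
almost everywhere. -/
theorem HasWeakPartial.wD_ae_eq {i : Fin 3} {f g : E3 → ℝ} (h : HasWeakPartial cyl i f g) :
    wD i f =ᵐ[volCyl] g := by
  have h' : ∃ g, HasWeakPartial cyl i f g := ⟨g, h⟩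
  unfold wD
  rw [dif_pos h']
  exact h'.choose_spec.unique isOpen_cyl h ae_eq_rfl

theorem HasWeakPartial.congr {Ω : Set E3} {i : Fin 3} {f f' g g' : E3 → ℝ}
    (h : HasWeakPartial Ω i f g) (hf : f =ᵐ[volume.restrict Ω] f')
    (hg : g =ᵐ[volume.restrict Ω] g') : HasWeakPartial Ω i f' g' where
  locInt := h.locInt.congr hf
  locInt' := h.locInt'.congr hg
  parts φ hφ := by
    have h1 : ∫ x in Ω, f' x * Nanowire.partialD i φ x = ∫ x in Ω, f x * Nanowire.partialD i φ x :=
      integral_congr_ae (by filter_upwards [hf] with x hx; rw [hx])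
    have h2 : ∫ x in Ω, g' x * φ x = ∫ x in Ω, g x * φ x :=
      integral_congr_ae (by filter_upwards [hg] with x hx; rw [hx])
    rw [h1, h2, h.parts φ hφ]

/-! ### Weak convergence -/

/-- Classes in `L²` of test functions in `Ω`. -/
def testSubmodule (Ω : Set E3) : Submodule ℝ (Lp ℝ 2 (volume.restrict Ω)) where
  carrier := {u | ∃ φ, IsTestFn Ω φ ∧ u =ᵐ[volume.restrict Ω] φ}
  add_mem' := by
    rintro u v ⟨φ, hφ, hu⟩ ⟨ψ, hψ, hv⟩
    exact ⟨φ + ψ, hφ.add hψ, (Lp.coeFn_add u v).trans (hu.add hv)⟩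
  zero_mem' := ⟨0, IsTestFn.zero, Lp.coeFn_zero _ _ _⟩
  smul_mem' := by
    rintro c u ⟨φ, hφ, hu⟩
    exact ⟨c • φ, hφ.const_smul c, (Lp.coeFn_smul c u).trans (hu.const_smul c)⟩

/-- The orthogonal complement is trivial by the fundamental lemma of the calculus of variations. -/
theorem testSubmodule_dense {Ω : Set E3} (hΩ : IsOpen Ω) :
    (testSubmodule Ω).topologicalClosure = ⊤ := by
  rw [Submodule.topologicalClosure_eq_top_iff, Submodule.eq_bot_iff]
  intro u hu
  rw [Submodule.mem_orthogonal'] at hu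
  have h1 : (u : E3 → ℝ) =ᵐ[volume.restrict Ω] (0 : E3 → ℝ) := by
    refine ae_eq_of_forall_test hΩ ?_ locallyIntegrableOn_zero fun φ hφ => ?_
    · exact locallyIntegrableOn_of_locallyIntegrable_restrict
        ((Lp.memLp u).locallyIntegrable (by norm_num))
    · have hm := hφ.memLp 2 (volume.restrict Ω)
      have := hu (hm.toLp φ) ⟨φ, hφ, hm.coeFn_toLp⟩
      rw [Lp_inner_eq] at this
      simpa using this
  exact (Lp.eq_zero_iff_ae_eq_zero).2 h1

/-- A vector of `L²(Ω)` whose products with test functions are bounded by `C ‖φ‖` has norm at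
most `C`. -/
theorem Lp_norm_le_of_forall_test {Ω : Set E3} (hΩ : IsOpen Ω) (u : Lp ℝ 2 (volume.restrict Ω))
    {C : ℝ} (hC : 0 ≤ C) (h : ∀ φ, IsTestFn Ω φ →
      |∫ x in Ω, u x * φ x| ≤ C * √(∫ x in Ω, φ x ^ 2)) : ‖u‖ ≤ C := by
  have key : ∀ v : Lp ℝ 2 (volume.restrict Ω), |inner ℝ u v| ≤ C * ‖v‖ := by
    have hd : Dense (testSubmodule Ω : Set (Lp ℝ 2 (volume.restrict Ω))) := by
      rw [dense_iff_closure_eq, ← Submodule.topologicalClosure_coe, testSubmodule_dense hΩ]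
      rfl
    intro v
    refine hd.induction (P := fun v => |inner ℝ u v| ≤ C * ‖v‖) ?_ ?_ v
    · rintro v ⟨φ, hφ, hv⟩
      have hm := hφ.memLp 2 (volume.restrict Ω)
      have hv' : v = hm.toLp φ := Lp.ext (hv.trans hm.coeFn_toLp.symm)
      rw [hv', Lp_inner_eq, norm_toLp_eq_sqrt]
      exact h φ hφ
    · exact isClosed_le (by fun_prop) (by fun_prop)
  have := key u
  rw [real_inner_self_eq_norm_sq, abs_of_nonneg (sq_nonneg _)] at this
  rcases (norm_nonneg u).eq_or_lt with h0 | h0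
  · rwa [← h0]
  · nlinarith

/-- A bounded sequence of functionals that converges on a dense subspace converges everywhere. The
limit is again a bounded functional by Banach-Steinhaus, and Riesz represents it. Since the limits
on the dense set are known in the applications, no further subsequence is needed. -/
theorem tendsto_inner_of_dense {H : Type*} [NormedAddCommGroup H] [InnerProductSpace ℝ H]
    [CompleteSpace H] (S : Submodule ℝ H) (hS : S.topologicalClosure = ⊤) (u : ℕ → H) {C : ℝ}
    (hC : ∀ n, ‖u n‖ ≤ C) (ℓ : H → ℝ)
    (h : ∀ v ∈ S, Tendsto (fun n => inner ℝ (u n) v) atTop (𝓝 (ℓ v))) :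
    ∃ u₀ : H, ∀ v, Tendsto (fun n => inner ℝ (u n) v) atTop (𝓝 (inner ℝ u₀ v)) := by
  have hd : Dense (S : Set H) := by
    rw [dense_iff_closure_eq, ← Submodule.topologicalClosure_coe, hS]
    rfl
  have hC0 : 0 ≤ C := (norm_nonneg _).trans (hC 0)
  have hcau : ∀ v, CauchySeq fun n => inner ℝ (u n) v := by
    intro v
    rw [Metric.cauchySeq_iff']
    intro ε hε
    -- The replacement of `v` by `w` costs `ε/4` at each of the two indices, which leaves `ε/2` for
    -- the Cauchy estimate at `w`. The `+ 1` keeps the denominator positive.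
    obtain ⟨w, hw, hwv⟩ := hd.exists_dist_lt v (show 0 < ε / (4 * (C + 1)) by positivity)
    obtain ⟨N, hN⟩ := Metric.cauchySeq_iff'.1 (h w hw).cauchySeq (ε / 2) (by positivity)
    refine ⟨N, fun n hn => ?_⟩
    have h1 := hN n hn
    rw [Real.dist_eq] at h1 ⊢
    have h2 : ∀ k, |inner ℝ (u k) (v - w)| ≤ ε / 4 := fun k => by
      refine (abs_real_inner_le_norm _ _).trans ?_
      rw [dist_eq_norm] at hwv
      calc ‖u k‖ * ‖v - w‖ ≤ (C + 1) * (ε / (4 * (C + 1))) := by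
            gcongr
            linarith [hC k]
        _ = ε / 4 := by field_simp
    have e : ∀ k, inner ℝ (u k) v = inner ℝ (u k) w + inner ℝ (u k) (v - w) := fun k => by
      rw [← inner_add_right]; simp
    rw [e n, e N]
    have a := abs_le.1 (h2 n)
    have b := abs_le.1 (h2 N)
    have c := abs_lt.1 h1
    rw [abs_lt]
    constructor <;> linarith [a.1, a.2, b.1, b.2, c.1, c.2]
  choose L hL using fun v => cauchySeq_tendsto_of_complete (hcau v)
  let T : H →L[ℝ] ℝ := continuousLinearMapOfTendsto (fun n => innerSL ℝ (u n)) (f := L) (by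
    rw [tendsto_pi_nhds]; exact hL)
  refine ⟨(InnerProductSpace.toDual ℝ H).symm T, fun v => ?_⟩
  rw [InnerProductSpace.toDual_symm_apply]
  exact hL v

/-- Bounded sequences in `L²(Σ)` that converge against test functions converge weakly. -/
theorem exists_weakL2Tendsto (h : ℕ → E3 → ℝ) (hm : ∀ n, MemLp (h n) 2 volCyl) {C : ℝ}
    (hC : ∀ n, ∫ x in cyl, h n x ^ 2 ≤ C) (ℓ : (E3 → ℝ) → ℝ)
    (hl : ∀ φ, IsTestFn cyl φ → Tendsto (fun n => ∫ x in cyl, h n x * φ x) atTop (𝓝 (ℓ φ))) :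
    ∃ h₀, MemLp h₀ 2 volCyl ∧ WeakL2Tendsto h h₀ := by
  obtain ⟨u₀, hu⟩ := tendsto_inner_of_dense (testSubmodule cyl) (testSubmodule_dense isOpen_cyl)
    (fun n => (hm n).toLp (h n)) (C := √C) (fun n => by
      rw [norm_toLp_eq_sqrt]; exact Real.sqrt_le_sqrt (hC n))
    -- The limits `ℓ` are indexed by functions whereas the dense subspace consists of classes.
    -- `limUnder` transfers them, and its value on other classes is irrelevant.
    (fun v => limUnder atTop fun n => inner ℝ ((hm n).toLp (h n)) v) (by
      rintro v ⟨φ, hφ, hv⟩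
      have hφm := hφ.memLp 2 volCyl
      have hv' : v = hφm.toLp φ := Lp.ext (hv.trans hφm.coeFn_toLp.symm)
      refine tendsto_nhds_limUnder ⟨ℓ φ, ?_⟩
      simp_rw [hv', inner_toLp]
      exact hl φ hφ)
  refine ⟨u₀, Lp.memLp u₀, fun g hg => ?_⟩
  have := hu (hg.toLp g)
  simp_rw [inner_toLp, Lp_inner_eq] at this
  exact this

theorem WeakL2Tendsto.congr {h h' : ℕ → E3 → ℝ} {h₀ h₀' : E3 → ℝ} (H : WeakL2Tendsto h h₀)
    (e : ∀ n, h n =ᵐ[volCyl] h' n) (e₀ : h₀ =ᵐ[volCyl] h₀') : WeakL2Tendsto h' h₀' := by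
  intro g hg
  have h1 : ∀ n, ∫ x in cyl, h' n x * g x = ∫ x in cyl, h n x * g x := fun n =>
    integral_congr_ae (by filter_upwards [e n] with x hx; rw [hx])
  have h2 : ∫ x in cyl, h₀' x * g x = ∫ x in cyl, h₀ x * g x :=
    integral_congr_ae (by filter_upwards [e₀] with x hx; rw [hx])
  simp_rw [h1, h2]
  exact H g hg

theorem WeakL2Tendsto.add_const_mul {h k : ℕ → E3 → ℝ} {h₀ k₀ : E3 → ℝ} (H : WeakL2Tendsto h h₀)
    (K : WeakL2Tendsto k k₀) (c : ℝ) (mh : ∀ n, MemLp (h n) 2 volCyl)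
    (mk : ∀ n, MemLp (k n) 2 volCyl) (mh₀ : MemLp h₀ 2 volCyl) (mk₀ : MemLp k₀ 2 volCyl) :
    WeakL2Tendsto (fun n x => h n x + c * k n x) (fun x => h₀ x + c * k₀ x) := by
  intro g hg
  have e : ∀ a b : E3 → ℝ, MemLp a 2 volCyl → MemLp b 2 volCyl →
      ∫ x in cyl, (a x + c * b x) * g x = (∫ x in cyl, a x * g x) + c * ∫ x in cyl, b x * g x := by
    intro a b ha hb
    rw [← integral_const_mul, ← integral_add (MemLp_mul_integrable ha hg)
      ((MemLp_mul_integrable hb hg).const_mul c)]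
    exact integral_congr_ae (Eventually.of_forall fun x => by ring)
  simp_rw [e _ _ (mh _) (mk _), e _ _ mh₀ mk₀]
  exact (H g hg).add ((K g hg).const_mul c)

/-- Weak lower semicontinuity of the `L²` norm. -/
theorem WeakL2Tendsto.eventually_le {h : ℕ → E3 → ℝ} {h₀ : E3 → ℝ} (H : WeakL2Tendsto h h₀)
    (mh : ∀ n, MemLp (h n) 2 volCyl) (mh₀ : MemLp h₀ 2 volCyl) {ε : ℝ} (hε : 0 < ε) :
    ∀ᶠ n in atTop, ∫ x in cyl, h₀ x ^ 2 ≤ (∫ x in cyl, h n x ^ 2) + ε := by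
  have h1 := H h₀ mh₀
  have h2 : ∫ x in cyl, h₀ x * h₀ x = ∫ x in cyl, h₀ x ^ 2 := by simp_rw [sq]
  rw [h2] at h1
  filter_upwards [h1.eventually (lt_mem_nhds (show (∫ x in cyl, h₀ x ^ 2) - ε / 2 <
    ∫ x in cyl, h₀ x ^ 2 by linarith))] with n hn
  -- Expanding `‖h n - h₀‖² ≥ 0` gives `‖h n‖² ≥ 2⟨h n, h₀⟩ - ‖h₀‖²`. The factor `2` explains the
  -- tolerance `ε/2` for the inner product.
  have h3 : 0 ≤ ∫ x in cyl, (h n x - h₀ x) ^ 2 := integral_nonneg fun x => sq_nonneg _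
  have h4 : ∫ x in cyl, (h n x - h₀ x) ^ 2 =
      (∫ x in cyl, h n x ^ 2) - 2 * (∫ x in cyl, h n x * h₀ x) + ∫ x in cyl, h₀ x ^ 2 := by
    have a1 := (mh n).integrable_sq
    have a2 := (MemLp_mul_integrable (mh n) mh₀).const_mul 2
    rw [← integral_const_mul, ← integral_sub a1 a2]
    have := integral_add (a1.sub a2) mh₀.integrable_sq
    simp only [Pi.sub_apply] at this
    rw [← this]
    exact integral_congr_ae (Eventually.of_forall fun x => by ring)
  linarith

end Nanowire

namespace Nanowire

/-! ### Bounded functions with square integrable gradient -/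

/-- `|f| ≤ 1` in the cylinder and `g` is the weak gradient of `f`, in `L²`. -/
structure BddH1 (f : E3 → ℝ) (g : Fin 3 → E3 → ℝ) : Prop where
  meas : AEStronglyMeasurable f volCyl
  bdd : ∀ᵐ x ∂volCyl, |f x| ≤ 1
  weak : ∀ i, HasWeakPartial cyl i f (g i)
  sq : ∀ i, MemLp (g i) 2 volCyl

theorem partialD_eq_deriv {F : E3 → ℝ} (hF : Differentiable ℝ F) (i : Fin 3) (x : E3) :
    partialD i F x = deriv (fun t : ℝ => F (x + t • EuclideanSpace.single i (1 : ℝ))) 0 := by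
  have := (hF x).lineDeriv_eq_fderiv (v := EuclideanSpace.single i (1 : ℝ))
  rw [partialD, ← this, lineDeriv]

theorem fderiv_eq_sum_partialD (F : E3 → ℝ) (x h : E3) :
    fderiv ℝ F x h = ∑ i, h i * partialD i F x := by
  have : h = ∑ i, h i • EuclideanSpace.single i (1 : ℝ) := by
    ext j
    simp [Finset.sum_apply, Pi.single_apply]
  conv_lhs => rw [this]
  simp [partialD]

/-- A smooth cutoff in the cylinder, depending on the transverse variables only. -/
noncomputable def cutoff (k : ℕ) (x : E3) : ℝ :=
  Real.smoothTransition (k * (1 - (x 1 ^ 2 + x 2 ^ 2)) - 1)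

theorem cutoff_contDiff (k : ℕ) : ContDiff ℝ ∞ (cutoff k) := by
  unfold cutoff
  exact Real.smoothTransition.contDiff.comp (by fun_prop)

theorem cutoff_abs_le (k : ℕ) (x : E3) : |cutoff k x| ≤ 1 := by
  rw [abs_le]
  have h0 : 0 ≤ cutoff k x := Real.smoothTransition.nonneg _
  exact ⟨by linarith,
    Real.smoothTransition.le_one _⟩

theorem cutoff_tendsto {x : E3} (hx : x ∈ cyl) :
    Tendsto (fun k => cutoff k x) atTop (𝓝 1) := by
  have h0 : 0 < 1 - (x 1 ^ 2 + x 2 ^ 2) := sub_pos.2 hx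
  refine tendsto_const_nhds.congr' ?_
  filter_upwards [eventually_ge_atTop ⌈2 / (1 - (x 1 ^ 2 + x 2 ^ 2))⌉₊] with k hk
  have : 2 / (1 - (x 1 ^ 2 + x 2 ^ 2)) ≤ k := (Nat.le_ceil _).trans (by exact_mod_cast hk)
  rw [div_le_iff₀ h0] at this
  exact (Real.smoothTransition.one_of_one_le (by linarith)).symm

theorem tsupport_cutoff (k : ℕ) : tsupport (cutoff k) ⊆ cyl := by
  have hc : IsClosed {x : E3 | 1 ≤ (k : ℝ) * (1 - (x 1 ^ 2 + x 2 ^ 2))} := by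
    apply isClosed_le <;> fun_prop
  refine (closure_minimal ?_ hc).trans ?_
  · intro x hx
    by_contra h
    exact hx (Real.smoothTransition.zero_of_nonpos (by simp at h; linarith))
  · intro x hx
    simp only [mem_ofPred_eq] at hx
    change x 1 ^ 2 + x 2 ^ 2 < 1
    by_contra h
    have : (k : ℝ) * (1 - (x 1 ^ 2 + x 2 ^ 2)) ≤ 0 :=
      mul_nonpos_of_nonneg_of_nonpos (Nat.cast_nonneg k) (by linarith)
    linarith

theorem cutoff_add_smul (k : ℕ) (x : E3) (t : ℝ) :
    cutoff k (x + t • EuclideanSpace.single 0 (1 : ℝ)) = cutoff k x := by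
  simp [cutoff]

theorem IsTestFn.cutoff_mul {φ : E3 → ℝ} (h : IsTestFn univ φ) (k : ℕ) :
    IsTestFn cyl fun x => cutoff k x * φ x :=
  ⟨(h.mul_left (cutoff_contDiff k)).smooth, (h.mul_left (cutoff_contDiff k)).compact,
    (tsupport_mul_subset_left (f := cutoff k)).trans (tsupport_cutoff k)⟩

/-- The cutoff does not depend on `x₁`, so the axial derivative never meets its steep gradient near
the lateral boundary. This is why the axial integration by parts holds up to that boundary. -/
theorem IsTestFn.partialD_cutoff_mul {φ : E3 → ℝ} (h : IsTestFn univ φ) (k : ℕ) (x : E3) :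
    Nanowire.partialD 0 (fun x => cutoff k x * φ x) x = cutoff k x * Nanowire.partialD 0 φ x := by
  rw [partialD_eq_deriv ((h.mul_left (cutoff_contDiff k)).smooth.differentiable (by simp)),
    partialD_eq_deriv (h.smooth.differentiable (by simp))]
  simp_rw [cutoff_add_smul]
  exact deriv_const_mul_field _

/-- Integrability of `f` against compactly supported functions, up to the boundary. -/
def LocInt (f : E3 → ℝ) : Prop := ∀ φ, IsTestFn univ φ → IntegrableOn (fun x => f x * φ x) cyl

theorem MemLp.locInt {f : E3 → ℝ} (hf : MemLp f 2 volCyl) : LocInt f := fun _ hφ =>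
  MemLp_mul_integrable hf (hφ.memLp 2 _)

theorem locInt_of_bound {f : E3 → ℝ} (hf : AEStronglyMeasurable f volCyl) {C : ℝ}
    (h : ∀ᵐ x ∂volCyl, |f x| ≤ C) : LocInt f := fun _ hφ =>
  (hφ.integrable volCyl).bdd_mul hf h

theorem tendsto_integral_cutoff {f φ : E3 → ℝ} (hf : IntegrableOn (fun x => f x * φ x) cyl) :
    Tendsto (fun k => ∫ x in cyl, f x * (cutoff k x * φ x)) atTop
      (𝓝 (∫ x in cyl, f x * φ x)) := by
  refine tendsto_integral_of_dominated_convergence (fun x => |f x * φ x|) (fun k => ?_) hf.abs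
    (fun k => ?_) ?_
  · have := hf.aestronglyMeasurable.mul
      (cutoff_contDiff k).continuous.aestronglyMeasurable (μ := volCyl)
    refine this.congr (Eventually.of_forall fun x => ?_)
    simp only [Pi.mul_apply]
    ring
  · filter_upwards with x
    have : f x * (cutoff k x * φ x) = cutoff k x * (f x * φ x) := by ring
    rw [this, Real.norm_eq_abs, abs_mul]
    exact mul_le_of_le_one_left (abs_nonneg _) (cutoff_abs_le k x)
  · filter_upwards [ae_restrict_mem measurableSet_cyl] with x hx
    have := ((cutoff_tendsto hx).mul_const (φ x)).const_mul (f x)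
    simpa using this

/-- In the direction of the axis, test functions need not vanish at the lateral boundary. -/
theorem HasWeakPartial.parts_zero {f g : E3 → ℝ} (h : HasWeakPartial cyl 0 f g) (hf : LocInt f)
    (hg : LocInt g) {φ : E3 → ℝ} (hφ : IsTestFn univ φ) :
    ∫ x in cyl, f x * partialD 0 φ x = - ∫ x in cyl, g x * φ x := by
  have h1 := tendsto_integral_cutoff (hf _ (hφ.partialD 0))
  have h2 := (tendsto_integral_cutoff (hg _ hφ)).neg
  refine tendsto_nhds_unique h1 (h2.congr fun k => ?_)
  rw [← h.parts _ (hφ.cutoff_mul k)]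
  simp_rw [hφ.partialD_cutoff_mul]

/-! ### Translations -/

theorem measurePreserving_translate (h : E3) :
    MeasurePreserving (fun x : E3 => x + h) (volume.restrict ((fun x : E3 => x + h) ⁻¹' cyl))
      volCyl :=
  (measurePreserving_add_right volume h).restrict_preimage measurableSet_cyl

/-- The points of the cylinder that stay there after translation by `h`. -/
def overlap (h : E3) : Set E3 := {x | x ∈ cyl ∧ x + h ∈ cyl}

theorem isOpen_overlap (h : E3) : IsOpen (overlap h) :=
  isOpen_cyl.inter (isOpen_cyl.preimage (continuous_add_const h))

theorem overlap_subset (h : E3) : overlap h ⊆ cyl := fun _ hx => hx.1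

theorem ae_overlap_translate {P : E3 → Prop} {h : E3} (hP : ∀ᵐ x ∂volCyl, P x) :
    ∀ᵐ x ∂volume.restrict (overlap h), P (x + h) :=
  ae_mono (Measure.restrict_mono (fun _ hx => hx.2) le_rfl)
    ((measurePreserving_translate h).quasiMeasurePreserving.ae hP)

theorem aestronglyMeasurable_translate {f : E3 → ℝ} {h : E3} (hf : AEStronglyMeasurable f volCyl) :
    AEStronglyMeasurable (fun x => f (x + h)) (volume.restrict (overlap h)) :=
  (hf.comp_quasiMeasurePreserving
    (measurePreserving_translate h).quasiMeasurePreserving).mono_measure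
    (Measure.restrict_mono (fun _ hx => hx.2) le_rfl)

/-- Convexity of the disk, from `|(1-s)a + sb|² = (1-s)|a|² + s|b|² - s(1-s)|a-b|²`. It keeps a test
function supported in the overlap inside the cylinder during the whole translation. -/
theorem add_smul_mem_cyl {x h : E3} (hx : x ∈ overlap h) {s : ℝ} (hs : s ∈ Icc (0 : ℝ) 1) :
    x + s • h ∈ cyl := by
  obtain ⟨h1, h2⟩ := hx
  simp only [cyl, mem_ofPred_eq, PiLp.add_apply, PiLp.smul_apply, smul_eq_mul] at *
  obtain ⟨s0, s1⟩ := hs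
  have e : (x 1 + s * h 1) ^ 2 + (x 2 + s * h 2) ^ 2 = (1 - s) * (x 1 ^ 2 + x 2 ^ 2) +
      s * ((x 1 + h 1) ^ 2 + (x 2 + h 2) ^ 2) - s * (1 - s) * (h 1 ^ 2 + h 2 ^ 2) := by ring
  have e2 : 0 ≤ s * (1 - s) * (h 1 ^ 2 + h 2 ^ 2) := by
    have : 0 ≤ 1 - s := by linarith
    positivity
  rw [e]
  rcases s0.eq_or_lt with rfl | s0
  · linarith
  · nlinarith

/-! ### Control of translates by the weak gradient -/

section translation

variable {f : E3 → ℝ} {g : Fin 3 → E3 → ℝ}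

theorem MemLp.sum_dir {g : Fin 3 → E3 → ℝ} (hg : ∀ i, MemLp (g i) 2 volCyl) (h : E3) :
    MemLp (fun x => ∑ i, h i * g i x) 2 volCyl :=
  memLp_finsetSum _ fun i _ => (hg i).const_mul (h i)

theorem BddH1.integrable_mul (H : BddH1 f g) {k : E3 → ℝ} (hk : IntegrableOn k cyl) :
    IntegrableOn (fun x => f x * k x) cyl :=
  hk.bdd_mul H.meas H.bdd

theorem BddH1.parts_dir (H : BddH1 f g) (h : E3) {φ : E3 → ℝ} (hφ : IsTestFn cyl φ) :
    ∫ x in cyl, f x * fderiv ℝ φ x h = - ∫ x in cyl, (∑ i, h i * g i x) * φ x := by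
  simp_rw [fderiv_eq_sum_partialD, Finset.mul_sum, Finset.sum_mul]
  rw [integral_finsetSum, integral_finsetSum, ← Finset.sum_neg_distrib]
  · refine Finset.sum_congr rfl fun i _ => ?_
    have := (H.weak i).parts φ hφ
    have e1 : ∀ x, f x * (h i * partialD i φ x) = h i * (f x * partialD i φ x) := fun x => by ring
    have e2 : ∀ x, h i * g i x * φ x = h i * (g i x * φ x) := fun x => by ring
    simp_rw [e1, e2, integral_const_mul, this]
    ring
  · intro i _
    exact MemLp_mul_integrable ((H.sq i).const_mul (h i)) (hφ.memLp 2 _)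
  · intro i _
    exact H.integrable_mul (((hφ.partialD i).integrable volCyl).const_mul (h i))

/-- The shift is put on the test function, the only smooth factor, and one differentiates under the
integral sign. -/
theorem hasDerivAt_translate (hm : AEStronglyMeasurable f volCyl) (hb : ∀ᵐ x ∂volCyl, |f x| ≤ 1)
    (h : E3) {φ : E3 → ℝ} (hφ : IsTestFn univ φ) (s₀ : ℝ) : HasDerivAt (fun s : ℝ => ∫ x in cyl, f x * φ (x - s • h))
      (∫ x in cyl, f x * (-(fderiv ℝ φ (x - s₀ • h) h))) s₀ := by
  obtain ⟨C, hC0, hC⟩ := (hφ.fderiv_apply h).exists_bound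
  obtain ⟨r, hr⟩ := hφ.compact.isBounded.subset_closedBall 0
  have hφs : ∀ s : ℝ, IsTestFn univ fun x => φ (x - s • h) := fun s =>
    hφ.comp_sub fun _ _ => mem_univ _
  -- This ball contains the supports of all translates with `|s - s₀| < 1`, so a constant on it
  -- dominates the derivatives.
  let K : Set E3 := Metric.closedBall 0 (r + (|s₀| + 1) * ‖h‖)
  refine (hasDerivAt_integral_of_dominated_loc_of_deriv_le (μ := volCyl)
    (F := fun s x => f x * φ (x - s • h)) (F' := fun s x => f x * (-(fderiv ℝ φ (x - s • h) h)))
    (bound := K.indicator fun _ => C) (Metric.ball_mem_nhds s₀ one_pos) ?_ ?_ ?_ ?_ ?_ ?_).2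
  · exact Eventually.of_forall fun s => hm.mul (hφs s).continuous.aestronglyMeasurable
  · exact ((hφs s₀).integrable volCyl).bdd_mul hm hb
  · refine hm.mul (Continuous.aestronglyMeasurable ?_)
    exact ((hφ.fderiv_apply h).continuous.comp (by fun_prop)).neg
  · filter_upwards [hb] with x hx s hs
    by_cases hxK : x ∈ K
    · rw [indicator_of_mem hxK, norm_mul, norm_neg]
      calc ‖f x‖ * ‖fderiv ℝ φ (x - s • h) h‖ ≤ 1 * C := by
            gcongr
            · exact hx
            · exact hC _
        _ = C := one_mul C
    · have : fderiv ℝ φ (x - s • h) h = 0 := by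
        apply image_eq_zero_of_notMem_tsupport (f := fun y => fderiv ℝ φ y h)
        intro hy
        apply hxK
        have h1 := hr (tsupport_fderiv_apply_subset ℝ h hy)
        rw [mem_closedBall_zero_iff] at h1 ⊢
        have h2 : |s| ≤ |s₀| + 1 := by
          rw [Metric.mem_ball, Real.dist_eq] at hs
          have := abs_sub_abs_le_abs_sub s s₀
          linarith
        calc ‖x‖ = ‖(x - s • h) + s • h‖ := by simp
          _ ≤ ‖x - s • h‖ + ‖s • h‖ := norm_add_le _ _
          _ ≤ r + (|s₀| + 1) * ‖h‖ := by
            rw [norm_smul, Real.norm_eq_abs]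
            gcongr
      rw [this, indicator_of_notMem hxK]
      simp
  · rw [integrable_indicator_iff Metric.isClosed_closedBall.measurableSet]
    exact integrableOn_const ((Measure.restrict_apply_le _ _).trans_lt
      (isCompact_closedBall _ _).measure_lt_top).ne
  · filter_upwards with x s _
    have h1 : HasDerivAt (fun s : ℝ => x - s • h) (-h) s := by
      simpa using ((hasDerivAt_id s).smul_const h).const_sub x
    have h2 := ((hφ.smooth.differentiable (by simp) (x - s • h)).hasFDerivAt).comp_hasDerivAt s h1
    rw [map_neg] at h2
    exact h2.const_mul (f x)

/-- The pairing with `φ(· - sh)` has derivative `∫ (h · g) φ(· - sh)` in `s`. By Cauchy-Schwarz this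
is bounded uniformly in `s`, since translation preserves the norm of `φ`. The mean value inequality
on `[0,1]` concludes. -/
theorem BddH1.abs_translate_test_le (H : BddH1 f g) (h : E3) {φ : E3 → ℝ}
    (hφ : IsTestFn (overlap h) φ) :
    |∫ x in overlap h, (f (x + h) - f x) * φ x| ≤
      √(∫ x in cyl, (∑ i, h i * g i x) ^ 2) * √(∫ x in overlap h, φ x ^ 2) := by
  have hs : ∀ s ∈ Icc (0 : ℝ) 1, IsTestFn cyl fun x => φ (x - s • h) := fun s hs =>
    hφ.comp_sub fun x hx => add_smul_mem_cyl hx hs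
  have hφ2 : ∀ s ∈ Icc (0 : ℝ) 1, ∫ x in cyl, φ (x - s • h) ^ 2 = ∫ x in overlap h, φ x ^ 2 := by
    intro s hs'
    simp_rw [pow_two]
    rw [(hs s hs').setIntegral_mul, hφ.setIntegral_mul,
      integral_sub_right_eq_self (fun x => φ x * φ x)]
  have key := norm_image_sub_le_of_norm_deriv_le_segment_01'
    (f := fun s : ℝ => ∫ x in cyl, f x * φ (x - s • h))
    (f' := fun s => ∫ x in cyl, f x * (-(fderiv ℝ φ (x - s • h) h)))
    (C := √(∫ x in cyl, (∑ i, h i * g i x) ^ 2) * √(∫ x in overlap h, φ x ^ 2))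
    (fun s _ => (hasDerivAt_translate H.meas H.bdd h (hφ.mono (subset_univ _)) s).hasDerivWithinAt) ?_
  · have h1 := hs 1 ⟨zero_le_one, le_rfl⟩
    have hφc := hφ.mono (overlap_subset h)
    rw [Real.norm_eq_abs, h1.setIntegral_mul, (hs 0 ⟨le_rfl, zero_le_one⟩).setIntegral_mul] at key
    simp only [one_smul, zero_smul, sub_zero] at key
    have e1 : ∫ x, f x * φ (x - h) = ∫ x, f (x + h) * φ x := by
      rw [← integral_add_right_eq_self _ h]
      simp
    rw [e1, ← hφ.setIntegral_mul fun x => f (x + h), ← hφ.setIntegral_mul, ← integral_sub] at key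
    · simpa only [sub_mul] using key
    · refine (hφ.integrable _).bdd_mul (aestronglyMeasurable_translate H.meas) (c := 1) ?_
      exact ae_overlap_translate H.bdd
    · exact (H.integrable_mul (hφ.integrable volCyl)).mono_set (overlap_subset h)
  · intro s hs'
    have hs'' : s ∈ Icc (0 : ℝ) 1 := Ico_subset_Icc_self hs'
    have e : ∀ x, fderiv ℝ (fun y => φ (y - s • h)) x = fderiv ℝ φ (x - s • h) := fun x =>
      fderiv_comp_sub _
    have h1 := H.parts_dir h (hs s hs'')
    simp_rw [e] at h1
    simp_rw [mul_neg, integral_neg, h1, neg_neg]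
    rw [Real.norm_eq_abs, ← hφ2 s hs'']
    exact abs_integral_mul_le (MemLp.sum_dir H.sq h) ((hs s hs'').memLp 2 _)

/-- Translation estimate in `L²`. -/
theorem BddH1.lintegral_translate_le (H : BddH1 f g) (h : E3) :
    ∫⁻ x in overlap h, ENNReal.ofReal ((f (x + h) - f x) ^ 2) ≤
      ENNReal.ofReal (∫ x in cyl, (∑ i, h i * g i x) ^ 2) := by
  -- The difference of translates is bounded but not yet known to be square integrable on an
  -- unbounded set. On bounded pieces it is, and duality with test functions bounds its norm
  -- independently of `N`.
  let S : ℕ → Set E3 := fun N => overlap h ∩ Metric.ball 0 N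
  have hSo : ∀ N, IsOpen (S N) := fun N => (isOpen_overlap h).inter Metric.isOpen_ball
  have hSm : Monotone S := fun a b hab =>
    inter_subset_inter_right _ (Metric.ball_subset_ball (by exact_mod_cast hab))
  have hSU : overlap h = ⋃ N, S N := by
    rw [← inter_iUnion, Metric.iUnion_ball_nat, inter_univ]
  rw [hSU, setLIntegral_iUnion_of_directed _ hSm.directed_le]
  refine iSup_le fun N => ?_
  have hsub : S N ⊆ overlap h := inter_subset_left
  have : IsFiniteMeasure (volume.restrict (S N)) :=
    ⟨by
      rw [Measure.restrict_apply_univ]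
      exact (measure_mono inter_subset_right).trans_lt measure_ball_lt_top⟩
  have hF : MemLp (fun x => f (x + h) - f x) 2 (volume.restrict (S N)) := by
    refine MemLp.of_bound (C := 2) ?_ ?_
    · exact ((aestronglyMeasurable_translate H.meas).sub (H.meas.mono_measure
        (Measure.restrict_mono (overlap_subset h) le_rfl))).mono_measure
        (Measure.restrict_mono hsub le_rfl)
    · have h1 := ae_mono (Measure.restrict_mono hsub le_rfl) (ae_overlap_translate (h := h) H.bdd)
      have h2 := ae_mono (Measure.restrict_mono (hsub.trans (overlap_subset h)) le_rfl) H.bdd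
      filter_upwards [h1, h2] with x h1 h2
      rw [Real.norm_eq_abs]
      rw [abs_le] at *
      constructor <;> linarith [h1.1, h1.2, h2.1, h2.2]
  have key := Lp_norm_le_of_forall_test (hSo N) (hF.toLp _)
    (Real.sqrt_nonneg (∫ x in cyl, (∑ i, h i * g i x) ^ 2)) fun φ hφ => by
      have h1 := H.abs_translate_test_le h (hφ.mono hsub)
      have h2 : ∫ x in overlap h, φ x ^ 2 = ∫ x in S N, φ x ^ 2 := by
        simp_rw [pow_two]
        exact hφ.setIntegral_mul_of_subset hsub φ
      rw [hφ.setIntegral_mul_of_subset hsub, h2] at h1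
      refine le_trans (le_of_eq ?_) h1
      congr 1
      refine integral_congr_ae ?_
      filter_upwards [hF.coeFn_toLp] with x hx
      rw [hx]
  rw [← ofReal_integral_eq_lintegral_ofReal hF.integrable_sq
    (Eventually.of_forall fun x => sq_nonneg _)]
  refine ENNReal.ofReal_le_ofReal ?_
  rw [norm_toLp_eq_sqrt] at key
  exact (Real.sqrt_le_sqrt_iff (integral_nonneg fun x => sq_nonneg _)).1 key

end translation

end Nanowire

namespace Nanowire

/-! ### Translations along the axis -/

theorem add_smul_e1_mem_cyl (x : E3) (t : ℝ) : x + t • e1 ∈ cyl ↔ x ∈ cyl := by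
  simp [cyl, e1]

theorem overlap_smul_e1 (t : ℝ) : overlap (t • e1) = cyl := by
  ext x
  simp [overlap, add_smul_e1_mem_cyl]

theorem measurePreserving_axis (t : ℝ) :
    MeasurePreserving (fun x : E3 => x + t • e1) volCyl volCyl := by
  have := measurePreserving_translate (t • e1)
  have e : (fun x : E3 => x + t • e1) ⁻¹' cyl = cyl := by
    ext x
    exact add_smul_e1_mem_cyl x t
  rwa [e] at this

theorem setIntegral_axis (F : E3 → ℝ) (t : ℝ) :
    ∫ x in cyl, F (x + t • e1) = ∫ x in cyl, F x :=
  (measurePreserving_axis t).integral_comp (measurableEmbedding_addRight _) F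

theorem MemLp.comp_axis {F : E3 → ℝ} {p : ℝ≥0∞} (hF : MemLp F p volCyl) (t : ℝ) :
    MemLp (fun x => F (x + t • e1)) p volCyl :=
  hF.comp_measurePreserving (measurePreserving_axis t)

theorem setIntegral_axis_mul (F G : E3 → ℝ) (t : ℝ) :
    ∫ x in cyl, F (x + t • e1) * G x = ∫ x in cyl, F x * G (x - t • e1) := by
  rw [← setIntegral_axis (fun x => F x * G (x - t • e1)) t]
  simp

theorem BddH1.of_parts {f : E3 → ℝ} {g : Fin 3 → E3 → ℝ} (hm : AEStronglyMeasurable f volCyl)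
    (hb : ∀ᵐ x ∂volCyl, |f x| ≤ 1) (hg : ∀ i, MemLp (g i) 2 volCyl)
    (h : ∀ i φ, IsTestFn cyl φ → ∫ x in cyl, f x * partialD i φ x = - ∫ x in cyl, g i x * φ x) :
    BddH1 f g where
  meas := hm
  bdd := hb
  sq := hg
  weak i := ⟨locallyIntegrableOn_of_bound hm hb, locallyIntegrableOn_of_locallyIntegrable_restrict
    ((hg i).locallyIntegrable (by norm_num)), h i⟩

theorem BddH1.comp_axis {f : E3 → ℝ} {g : Fin 3 → E3 → ℝ} (H : BddH1 f g) (t : ℝ) :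
    BddH1 (fun x => f (x + t • e1)) (fun i x => g i (x + t • e1)) := by
  refine .of_parts (H.meas.comp_measurePreserving (measurePreserving_axis t))
    ((measurePreserving_axis t).quasiMeasurePreserving.ae H.bdd)
    (fun i => MemLp.comp_axis (H.sq i) t) fun i φ hφ => ?_
  rw [setIntegral_axis_mul, setIntegral_axis_mul]
  have h1 : IsTestFn cyl fun x => φ (x - t • e1) :=
    hφ.comp_sub fun x hx => (add_smul_e1_mem_cyl x t).2 hx
  have h2 := (H.weak i).parts _ h1
  rw [← h2]
  refine integral_congr_ae (Eventually.of_forall fun x => ?_)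
  simp only [partialD]
  rw [fderiv_comp_sub]

theorem integral_add_add {α : Type*} [MeasurableSpace α] {μ : Measure α} {a b c : α → ℝ}
    (ha : Integrable a μ) (hb : Integrable b μ) (hc : Integrable c μ) :
    ∫ x, (a x + b x + c x) ∂μ = (∫ x, a x ∂μ) + (∫ x, b x ∂μ) + ∫ x, c x ∂μ := by
  rw [← integral_add ha hb]
  exact integral_add (ha.add hb) hc

/-! ### The product rule -/

section product

variable {f f' : E3 → ℝ} {g g' : Fin 3 → E3 → ℝ}

/-- Difference quotients in the direction of the axis. -/
noncomputable def quot (f : E3 → ℝ) (n : ℕ) (x : E3) : ℝ :=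
  ((n : ℝ) + 1) * (f (x + (1 / ((n : ℝ) + 1)) • e1) - f x)

theorem tendsto_step : Tendsto (fun n : ℕ => 1 / ((n : ℝ) + 1)) atTop (𝓝[≠] 0) := by
  rw [tendsto_nhdsWithin_iff]
  exact ⟨tendsto_one_div_add_atTop_nhds_zero_nat, Eventually.of_forall fun n => by
    simp only [mem_compl_iff, mem_singleton_iff]; positivity⟩

theorem tendsto_quot_test (hm : AEStronglyMeasurable f volCyl) (hb : ∀ᵐ x ∂volCyl, |f x| ≤ 1)
    {φ : E3 → ℝ} (hφ : IsTestFn univ φ) :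
    Tendsto (fun n => ∫ x in cyl, quot f n x * φ x) atTop
      (𝓝 (-∫ x in cyl, f x * partialD 0 φ x)) := by
  have h1 := (hasDerivAt_translate hm hb e1 hφ 0).tendsto_slope_zero.comp tendsto_step
  have e : ∫ x in cyl, f x * -(fderiv ℝ φ (x - (0 : ℝ) • e1) e1) =
      -∫ x in cyl, f x * partialD 0 φ x := by
    rw [← integral_neg]
    simp [partialD, e1]
  rw [e] at h1
  refine h1.congr fun n => ?_
  have i1 : IntegrableOn (fun x => f x * φ x) cyl := (hφ.integrable volCyl).bdd_mul hm hb
  have i2 : IntegrableOn (fun x => f (x + (1 / ((n : ℝ) + 1)) • e1) * φ x) cyl :=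
    (hφ.integrable volCyl).bdd_mul (hm.comp_measurePreserving (measurePreserving_axis _))
      ((measurePreserving_axis _).quasiMeasurePreserving.ae hb)
  simp only [Function.comp_apply, zero_add, zero_smul, sub_zero, smul_eq_mul]
  rw [← setIntegral_axis_mul, ← integral_sub i2 i1, ← integral_const_mul]
  refine integral_congr_ae (Eventually.of_forall fun x => ?_)
  simp only [quot, one_div, inv_inv]
  ring

theorem BddH1.translate_axis_le (H : BddH1 f g) (t : ℝ) :
    MemLp (fun x => f (x + t • e1) - f x) 2 volCyl ∧
      ∫ x in cyl, (f (x + t • e1) - f x) ^ 2 ≤ t ^ 2 * ∫ x in cyl, g 0 x ^ 2 := by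
  have h1 := H.lintegral_translate_le (t • e1)
  have e : ∀ x, (∑ i, (t • e1) i * g i x) ^ 2 = t ^ 2 * g 0 x ^ 2 := fun x => by
    simp [e1, mul_pow]
  simp_rw [e] at h1
  rw [overlap_smul_e1, integral_const_mul] at h1
  have hm : AEStronglyMeasurable (fun x => f (x + t • e1) - f x) volCyl :=
    (H.meas.comp_measurePreserving (measurePreserving_axis t)).sub H.meas
  have hi : Integrable (fun x => (f (x + t • e1) - f x) ^ 2) volCyl := by
    refine ⟨hm.pow 2, ?_⟩
    rw [hasFiniteIntegral_iff_ofReal (Eventually.of_forall fun x => sq_nonneg _)]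
    exact h1.trans_lt ENNReal.ofReal_lt_top
  refine ⟨(memLp_two_iff_integrable_sq hm).2 hi, ?_⟩
  rw [← ofReal_integral_eq_lintegral_ofReal hi (Eventually.of_forall fun x => sq_nonneg _)] at h1
  exact (ENNReal.ofReal_le_ofReal_iff
    (mul_nonneg (sq_nonneg _) (integral_nonneg fun x => sq_nonneg _))).1 h1

theorem BddH1.memLp_quot (H : BddH1 f g) (n : ℕ) : MemLp (quot f n) 2 volCyl :=
  (H.translate_axis_le _).1.const_mul _

theorem BddH1.integral_quot_sq_le (H : BddH1 f g) (n : ℕ) :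
    ∫ x in cyl, quot f n x ^ 2 ≤ ∫ x in cyl, g 0 x ^ 2 := by
  have h1 := (H.translate_axis_le (1 / ((n : ℝ) + 1))).2
  have h2 : ((n : ℝ) + 1) ^ 2 * (1 / ((n : ℝ) + 1)) ^ 2 = 1 := by field_simp
  simp_rw [quot, mul_pow, integral_const_mul]
  calc _ ≤ ((n : ℝ) + 1) ^ 2 * ((1 / ((n : ℝ) + 1)) ^ 2 * ∫ x in cyl, g 0 x ^ 2) := by gcongr
    _ = _ := by rw [← mul_assoc, h2, one_mul]

/-- The translation estimate bounds the quotients in `L²`, and a discrete integration by parts gives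
their limits against test functions. This allows products to be differentiated without
mollification. -/
theorem BddH1.weak_quot (H : BddH1 f g) : WeakL2Tendsto (quot f) (g 0) := by
  have ht : ∀ φ, IsTestFn cyl φ →
      Tendsto (fun n => ∫ x in cyl, quot f n x * φ x) atTop (𝓝 (∫ x in cyl, g 0 x * φ x)) := by
    intro φ hφ
    have := tendsto_quot_test H.meas H.bdd (hφ.mono (subset_univ _))
    rwa [(H.weak 0).parts φ hφ, neg_neg] at this
  obtain ⟨h₀, hm, hw⟩ := exists_weakL2Tendsto (quot f) H.memLp_quot H.integral_quot_sq_le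
    (fun φ => ∫ x in cyl, g 0 x * φ x) ht
  refine hw.congr (fun _ => ae_eq_rfl) (ae_eq_of_forall_test isOpen_cyl ?_ ?_ fun φ hφ => ?_)
  · exact locallyIntegrableOn_of_locallyIntegrable_restrict (hm.locallyIntegrable (by norm_num))
  · exact (H.weak 0).locInt'
  · exact tendsto_nhds_unique (hw φ (hφ.memLp 2 _)) (ht φ hφ)

theorem BddH1.memLp_mul_test (H : BddH1 f g) {φ : E3 → ℝ} (hφ : MemLp φ 2 volCyl) :
    MemLp (fun x => f x * φ x) 2 volCyl := by
  refine hφ.mono (H.meas.mul hφ.aestronglyMeasurable) ?_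
  filter_upwards [H.bdd] with x hx
  rw [norm_mul]
  exact mul_le_of_le_one_left (norm_nonneg _) hx

/-- The product rule in the direction of the axis. -/
theorem BddH1.product_rule (H : BddH1 f g) (H' : BddH1 f' g') {φ : E3 → ℝ}
    (hφ : IsTestFn univ φ) :
    ∫ x in cyl, f x * f' x * partialD 0 φ x =
      - ∫ x in cyl, (f x * g' 0 x + f' x * g 0 x) * φ x := by
  have hφm := hφ.memLp 2 volCyl
  have hb : ∀ᵐ x ∂volCyl, |f x * f' x| ≤ 1 := by
    filter_upwards [H.bdd, H'.bdd] with x h1 h2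
    rw [abs_mul]
    exact mul_le_one₀ h1 (abs_nonneg _) h2
  have h1 := tendsto_quot_test (f := fun x => f x * f' x) (H.meas.mul H'.meas) hb hφ
  have h2 := H.weak_quot _ (H'.memLp_mul_test hφm)
  have h3 := H'.weak_quot _ (H.memLp_mul_test hφm)
  obtain ⟨C, hC0, hC⟩ := hφ.exists_bound
  have hφq : ∀ n, MemLp (fun x => quot f' n x * φ x) 2 volCyl := fun n => by
    refine ((H'.memLp_quot n).const_mul C).mono
      ((H'.memLp_quot n).aestronglyMeasurable.mul hφm.aestronglyMeasurable)
      (Eventually.of_forall fun x => ?_)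
    rw [norm_mul, norm_mul, mul_comm, Real.norm_of_nonneg hC0]
    exact mul_le_mul_of_nonneg_right (hC x) (norm_nonneg _)
  -- The quotient of `f f'` is `f' quot f + f quot f' + (n+1)⁻¹ quot f quot f'`. In the first two
  -- terms a weakly convergent quotient meets a fixed `L²` function; the last is `O(1/n)` by
  -- Cauchy-Schwarz.
  have h4 : Tendsto (fun n : ℕ => 1 / ((n : ℝ) + 1) * ∫ x in cyl, quot f n x * (quot f' n x * φ x))
      atTop (𝓝 0) := by
    set D := √(∫ x in cyl, g 0 x ^ 2) * √(C ^ 2 * ∫ x in cyl, g' 0 x ^ 2)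
    refine squeeze_zero_norm (a := fun n : ℕ => 1 / ((n : ℝ) + 1) * D) (fun n => ?_) ?_
    · rw [norm_mul, Real.norm_of_nonneg (by positivity)]
      gcongr
      refine (abs_integral_mul_le (H.memLp_quot n) (hφq n)).trans ?_
      have : ∫ x in cyl, (quot f' n x * φ x) ^ 2 ≤ C ^ 2 * ∫ x in cyl, g' 0 x ^ 2 := by
        refine le_trans ?_ (mul_le_mul_of_nonneg_left (H'.integral_quot_sq_le n) (sq_nonneg C))
        rw [← integral_const_mul]
        refine integral_mono (hφq n).integrable_sq ((H'.memLp_quot n).integrable_sq.const_mul _) ?_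
        intro x
        have : φ x ^ 2 ≤ C ^ 2 := sq_le_sq' (abs_le.1 (hC x)).1 (abs_le.1 (hC x)).2
        simp only [mul_pow]
        nlinarith [sq_nonneg (quot f' n x)]
      exact mul_le_mul (Real.sqrt_le_sqrt (H.integral_quot_sq_le n)) (Real.sqrt_le_sqrt this)
        (Real.sqrt_nonneg _) (Real.sqrt_nonneg _)
    · simpa using tendsto_one_div_add_atTop_nhds_zero_nat.mul_const D
  have h5 := (h2.add h3).add h4
  have h6 := tendsto_nhds_unique h1 (h5.congr fun n => ?_)
  · rw [neg_eq_iff_eq_neg] at h6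
    rw [h6, add_zero, ← integral_add (MemLp_mul_integrable (H.sq 0) (H'.memLp_mul_test hφm))
      (MemLp_mul_integrable (H'.sq 0) (H.memLp_mul_test hφm))]
    congr 1
    exact integral_congr_ae (Eventually.of_forall fun x => by ring)
  · rw [← integral_const_mul, ← integral_add_add
      (MemLp_mul_integrable (H.memLp_quot n) (H'.memLp_mul_test hφm))
      (MemLp_mul_integrable (H'.memLp_quot n) (H.memLp_mul_test hφm))
      ((MemLp_mul_integrable (H.memLp_quot n) (hφq n)).const_mul _)]
    refine integral_congr_ae (Eventually.of_forall fun x => ?_)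
    simp only [quot]
    have hn : ((n : ℝ) + 1) ≠ 0 := by positivity
    field_simp
    ring

end product

/-- A map with values in the sphere is orthogonal to its derivative along the axis. -/
theorem sum_mul_partial_zero_eq_zero {f : Fin 3 → E3 → ℝ} {g : Fin 3 → Fin 3 → E3 → ℝ}
    (H : ∀ j, BddH1 (f j) (g j)) (h1 : ∀ᵐ x ∂volCyl, ∑ j, f j x ^ 2 = 1) :
    ∀ᵐ x ∂volCyl, ∑ j, f j x * g j 0 x = 0 := by
  have hm : ∀ j, MemLp (g j 0) 2 volCyl := fun j => (H j).sq 0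
  have hi : ∀ j φ, IsTestFn univ φ → IntegrableOn (fun x => f j x * g j 0 x * φ x) cyl := by
    intro j φ hφ
    have := MemLp_mul_integrable (hm j) ((H j).memLp_mul_test (hφ.memLp 2 volCyl))
    refine this.congr (Eventually.of_forall fun x => by ring)
  refine ae_eq_of_forall_test isOpen_cyl (f := fun x => ∑ j, f j x * g j 0 x) (g := 0) ?_
    locallyIntegrableOn_zero fun φ hφ => ?_
  · refine locallyIntegrableOn_of_locallyIntegrable_restrict ?_
    refine (memLp_finsetSum (μ := volCyl) (p := 2) Finset.univ fun j _ =>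
      (H j).memLp_mul_test (hm j)).locallyIntegrable (by norm_num)
  · have hφ' := hφ.mono (subset_univ cyl)
    -- The squares add up to the constant `1`, whose weak derivative is zero. The product rule then
    -- identifies the left side with minus twice the integral to be shown zero.
    have e1 : ∑ j, ∫ x in cyl, f j x * f j x * partialD 0 φ x = 0 := by
      rw [← integral_finsetSum]
      · have h2 := (hasWeakPartial_of_lipschitz cyl 0 (LipschitzWith.const (1 : ℝ))).parts φ hφ
        have h3 : ∀ x : E3, lineDeriv ℝ (fun _ : E3 => (1 : ℝ)) x
            (EuclideanSpace.single 0 1) = 0 := fun x => by simp [lineDeriv]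
        simp only [h3, zero_mul, integral_zero, neg_zero, one_mul] at h2
        rw [← h2]
        refine integral_congr_ae ?_
        filter_upwards [h1] with x hx
        rw [← Finset.sum_mul]
        simp_rw [← pow_two]
        rw [hx, one_mul]
      · intro j _
        simp_rw [mul_assoc]
        exact (H j).integrable_mul ((H j).integrable_mul ((hφ'.partialD 0).integrable _))
    simp_rw [fun j => (H j).product_rule (H j) hφ', Finset.sum_neg_distrib, neg_eq_zero] at e1
    simp only [Pi.zero_apply, zero_mul, integral_zero]
    simp_rw [Finset.sum_mul]
    rw [integral_finsetSum _ fun j _ => hi j φ hφ']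
    have e2 : ∀ j, ∫ x in cyl, (f j x * g j 0 x + f j x * g j 0 x) * φ x =
        2 * ∫ x in cyl, f j x * g j 0 x * φ x := fun j => by
      rw [← integral_const_mul]
      exact integral_congr_ae (Eventually.of_forall fun x => by ring)
    simp_rw [e2, ← Finset.mul_sum] at e1
    linarith

/-- The gradient vanishes where the function is constant. -/
theorem HasWeakPartial.ae_eq_zero_of_const {i : Fin 3} {f g : E3 → ℝ} {U : Set E3} {c : ℝ}
    (h : HasWeakPartial cyl i f g) (hU : IsOpen U) (hf : ∀ᵐ x ∂volCyl, x ∈ U → f x = c) :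
    ∀ᵐ x ∂volCyl, x ∈ U → g x = 0 := by
  have hO : IsOpen (cyl ∩ U) := isOpen_cyl.inter hU
  have h1 := h.mono (inter_subset_left (s := cyl) (t := U))
  have h2 := hasWeakPartial_of_lipschitz (cyl ∩ U) i (LipschitzWith.const c)
  have h3 := h1.unique hO h2 (by
    rw [EventuallyEq, ae_restrict_iff' hO.measurableSet]
    rw [ae_restrict_iff' measurableSet_cyl] at hf
    filter_upwards [hf] with x hx hx'
    exact hx hx'.1 hx'.2)
  rw [EventuallyEq, ae_restrict_iff' hO.measurableSet] at h3
  rw [ae_restrict_iff' measurableSet_cyl]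
  filter_upwards [h3] with x hx h4 h5
  rw [hx ⟨h4, h5⟩]
  simp [lineDeriv]

theorem isOpen_far (l : ℝ) : IsOpen {x : E3 | l < |x 0|} := by
  apply isOpen_lt <;> fun_prop

/-- Integration by parts along the axis. -/
theorem BddH1.integral_parts {f f' : E3 → ℝ} {g g' : Fin 3 → E3 → ℝ} (H : BddH1 f g)
    (H' : BddH1 f' g') {l : ℝ} (hl : 0 ≤ l) (hf : ∀ᵐ x ∂volCyl, l ≤ |x 0| → f x = 0) :
    ∫ x in cyl, (f x * g' 0 x + f' x * g 0 x) = 0 := by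
  have hg := (H.weak 0).ae_eq_zero_of_const (isOpen_far l) (c := 0)
    (by filter_upwards [hf] with x hx h using hx (le_of_lt h))
  -- Points of the cylinder with `|x₁| ≤ l` have norm below `l + 2`, so `b = 1` near them and its
  -- derivative appears only where `f = 0`.
  let b : ContDiffBump (0 : E3) := ⟨l + 2, l + 3, by linarith, by linarith⟩
  have hb : IsTestFn univ b := ⟨b.contDiff, b.hasCompactSupport, subset_univ _⟩
  have hin : ∀ x ∈ cyl, |x 0| ≤ l → x ∈ Metric.ball (0 : E3) (l + 2) := by
    intro x hx hx0
    rw [mem_ball_zero_iff, EuclideanSpace.norm_eq, Real.sqrt_lt' (by linarith),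
      Fin.sum_univ_three]
    simp only [Real.norm_eq_abs, sq_abs]
    have h1 : x 1 ^ 2 + x 2 ^ 2 < 1 := hx
    have h2 : x 0 ^ 2 ≤ l ^ 2 := sq_le_sq' (abs_le.1 hx0).1 (abs_le.1 hx0).2
    nlinarith
  have h1 := H.product_rule H' hb
  have e1 : ∫ x in cyl, f x * f' x * partialD 0 b x = 0 := by
    rw [← integral_zero E3 ℝ (μ := volCyl)]
    refine integral_congr_ae ?_
    filter_upwards [hf, ae_restrict_mem measurableSet_cyl] with x hx hxc
    rcases le_total l |x 0| with h | h
    · rw [hx h]; simp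
    · have : (b : E3 → ℝ) =ᶠ[𝓝 x] fun _ => 1 := by
        filter_upwards [Metric.isOpen_ball.mem_nhds (hin x hxc h)] with y hy
        exact b.one_of_mem_closedBall (Metric.ball_subset_closedBall hy)
      simp [partialD, this.fderiv_eq]
  rw [e1, eq_comm, neg_eq_zero] at h1
  rw [← h1]
  refine integral_congr_ae ?_
  filter_upwards [hf, hg, ae_restrict_mem measurableSet_cyl] with x hx hx' hxc
  rcases le_or_gt |x 0| l with h | h
  · rw [b.one_of_mem_closedBall (Metric.ball_subset_closedBall (hin x hxc h)), mul_one]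
  · rw [hx h.le, hx' h]; simp

end Nanowire

namespace Nanowire

/-! ### Weak derivatives on the line -/

theorem exists_support_Ioo {ζ : ℝ → ℝ} (hc : HasCompactSupport ζ) :
    ∃ T > 0, tsupport ζ ⊆ Ioo (-T) T := by
  obtain ⟨r, hr⟩ := hc.isBounded.subset_ball 0
  refine ⟨max r 1, by positivity, hr.trans fun x hx => ?_⟩
  rw [mem_ball_zero_iff, Real.norm_eq_abs, abs_lt] at hx
  exact ⟨by linarith [le_max_left r 1, hx.1], hx.2.trans_le (le_max_left _ _)⟩

theorem integral_eq_interval {f : ℝ → ℝ} {T : ℝ} (h : Function.support f ⊆ Ioo (-T) T) :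
    ∫ t, f t = ∫ t in (-T)..T, f t :=
  (intervalIntegral.integral_eq_integral_of_support_subset (h.trans Ioo_subset_Ioc_self)).symm

/-- The zero mean is what makes the primitive started at `-T` vanish again beyond `T`. -/
theorem exists_antideriv {ψ : ℝ → ℝ} (hs : ContDiff ℝ ∞ ψ) (hc : HasCompactSupport ψ)
    (h0 : ∫ t, ψ t = 0) : ∃ ζ : ℝ → ℝ, ContDiff ℝ ∞ ζ ∧ HasCompactSupport ζ ∧ deriv ζ = ψ := by
  obtain ⟨T, hT, hsub⟩ := exists_support_Ioo hc
  have hcont := hs.continuous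
  have hd : ∀ x, HasDerivAt (fun x => ∫ t in (-T)..x, ψ t) (ψ x) x := fun x =>
    intervalIntegral.integral_hasDerivAt_right (hcont.intervalIntegrable _ _)
      (hcont.stronglyMeasurableAtFilter _ _) hcont.continuousAt
  have hdd : deriv (fun x => ∫ t in (-T)..x, ψ t) = ψ := funext fun x => (hd x).deriv
  have hz : ∀ x, x ∉ Ioo (-T) T → ψ x = 0 := fun x hx =>
    image_eq_zero_of_notMem_tsupport fun h => hx (hsub h)
  refine ⟨_, ?_, ?_, hdd⟩
  · rw [contDiff_infty_iff_deriv, hdd]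
    exact ⟨fun x => (hd x).differentiableAt, hs⟩
  · refine HasCompactSupport.of_support_subset_isCompact (isCompact_Icc (a := -T) (b := T)) ?_
    intro x hx
    by_contra hx'
    apply hx
    rw [mem_Icc, not_and_or, not_le, not_le] at hx'
    rcases hx' with h | h
    · change ∫ t in (-T)..x, ψ t = 0
      rw [intervalIntegral.integral_symm, neg_eq_zero]
      refine (intervalIntegral.integral_congr (g := fun _ => 0) fun t ht => ?_).trans (by simp)
      rw [uIcc_of_le h.le] at ht
      exact hz t fun h' => by linarith [h'.1, ht.2]
    · change ∫ t in (-T)..x, ψ t = 0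
      rw [← intervalIntegral.integral_add_adjacent_intervals (b := T)
        (hcont.intervalIntegrable _ _) (hcont.intervalIntegrable _ _), ← integral_eq_interval
        ((subset_tsupport ψ).trans hsub), h0, zero_add]
      refine (intervalIntegral.integral_congr (g := fun _ => 0) fun t ht => ?_).trans (by simp)
      rw [uIcc_of_le h.le] at ht
      exact hz t fun h' => by linarith [h'.2, ht.1]

/-- The primitive is merely absolutely continuous with derivative `g` almost everywhere, so the
integration by parts takes place in that class. -/
theorem integral_primitive_mul_deriv {g ζ : ℝ → ℝ} (hg : LocallyIntegrable g)
    (hs : ContDiff ℝ ∞ ζ) (hc : HasCompactSupport ζ) :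
    ∫ t, (∫ r in (0 : ℝ)..t, g r) * deriv ζ t = -∫ t, g t * ζ t := by
  obtain ⟨T, hT, hsub⟩ := exists_support_Ioo hc
  have hgi : ∀ a b : ℝ, IntervalIntegrable g volume a b := fun a b =>
    intervalIntegrable_iff.2 ((hg.integrableOn_isCompact isCompact_uIcc).mono_set uIoc_subset_uIcc)
  have hz : ∀ x, x ∉ Ioo (-T) T → ζ x = 0 := fun x hx =>
    image_eq_zero_of_notMem_tsupport fun h => hx (hsub h)
  have hac := (hgi (-T) T).absolutelyContinuousOnInterval_intervalIntegral (c := 0)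
    (by rw [mem_uIcc]; left; constructor <;> linarith)
  have hac' := ContDiffOn.absolutelyContinuousOnInterval
    (((hs.of_le (m := 1) (by simp)).contDiffOn (s := uIcc (-T) T)))
  have h1 := hac.integral_mul_deriv_eq_deriv_mul hac'
  rw [hz T (by simp), hz (-T) (by simp), mul_zero, mul_zero, sub_zero, zero_sub] at h1
  rw [integral_eq_interval, integral_eq_interval, h1]
  · congr 1
    refine intervalIntegral.integral_congr_ae ?_
    filter_upwards [LocallyIntegrable.ae_hasDerivAt_integral hg] with x hx _
    rw [(hx 0).deriv]
  · exact ((Function.support_mul_subset_right _ _).trans (subset_tsupport ζ)).trans hsub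
  · refine ((Function.support_mul_subset_right _ _).trans ?_).trans hsub
    exact support_deriv_subset

/-- The lemma of du Bois-Reymond. -/
theorem exists_ae_eq_primitive {f g : ℝ → ℝ} (hf : LocallyIntegrable f) (hg : LocallyIntegrable g)
    (h : ∀ ζ : ℝ → ℝ, ContDiff ℝ ∞ ζ → HasCompactSupport ζ →
      ∫ t, f t * deriv ζ t = -∫ t, g t * ζ t) :
    ∃ c : ℝ, f =ᵐ[volume] fun t => c + ∫ r in (0 : ℝ)..t, g r := by
  set F : ℝ → ℝ := fun t => ∫ r in (0 : ℝ)..t, g r with hF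
  have hgi : ∀ a b : ℝ, IntervalIntegrable g volume a b := fun a b =>
    intervalIntegrable_iff.2 ((hg.integrableOn_isCompact isCompact_uIcc).mono_set uIoc_subset_uIcc)
  have hFc : Continuous F := intervalIntegral.continuous_primitive hgi 0
  obtain ⟨b⟩ : Nonempty (ContDiffBump (0 : ℝ)) := inferInstance
  set β : ℝ → ℝ := fun t => (∫ r, b r)⁻¹ * b t with hβ
  have hβs : ContDiff ℝ ∞ β := contDiff_const.mul b.contDiff
  have hβc : HasCompactSupport β := b.hasCompactSupport.mul_left
  have hβ1 : ∫ t, β t = 1 := by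
    rw [hβ, integral_const_mul, inv_mul_cancel₀ b.integral_pos.ne']
  have hint : ∀ {k ζ : ℝ → ℝ}, LocallyIntegrable k → ContDiff ℝ ∞ ζ → HasCompactSupport ζ →
      Integrable fun t => k t * ζ t := fun hk hs hc =>
    hk.integrable_smul_right_of_hasCompactSupport hs.continuous hc
  refine ⟨∫ t, (f t - F t) * β t, ?_⟩
  set c := ∫ t, (f t - F t) * β t with hcdef
  have hloc : LocallyIntegrable fun t => f t - F t := hf.sub hFc.locallyIntegrable
  have key := ae_eq_of_integral_contDiff_smul_eq hloc (locallyIntegrable_const c) ?_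
  · filter_upwards [key] with t ht
    linarith
  · intro ψ hs hc
    simp only [smul_eq_mul]
    set I := ∫ t, ψ t
    have hψi : Integrable ψ := hs.continuous.integrable_of_hasCompactSupport hc
    have hβi : Integrable β := hβs.continuous.integrable_of_hasCompactSupport hβc
    -- Subtracting `I β` removes the mean of `ψ` and leaves a derivative `ζ'`, to which `f - F` is
    -- orthogonal. Hence `f - F` acts on `ψ` as the constant `c`.
    obtain ⟨ζ, h1, h2, h3⟩ := exists_antideriv (ψ := fun t => ψ t - I * β t)
      (hs.sub (contDiff_const.mul hβs)) (hc.sub hβc.mul_left) (by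
        rw [integral_sub hψi (hβi.const_mul I), integral_const_mul, hβ1, mul_one, sub_self])
    have h4 := h ζ h1 h2
    have h5 := integral_primitive_mul_deriv hg h1 h2
    have hd : ContDiff ℝ ∞ (deriv ζ) := by
      rw [h3]; exact hs.sub (contDiff_const.mul hβs)
    have h6 : ∫ t, (f t - F t) * deriv ζ t = 0 := by
      simp_rw [sub_mul]
      rw [integral_sub (hint hf hd h2.deriv) (hint hFc.locallyIntegrable hd h2.deriv), h4, h5,
        sub_self]
    rw [h3] at h6
    have h7 : ∫ t, (f t - F t) * (ψ t - I * β t) =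
        (∫ t, ψ t * (f t - F t)) - I * c := by
      rw [hcdef, ← integral_const_mul, ← integral_sub]
      · exact integral_congr_ae (Eventually.of_forall fun t => by ring)
      · simpa only [mul_comm] using hint hloc hs hc
      · exact (hint hloc hβs hβc).const_mul I
    rw [integral_mul_const]
    linarith

end Nanowire

namespace Nanowire

/-! ### Sections of the cylinder -/

/-- The unit disk. -/
def disk : Set (Fin 2 → ℝ) := {y | y 0 ^ 2 + y 1 ^ 2 < 1}

theorem isOpen_disk : IsOpen disk := by
  unfold disk
  apply isOpen_lt <;> fun_prop

theorem measurableSet_disk : MeasurableSet disk := isOpen_disk.measurableSet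

theorem abs_le_one_of_mem_disk {y : Fin 2 → ℝ} (hy : y ∈ disk) (i : Fin 2) : |y i| ≤ 1 := by
  have h : y 0 ^ 2 + y 1 ^ 2 < 1 := hy
  rw [← sq_le_one_iff_abs_le_one]
  fin_cases i
  · simp only [Fin.zero_eta]; nlinarith [sq_nonneg (y 1)]
  · simp only [Fin.mk_one]; nlinarith [sq_nonneg (y 0)]

theorem disk_subset_closedBall : disk ⊆ Metric.closedBall 0 1 := fun y hy => by
  rw [mem_closedBall_zero_iff, pi_norm_le_iff_of_nonneg zero_le_one]
  exact abs_le_one_of_mem_disk hy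

theorem volume_disk_lt_top : volume disk < ⊤ :=
  (measure_mono disk_subset_closedBall).trans_lt (isCompact_closedBall _ _).measure_lt_top

/-- Lebesgue measure on the disk. -/
noncomputable abbrev volDisk : Measure (Fin 2 → ℝ) := volume.restrict disk

instance : IsFiniteMeasure volDisk := ⟨by
  rw [Measure.restrict_apply_univ]; exact volume_disk_lt_top⟩

/-- The area of the disk. -/
noncomputable def area : ℝ := volDisk.real univ

theorem area_pos : 0 < area := by
  have h : volume disk ≠ 0 := (isOpen_disk.measure_pos volume ⟨0, by simp [disk]⟩).ne'
  refine ENNReal.toReal_pos ?_ ?_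
  · rwa [Measure.restrict_apply_univ]
  · rw [Measure.restrict_apply_univ]; exact volume_disk_lt_top.ne

/-- The splitting `x = (x₁, x')`. -/
noncomputable def split : E3 ≃ᵐ ℝ × (Fin 2 → ℝ) :=
  (MeasurableEquiv.toLp 2 (Fin 3 → ℝ)).symm.trans (MeasurableEquiv.piFinSuccAbove (fun _ => ℝ) 0)

theorem split_fst (x : E3) : (split x).1 = x 0 := rfl

theorem split_snd (x : E3) (j : Fin 2) : (split x).2 j = x j.succ := rfl

/-- The point with coordinates `t` on the axis and `y` in the transverse plane. -/
noncomputable def join (t : ℝ) (y : Fin 2 → ℝ) : E3 := split.symm (t, y)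

@[simp] theorem join_zero (t : ℝ) (y : Fin 2 → ℝ) : join t y 0 = t := by
  rw [← split_fst, join, MeasurableEquiv.apply_symm_apply]

@[simp] theorem join_succ (t : ℝ) (y : Fin 2 → ℝ) (j : Fin 2) : join t y j.succ = y j := by
  rw [← split_snd, join, MeasurableEquiv.apply_symm_apply]

@[simp] theorem join_one (t : ℝ) (y : Fin 2 → ℝ) : join t y 1 = y 0 := join_succ t y 0

@[simp] theorem join_two (t : ℝ) (y : Fin 2 → ℝ) : join t y 2 = y 1 := join_succ t y 1

theorem join_mem_cyl (t : ℝ) (y : Fin 2 → ℝ) : join t y ∈ cyl ↔ y ∈ disk := by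
  simp [cyl, disk]

theorem measurable_join : Measurable fun p : ℝ × (Fin 2 → ℝ) => join p.1 p.2 :=
  split.symm.measurable

theorem measurePreserving_split_univ :
    MeasurePreserving split volume ((volume : Measure ℝ).prod (volume : Measure (Fin 2 → ℝ))) :=
  (EuclideanSpace.volume_preserving_symm_measurableEquiv_toLp (Fin 3)).trans
    (volume_preserving_piFinSuccAbove (fun _ => ℝ) 0)

theorem measurePreserving_split :
    MeasurePreserving split volCyl ((volume : Measure ℝ).prod volDisk) := by
  have h := measurePreserving_split_univ.restrict_preimage
    (s := (univ : Set ℝ) ×ˢ disk) (MeasurableSet.univ.prod measurableSet_disk)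
  have e : split ⁻¹' ((univ : Set ℝ) ×ˢ disk) = cyl := by
    ext x
    simp only [mem_preimage, mem_prod, mem_univ, true_and]
    rfl
  rw [e, ← Measure.prod_restrict, Measure.restrict_univ] at h
  exact h

theorem measurePreserving_join :
    MeasurePreserving (fun p : ℝ × (Fin 2 → ℝ) => join p.1 p.2)
      ((volume : Measure ℝ).prod volDisk) volCyl :=
  measurePreserving_split.symm split

/-! ### Fubini on the cylinder -/

section fubini

variable {F : E3 → ℝ}

theorem integrable_join (hF : IntegrableOn F cyl) :
    Integrable (fun p : ℝ × (Fin 2 → ℝ) => F (join p.1 p.2)) (volume.prod volDisk) :=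
  measurePreserving_join.integrable_comp_of_integrable hF

theorem setIntegral_cyl (hF : IntegrableOn F cyl) :
    ∫ x in cyl, F x = ∫ t, ∫ y, F (join t y) ∂volDisk := by
  rw [← measurePreserving_join.integral_comp split.symm.measurableEmbedding F]
  exact integral_prod _ (integrable_join hF)

theorem lintegral_cyl {F : E3 → ℝ≥0∞} (hF : AEMeasurable F volCyl) :
    ∫⁻ x in cyl, F x = ∫⁻ t, ∫⁻ y, F (join t y) ∂volDisk := by
  rw [← measurePreserving_join.lintegral_comp_emb split.symm.measurableEmbedding F]
  exact lintegral_prod _ (hF.comp_quasiMeasurePreserving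
    measurePreserving_join.quasiMeasurePreserving)

theorem ae_ae_join {p : E3 → Prop} (h : ∀ᵐ x ∂volCyl, p x) :
    ∀ᵐ t : ℝ, ∀ᵐ y ∂volDisk, p (join t y) :=
  Measure.ae_ae_of_ae_prod (measurePreserving_join.quasiMeasurePreserving.ae h)

theorem ae_axis {p : ℝ → Prop} (h : ∀ᵐ t : ℝ, p t) : ∀ᵐ x ∂volCyl, p (x 0) :=
  (Measure.quasiMeasurePreserving_fst.comp
    measurePreserving_split.quasiMeasurePreserving).ae h

theorem aestronglyMeasurable_axis {v : ℝ → ℝ} (hv : AEStronglyMeasurable v volume) :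
    AEStronglyMeasurable (fun x : E3 => v (x 0)) volCyl :=
  hv.comp_quasiMeasurePreserving (Measure.quasiMeasurePreserving_fst.comp
    measurePreserving_split.quasiMeasurePreserving)

theorem integrableOn_axis {v : ℝ → ℝ} (hv : Integrable v) :
    IntegrableOn (fun x : E3 => v (x 0)) cyl := by
  have h := hv.comp_fst volDisk
  exact measurePreserving_split.integrable_comp_of_integrable h

theorem setIntegral_axis_fun {v : ℝ → ℝ} (hv : Integrable v) :
    ∫ x in cyl, v (x 0) = area * ∫ t, v t := by
  rw [setIntegral_cyl (integrableOn_axis hv)]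
  simp [area, integral_const_mul]

end fubini

/-! ### Averages over sections -/

/-- Integrability over bounded pieces of the cylinder. -/
def TubeInt (f : E3 → ℝ) : Prop := ∀ T : ℝ, IntegrableOn (fun x => (Icc (-T) T).indicator
  (fun _ => (1 : ℝ)) (x 0) * f x) cyl

theorem memLp_tube (T : ℝ) :
    MemLp (fun x : E3 => (Icc (-T) T).indicator (fun _ => (1 : ℝ)) (x 0)) 2 volCyl := by
  have h : Integrable ((Icc (-T) T).indicator (fun _ => (1 : ℝ))) := by
    rw [integrable_indicator_iff measurableSet_Icc]
    exact integrableOn_const measure_Icc_lt_top.ne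
  have hi := integrableOn_axis h
  refine (memLp_two_iff_integrable_sq hi.aestronglyMeasurable).2 (hi.congr ?_)
  filter_upwards with x
  by_cases hx : x 0 ∈ Icc (-T) T <;> simp [hx]

theorem MemLp.tubeInt {f : E3 → ℝ} (hf : MemLp f 2 volCyl) : TubeInt f := fun T =>
  MemLp_mul_integrable (memLp_tube T) hf

theorem integrableOn_tube (T : ℝ) :
    IntegrableOn (fun x : E3 => (Icc (-T) T).indicator (fun _ => (1 : ℝ)) (x 0)) cyl := by
  refine integrableOn_axis ?_
  rw [integrable_indicator_iff measurableSet_Icc]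
  exact integrableOn_const measure_Icc_lt_top.ne

theorem BddH1.tubeInt {f : E3 → ℝ} {g : Fin 3 → E3 → ℝ} (H : BddH1 f g) : TubeInt f := fun T => by
  simp_rw [mul_comm _ (f _)]
  exact H.integrable_mul (integrableOn_tube T)

/-- The average over a section of the cylinder. -/
noncomputable def secAvg (f : E3 → ℝ) (t : ℝ) : ℝ := area⁻¹ * ∫ y, f (join t y) ∂volDisk

theorem TubeInt.locallyIntegrable {f : E3 → ℝ} (hf : TubeInt f) :
    LocallyIntegrable (secAvg f) := by
  rw [locallyIntegrable_iff]
  intro K hK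
  obtain ⟨r, hr⟩ := hK.isBounded.subset_closedBall 0
  rw [Real.closedBall_eq_Icc, zero_sub, zero_add] at hr
  refine IntegrableOn.mono_set ?_ hr
  have h := ((integrable_join (hf r)).integral_prod_left).const_mul area⁻¹
  rw [← integrable_indicator_iff measurableSet_Icc]
  refine h.congr (Eventually.of_forall fun t => ?_)
  by_cases ht : t ∈ Icc (-r) r <;> simp [ht, secAvg]

theorem setIntegral_cyl_mul_axis {f : E3 → ℝ} {ζ : ℝ → ℝ}
    (h : IntegrableOn (fun x => f x * ζ (x 0)) cyl) :
    ∫ x in cyl, f x * ζ (x 0) = area * ∫ t, secAvg f t * ζ t := by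
  rw [setIntegral_cyl h, ← integral_const_mul]
  refine integral_congr_ae (Eventually.of_forall fun t => ?_)
  simp only [join_zero, integral_mul_const, secAvg]
  have := area_pos.ne'
  field_simp

theorem TubeInt.mul_axis {f : E3 → ℝ} (hf : TubeInt f) {ζ : ℝ → ℝ} {T C : ℝ}
    (hm : AEStronglyMeasurable ζ) (hC : ∀ t, |ζ t| ≤ C) (hT : ∀ t, t ∉ Icc (-T) T → ζ t = 0) :
    IntegrableOn (fun x => f x * ζ (x 0)) cyl := by
  have h := (hf T).bdd_mul (f := fun x => ζ (x 0)) (aestronglyMeasurable_axis hm)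
    (Eventually.of_forall fun x => hC (x 0))
  refine h.congr (Eventually.of_forall fun x => ?_)
  by_cases hx : x 0 ∈ Icc (-T) T
  · simp [hx, mul_comm]
  · simp [hT _ hx]

/-- As a function on space, `ζ(x₁)` has neither compact support nor support inside the cylinder. A
bump equal to `1` on the relevant piece of the cylinder supplies the first, and
`HasWeakPartial.parts_zero` makes the second unnecessary. -/
theorem BddH1.secAvg_parts {f : E3 → ℝ} {g : Fin 3 → E3 → ℝ} (H : BddH1 f g) {ζ : ℝ → ℝ}
    (hs : ContDiff ℝ ∞ ζ) (hc : HasCompactSupport ζ) :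
    ∫ t, secAvg f t * deriv ζ t = -∫ t, secAvg (g 0) t * ζ t := by
  obtain ⟨T, hT, hsub⟩ := exists_support_Ioo hc
  let b : ContDiffBump (0 : E3) := ⟨T + 2, T + 3, by linarith, by linarith⟩
  have hin : ∀ x ∈ cyl, |x 0| ≤ T → x ∈ Metric.ball (0 : E3) (T + 2) := by
    intro x hx hx0
    rw [mem_ball_zero_iff, EuclideanSpace.norm_eq, Real.sqrt_lt' (by linarith),
      Fin.sum_univ_three]
    simp only [Real.norm_eq_abs, sq_abs]
    have h1 : x 1 ^ 2 + x 2 ^ 2 < 1 := hx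
    have h2 : x 0 ^ 2 ≤ T ^ 2 := sq_le_sq' (abs_le.1 hx0).1 (abs_le.1 hx0).2
    nlinarith
  have hζ3 : ContDiff ℝ ∞ fun x : E3 => ζ (x 0) :=
    hs.comp (by fun_prop)
  have hφ : IsTestFn univ fun x : E3 => ζ (x 0) * b x :=
    ⟨hζ3.mul b.contDiff, b.hasCompactSupport.mul_left, subset_univ _⟩
  have hz : ∀ t, t ∉ Icc (-T) T → ζ t = 0 := fun t ht =>
    image_eq_zero_of_notMem_tsupport fun h => ht (Ioo_subset_Icc_self (hsub h))
  have hz' : ∀ t, t ∉ Icc (-T) T → deriv ζ t = 0 := fun t ht => by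
    by_contra h
    exact ht (Ioo_subset_Icc_self (hsub (support_deriv_subset h)))
  have hb1 : ∀ x ∈ cyl, |x 0| ≤ T → b x = 1 := fun x hx h =>
    b.one_of_mem_closedBall (Metric.ball_subset_closedBall (hin x hx h))
  have e1 : ∀ x ∈ cyl, ζ (x 0) * b x = ζ (x 0) := fun x hx => by
    by_cases h : x 0 ∈ Icc (-T) T
    · rw [hb1 x hx (abs_le.2 h), mul_one]
    · rw [hz _ h, zero_mul]
  have e2 : ∀ x ∈ cyl, partialD 0 (fun x : E3 => ζ (x 0) * b x) x = deriv ζ (x 0) := fun x hx => by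
    have hv : HasDerivAt (fun t : ℝ => (x + t • EuclideanSpace.single 0 (1 : ℝ) : E3) 0) 1 0 := by
      simpa using (hasDerivAt_id (0 : ℝ)).const_add (x 0)
    by_cases h : x 0 ∈ tsupport ζ
    · have h0 : |x 0| ≤ T := abs_le.2 (Ioo_subset_Icc_self (hsub h))
      have h1 : (fun x : E3 => ζ (x 0) * b x) =ᶠ[𝓝 x] fun x => ζ (x 0) := by
        filter_upwards [Metric.isOpen_ball.mem_nhds (hin x hx h0)] with y hy
        rw [b.one_of_mem_closedBall (Metric.ball_subset_closedBall hy), mul_one]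
      have h2 := partialD_eq_deriv (hζ3.differentiable (by simp)) 0 x
      rw [partialD, h1.fderiv_eq, ← partialD, h2]
      have h3 : HasDerivAt ζ (deriv ζ (x 0))
          ((x + (0 : ℝ) • EuclideanSpace.single 0 (1 : ℝ) : E3) 0) := by
        simpa using (hs.differentiable (by simp) (x 0)).hasDerivAt
      have h4 := (HasDerivAt.comp (h₂ := ζ)
        (h := fun t : ℝ => (x + t • EuclideanSpace.single 0 (1 : ℝ) : E3) 0) 0 h3 hv).deriv
      simpa [Function.comp_def] using h4
    · have h1 : (fun x : E3 => ζ (x 0) * b x) =ᶠ[𝓝 x] fun _ => 0 := by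
        have : {y : E3 | y 0 ∉ tsupport ζ} ∈ 𝓝 x :=
          ((isClosed_tsupport ζ).isOpen_compl.preimage (f := fun y : E3 => y 0)
            (by fun_prop)).mem_nhds h
        filter_upwards [this] with y hy
        rw [image_eq_zero_of_notMem_tsupport hy, zero_mul]
      rw [partialD, h1.fderiv_eq]
      have : deriv ζ (x 0) = 0 := by
        by_contra h'
        exact h (support_deriv_subset h')
      simp [this]
  have key := (H.weak 0).parts_zero (locInt_of_bound H.meas H.bdd) (MemLp.locInt (H.sq 0)) hφ
  have c1 : ∫ x in cyl, f x * partialD 0 (fun x : E3 => ζ (x 0) * b x) x =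
      ∫ x in cyl, f x * deriv ζ (x 0) :=
    setIntegral_congr_fun measurableSet_cyl fun x hx => by simp only [e2 x hx]
  have c2 : ∫ x in cyl, g 0 x * (ζ (x 0) * b x) = ∫ x in cyl, g 0 x * ζ (x 0) :=
    setIntegral_congr_fun measurableSet_cyl fun x hx => by simp only [e1 x hx]
  rw [c1, c2] at key
  obtain ⟨C, hC⟩ := hc.exists_bound_of_continuous hs.continuous
  have hs' : Continuous (deriv ζ) := hs.continuous_deriv (by simp)
  obtain ⟨C', hC'⟩ := hc.deriv.exists_bound_of_continuous hs'
  rw [setIntegral_cyl_mul_axis (H.tubeInt.mul_axis hs'.aestronglyMeasurable hC' hz'),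
    setIntegral_cyl_mul_axis ((MemLp.tubeInt (H.sq 0)).mul_axis
      hs.continuous.aestronglyMeasurable hC hz), ← mul_neg] at key
  exact mul_left_cancel₀ area_pos.ne' key

/-- `u` is the continuous representative of the section averages of `f`. -/
structure IsMean (f : E3 → ℝ) (u : ℝ → ℝ) : Prop where
  cont : Continuous u
  ae_eq : secAvg f =ᵐ[volume] u

theorem TubeInt.integral_interval {g : E3 → ℝ} (hg : TubeInt g) {s t : ℝ} (hst : s ≤ t) :
    ∫ r in s..t, secAvg g r = area⁻¹ * ∫ x in cyl, g x * (Ioc s t).indicator 1 (x 0) := by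
  have hT : ∀ r, r ∉ Icc (-(|s| + |t|)) (|s| + |t|) → (Ioc s t).indicator (1 : ℝ → ℝ) r = 0 := by
    intro r hr
    refine indicator_of_notMem (fun h => hr ⟨?_, ?_⟩) _
    · linarith [neg_abs_le s, h.1, abs_nonneg t]
    · linarith [le_abs_self t, h.2, abs_nonneg s]
  have hC : ∀ r, |(Ioc s t).indicator (1 : ℝ → ℝ) r| ≤ 1 := fun r => by
    by_cases h : r ∈ Ioc s t <;> simp [h]
  rw [setIntegral_cyl_mul_axis (hg.mul_axis
    (stronglyMeasurable_one.indicator measurableSet_Ioc).aestronglyMeasurable hC hT),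
    inv_mul_cancel_left₀ area_pos.ne', intervalIntegral.integral_of_le hst,
    ← integral_indicator measurableSet_Ioc]
  refine integral_congr_ae (Eventually.of_forall fun r => ?_)
  by_cases h : r ∈ Ioc s t <;> simp [h]

/-- Section averages have the averaged axial derivative as weak derivative, so du Bois-Reymond
supplies the continuous representative. The increments are written over the cylinder, ready both for
Cauchy-Schwarz and for bounds by the total variation. -/
theorem BddH1.exists_isMean {f : E3 → ℝ} {g : Fin 3 → E3 → ℝ} (H : BddH1 f g) :
    ∃ u, IsMean f u ∧ ∀ s t, s ≤ t →
      u t - u s = area⁻¹ * ∫ x in cyl, g 0 x * (Ioc s t).indicator 1 (x 0) := by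
  have hg := MemLp.tubeInt (H.sq 0)
  obtain ⟨c, hc⟩ := exists_ae_eq_primitive H.tubeInt.locallyIntegrable hg.locallyIntegrable
    fun ζ hs hcs => H.secAvg_parts hs hcs
  have hgi : ∀ a b : ℝ, IntervalIntegrable (secAvg (g 0)) volume a b := fun a b =>
    intervalIntegrable_iff.2
      ((hg.locallyIntegrable.integrableOn_isCompact isCompact_uIcc).mono_set uIoc_subset_uIcc)
  refine ⟨_, ⟨?_, hc⟩, fun s t hst => ?_⟩
  · exact continuous_const.add (intervalIntegral.continuous_primitive hgi 0)
  · rw [← hg.integral_interval hst, add_sub_add_left_eq_sub,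
      intervalIntegral.integral_interval_sub_left (hgi _ _) (hgi _ _)]

end Nanowire

namespace Nanowire

/-! ### The Poincaré inequality on sections -/

/-- The transverse vector with coordinates `h`. -/
noncomputable def transv (h : Fin 2 → ℝ) : E3 := join 0 h

theorem join_add (t : ℝ) (y h : Fin 2 → ℝ) : join t (y + h) = join t y + transv h := by
  ext i
  refine Fin.cases ?_ (fun j => ?_) i
  · simp [transv]
  · simp only [PiLp.add_apply, transv, join_succ, Pi.add_apply]

theorem measurable_transv : Measurable transv :=
  measurable_join.comp (measurable_const.prodMk measurable_id)

/-- Coordinates of two points of the disk differ by at most `2`, so in the Poincaré argument only a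
bounded set of shifts matters. -/
theorem overlap_transv_eq_empty {h : Fin 2 → ℝ} (hh : h ∉ Metric.closedBall (0 : Fin 2 → ℝ) 2) :
    overlap (transv h) = ∅ := by
  rw [eq_empty_iff_forall_notMem]
  rintro x ⟨h1, h2⟩
  apply hh
  have e : x = join (split x).1 (split x).2 := by simp [join]
  rw [e, ← join_add, join_mem_cyl] at h2
  rw [e, join_mem_cyl] at h1
  have a := abs_le_one_of_mem_disk h1
  have b := abs_le_one_of_mem_disk h2
  rw [mem_closedBall_zero_iff, pi_norm_le_iff_of_nonneg zero_le_two]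
  intro i
  have a' := abs_le.1 (a i)
  have b' := abs_le.1 (b i)
  rw [Pi.add_apply] at b'
  rw [Real.norm_eq_abs, abs_le]
  constructor <;> linarith [a'.1, a'.2, b'.1, b'.2]

theorem sq_sub_avg_le {v : (Fin 2 → ℝ) → ℝ} (hv : MemLp v 2 volDisk) (a : ℝ) :
    (a - area⁻¹ * ∫ z, v z ∂volDisk) ^ 2 ≤ area⁻¹ * ∫ z, (a - v z) ^ 2 ∂volDisk := by
  have hA := area_pos
  have hc : ∀ c : ℝ, MemLp (fun _ : Fin 2 → ℝ => c) 2 volDisk := fun c => memLp_const c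
  have hw : MemLp (fun z => a - v z) 2 volDisk := (hc a).sub hv
  have h1 : a - area⁻¹ * ∫ z, v z ∂volDisk = area⁻¹ * ∫ z, (a - v z) ∂volDisk := by
    rw [integral_sub (integrable_const a) (hv.integrable (by norm_num)), integral_const,
      smul_eq_mul]
    change _ = area⁻¹ * (area * a - _)
    rw [mul_sub, inv_mul_cancel_left₀ hA.ne']
  have h2 := abs_integral_mul_le (hc 1) hw
  simp only [one_mul, one_pow, integral_const, smul_eq_mul, mul_one] at h2
  change _ ≤ √area * _ at h2
  have h0 : 0 ≤ ∫ z, (a - v z) ^ 2 ∂volDisk := integral_nonneg fun z => sq_nonneg _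
  have h3 : (∫ z, (a - v z) ∂volDisk) ^ 2 ≤ area * ∫ z, (a - v z) ^ 2 ∂volDisk := by
    rw [← sq_abs]
    refine (pow_le_pow_left₀ (abs_nonneg _) h2 2).trans ?_
    rw [mul_pow, Real.sq_sqrt hA.le, Real.sq_sqrt h0]
  rw [h1, mul_pow]
  calc area⁻¹ ^ 2 * (∫ z, (a - v z) ∂volDisk) ^ 2
      ≤ area⁻¹ ^ 2 * (area * ∫ z, (a - v z) ^ 2 ∂volDisk) := by gcongr
    _ = area⁻¹ * ∫ z, (a - v z) ^ 2 ∂volDisk := by field_simp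

/-- The constant in the Poincaré inequality. -/
noncomputable def poincareConst : ℝ :=
  area⁻¹ * (8 * volume.real (Metric.closedBall (0 : Fin 2 → ℝ) 2))

theorem poincareConst_nonneg : 0 ≤ poincareConst := by
  have := area_pos
  unfold poincareConst
  positivity

theorem BddH1.congr_left {f f' : E3 → ℝ} {g : Fin 3 → E3 → ℝ} (H : BddH1 f g)
    (h : f =ᵐ[volCyl] f') : BddH1 f' g where
  meas := H.meas.congr h
  bdd := by filter_upwards [H.bdd, h] with x h1 h2; rwa [← h2]
  weak i := (H.weak i).congr h ae_eq_rfl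
  sq := H.sq

theorem BddH1.lintegral_overlap_le {f : E3 → ℝ} {g : Fin 3 → E3 → ℝ} (H : BddH1 f g)
    (h : Fin 2 → ℝ) :
    ∫⁻ x in overlap (transv h), ENNReal.ofReal ((f (x + transv h) - f x) ^ 2) ≤
      (Metric.closedBall (0 : Fin 2 → ℝ) 2).indicator
        (fun _ => ENNReal.ofReal (8 * ∫ x in cyl, (g 1 x ^ 2 + g 2 x ^ 2))) h := by
  by_cases hh : h ∈ Metric.closedBall (0 : Fin 2 → ℝ) 2
  · rw [indicator_of_mem hh]
    refine (H.lintegral_translate_le _).trans (ENNReal.ofReal_le_ofReal ?_)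
    rw [← integral_const_mul]
    refine integral_mono (MemLp.sum_dir H.sq _).integrable_sq
      (((H.sq 1).integrable_sq.add (H.sq 2).integrable_sq).const_mul 8) fun x => ?_
    rw [mem_closedBall_zero_iff, pi_norm_le_iff_of_nonneg zero_le_two] at hh
    have h0 := abs_le.1 (hh 0)
    have h1 := abs_le.1 (hh 1)
    simp only [Fin.sum_univ_three, transv, join_zero, join_one, join_two, zero_mul, zero_add]
    have k0 : h 0 ^ 2 ≤ 4 := by nlinarith
    have k1 : h 1 ^ 2 ≤ 4 := by nlinarith
    -- Cauchy-Schwarz with `h₀² + h₁² ≤ 4 + 4`, the source of the constant `8`.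
    nlinarith [sq_nonneg (h 0 * g 2 x - h 1 * g 1 x), sq_nonneg (g 1 x), sq_nonneg (g 2 x),
      mul_nonneg (sub_nonneg.2 k0) (sq_nonneg (g 1 x)),
      mul_nonneg (sub_nonneg.2 k0) (sq_nonneg (g 2 x)),
      mul_nonneg (sub_nonneg.2 k1) (sq_nonneg (g 1 x)),
      mul_nonneg (sub_nonneg.2 k1) (sq_nonneg (g 2 x))]
  · rw [overlap_transv_eq_empty hh]
    simp

/-- The squared distance to the average is at most the mean of `(f(y) - f(z))²` over `z` in the
section. With `z = y + h` and the order of integration exchanged, the integral for fixed `h` is the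
one bounded by the translation estimate; it remains to integrate over the bounded set of shifts. -/
theorem BddH1.lintegral_poincare {f : E3 → ℝ} {g : Fin 3 → E3 → ℝ} (H : BddH1 f g)
    (hf : Measurable f) :
    ∫⁻ x in cyl, ENNReal.ofReal ((f x - secAvg f (x 0)) ^ 2) ≤
      ENNReal.ofReal (poincareConst * ∫ x in cyl, (g 1 x ^ 2 + g 2 x ^ 2)) := by
  have hA := area_pos
  let K : E3 → (Fin 2 → ℝ) → ℝ≥0∞ := fun x h =>
    {p : E3 × (Fin 2 → ℝ) | p.1 + transv p.2 ∈ cyl}.indicator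
      (fun p => ENNReal.ofReal ((f (p.1 + transv p.2) - f p.1) ^ 2)) (x, h)
  have hmap : Measurable fun p : E3 × (Fin 2 → ℝ) => p.1 + transv p.2 :=
    measurable_fst.add (measurable_transv.comp measurable_snd)
  have hK : Measurable (Function.uncurry K) :=
    Measurable.indicator (((hf.comp hmap).sub (hf.comp measurable_fst)).pow_const 2).ennreal_ofReal
      (hmap measurableSet_cyl)
  have hKl : Measurable fun x => ∫⁻ h, K x h :=
    hK.lintegral_prod_right' (f := Function.uncurry K)
  have hfj : ∀ t, Measurable fun y => f (join t y) := fun t =>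
    hf.comp (measurable_join.comp measurable_prodMk_left)
  have hsec : AEStronglyMeasurable (secAvg f) volume :=
    H.tubeInt.locallyIntegrable.aestronglyMeasurable
  have step1 : ∫⁻ x in cyl, ENNReal.ofReal ((f x - secAvg f (x 0)) ^ 2) ≤
      ∫⁻ x in cyl, ENNReal.ofReal area⁻¹ * ∫⁻ h, K x h := by
    have m1 : AEMeasurable (fun x => ENNReal.ofReal ((f x - secAvg f (x 0)) ^ 2)) volCyl :=
      ((H.meas.sub (aestronglyMeasurable_axis hsec)).pow 2).aemeasurable.ennreal_ofReal
    rw [lintegral_cyl m1, lintegral_cyl (hKl.const_mul _).aemeasurable]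
    refine lintegral_mono_ae ?_
    filter_upwards [ae_ae_join H.bdd] with t ht
    refine lintegral_mono fun y => ?_
    have hv : MemLp (fun z => f (join t z)) 2 volDisk :=
      MemLp.of_bound (hfj t).aestronglyMeasurable 1 ht
    have hw : MemLp (fun z => f (join t y) - f (join t z)) 2 volDisk := (memLp_const _).sub hv
    rw [join_zero]
    calc ENNReal.ofReal ((f (join t y) - secAvg f t) ^ 2)
        ≤ ENNReal.ofReal (area⁻¹ * ∫ z, (f (join t y) - f (join t z)) ^ 2 ∂volDisk) :=
          ENNReal.ofReal_le_ofReal (sq_sub_avg_le hv _)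
      _ = ENNReal.ofReal area⁻¹ *
          ∫⁻ z, ENNReal.ofReal ((f (join t y) - f (join t z)) ^ 2) ∂volDisk := by
        rw [ENNReal.ofReal_mul (inv_nonneg.2 hA.le), ofReal_integral_eq_lintegral_ofReal
          hw.integrable_sq (Eventually.of_forall fun z => sq_nonneg _)]
      _ = ENNReal.ofReal area⁻¹ * ∫⁻ h, K (join t y) h := by
        congr 1
        -- Substitution `z = y + h`; the indicator in `K` records that `y + h` must stay in the
        -- disk.
        rw [← lintegral_indicator measurableSet_disk, ← lintegral_add_left_eq_self _ y]
        refine lintegral_congr fun h => ?_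
        have hiff : join t y + transv h ∈ cyl ↔ y + h ∈ disk := by rw [← join_add, join_mem_cyl]
        by_cases hy : y + h ∈ disk
        · have hy' : (join t y, h) ∈ {p : E3 × (Fin 2 → ℝ) | p.1 + transv p.2 ∈ cyl} := hiff.2 hy
          simp only [K]
          rw [indicator_of_mem hy, indicator_of_mem hy', join_add, ← neg_sub, neg_sq]
        · have hy' : (join t y, h) ∉ {p : E3 × (Fin 2 → ℝ) | p.1 + transv p.2 ∈ cyl} :=
            fun h' => hy (hiff.1 h')
          simp only [K]
          rw [indicator_of_notMem hy, indicator_of_notMem hy']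
  have step2 : ∫⁻ x in cyl, ∫⁻ h, K x h =
      ∫⁻ h, ∫⁻ x in overlap (transv h), ENNReal.ofReal ((f (x + transv h) - f x) ^ 2) := by
    rw [lintegral_lintegral_swap hK.aemeasurable]
    refine lintegral_congr fun h => ?_
    have hms : MeasurableSet ((fun x : E3 => x + transv h) ⁻¹' cyl) :=
      (measurable_add_const _) measurableSet_cyl
    have e : overlap (transv h) = ((fun x : E3 => x + transv h) ⁻¹' cyl) ∩ cyl := by
      ext x; simp [overlap, and_comm]
    rw [e, ← Measure.restrict_restrict hms, ← lintegral_indicator hms]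
    rfl
  refine step1.trans ?_
  rw [lintegral_const_mul _ hKl, step2]
  have step3 := lintegral_mono (μ := volume) fun h => H.lintegral_overlap_le h
  rw [lintegral_indicator Metric.isClosed_closedBall.measurableSet, setLIntegral_const] at step3
  refine (mul_le_mul_right step3 _).trans (le_of_eq ?_)
  have hfin : volume (Metric.closedBall (0 : Fin 2 → ℝ) 2) ≠ ⊤ :=
    (isCompact_closedBall _ _).measure_lt_top.ne
  rw [← ENNReal.ofReal_toReal hfin, ← ENNReal.ofReal_mul (mul_nonneg (by norm_num)
    (integral_nonneg fun x => by positivity)), ← ENNReal.ofReal_mul (inv_nonneg.2 hA.le)]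
  congr 1
  simp only [poincareConst, Measure.real]
  ring

theorem BddH1.poincare {f : E3 → ℝ} {g : Fin 3 → E3 → ℝ} (H : BddH1 f g) {u : ℝ → ℝ}
    (hu : IsMean f u) :
    MemLp (fun x => f x - u (x 0)) 2 volCyl ∧ ∫ x in cyl, (f x - u (x 0)) ^ 2 ≤
      poincareConst * ∫ x in cyl, (g 1 x ^ 2 + g 2 x ^ 2) := by
  -- The kernel `K` must be jointly measurable in point and shift, so a genuinely measurable
  -- representative is needed.
  set f' := H.meas.mk f with hf'
  have hff : f =ᵐ[volCyl] f' := H.meas.ae_eq_mk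
  have h1 := (H.congr_left hff).lintegral_poincare H.meas.stronglyMeasurable_mk.measurable
  have hsec : secAvg f' =ᵐ[volume] u := by
    refine EventuallyEq.trans ?_ hu.ae_eq
    filter_upwards [ae_ae_join hff] with t ht
    simp only [secAvg]
    congr 1
    exact integral_congr_ae (by filter_upwards [ht] with y hy using hy.symm)
  have hfu : (fun x => (f' x - secAvg f' (x 0)) ^ 2) =ᵐ[volCyl] fun x => (f x - u (x 0)) ^ 2 := by
    filter_upwards [hff, ae_axis hsec] with x h2 h3
    rw [← h2, h3]
  have hm : AEStronglyMeasurable (fun x => f x - u (x 0)) volCyl :=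
    H.meas.sub (aestronglyMeasurable_axis hu.cont.aestronglyMeasurable)
  rw [lintegral_congr_ae (hfu.mono fun x hx => by simp only at hx; rw [hx])] at h1
  have hi : Integrable (fun x => (f x - u (x 0)) ^ 2) volCyl := by
    refine ⟨hm.pow 2, ?_⟩
    rw [hasFiniteIntegral_iff_ofReal (Eventually.of_forall fun x => sq_nonneg _)]
    exact h1.trans_lt ENNReal.ofReal_lt_top
  refine ⟨(memLp_two_iff_integrable_sq hm).2 hi, ?_⟩
  rw [← ofReal_integral_eq_lintegral_ofReal hi (Eventually.of_forall fun x => sq_nonneg _)] at h1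
  exact (ENNReal.ofReal_le_ofReal_iff (mul_nonneg poincareConst_nonneg
    (integral_nonneg fun x => by positivity))).1 h1

end Nanowire

namespace Nanowire

/-! ### The stray field -/

theorem tendsto_integral_mul_of_eLpNorm {α : Type*} [MeasurableSpace α] {μ : Measure α}
    {h : ℕ → α → ℝ} {h₀ k : α → ℝ} (hh : ∀ n, MemLp (h n) 2 μ) (hh₀ : MemLp h₀ 2 μ)
    (hk : MemLp k 2 μ) (hl : Tendsto (fun n => eLpNorm (h n - h₀) 2 μ) atTop (𝓝 0)) :
    Tendsto (fun n => ∫ x, h n x * k x ∂μ) atTop (𝓝 (∫ x, h₀ x * k x ∂μ)) := by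
  simp_rw [← inner_toLp (hh _) hk, ← inner_toLp hh₀ hk]
  refine Tendsto.inner ?_ tendsto_const_nhds
  rwa [Lp.tendsto_Lp_iff_tendsto_eLpNorm'' h hh h₀ hh₀]

namespace Params

variable (p : Params)

theorem rho_pos : 0 < p.rho := div_pos p.d_pos (Real.sqrt_pos.2 p.Q_pos)

theorem eta_pos : 0 < p.eta := div_pos p.R_pos p.rho_pos

theorem len_pos : 0 < p.len := div_pos p.L_pos p.rho_pos

theorem scale_zero : p.scale 0 = 1 := by simp [scale]

theorem scale_one : p.scale 1 = 1 / p.eta := by simp [scale]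

theorem scale_two : p.scale 2 = 1 / p.eta := by simp [scale]

end Params

theorem integral_indicator_Icc (l : ℝ) (hl : 0 ≤ l) :
    ∫ t, (Icc (-l) l).indicator (fun _ => (1 : ℝ)) t = 2 * l := by
  rw [integral_indicator measurableSet_Icc]
  simp only [integral_const, smul_eq_mul, mul_one, measureReal_restrict_apply_univ,
    Real.volume_real_Icc]
  rw [max_eq_left (by linarith)]
  ring

theorem integral_tube {l : ℝ} (hl : 0 ≤ l) :
    ∫ x in cyl, (Icc (-l) l).indicator (fun _ => (1 : ℝ)) (x 0) = area * (2 * l) := by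
  rw [setIntegral_axis_fun, integral_indicator_Icc l hl]
  rw [integrable_indicator_iff measurableSet_Icc]
  exact integrableOn_const measure_Icc_lt_top.ne

theorem measurableSet_wire (p : Params) : MeasurableSet (wire p) :=
  measurableSet_cyl.inter (isOpen_lt (f := fun x : E3 => |x 0|) (g := fun _ => p.len)
    (by fun_prop) (by fun_prop)).measurableSet

theorem wire_subset (p : Params) : wire p ⊆ cyl := fun _ hx => hx.1

section stray

variable {p : Params} {m : E3 → E3}

theorem MemH1.meas_coord (h : MemH1 m) (j : Fin 3) :
    AEStronglyMeasurable (fun x => m x j) volCyl :=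
  (EuclideanSpace.proj (𝕜 := ℝ) j).continuous.comp_aestronglyMeasurable h.meas

theorem MemH1.sum_sq (h : MemH1 m) : ∀ᵐ x ∂volCyl, ∑ j, m x j ^ 2 = 1 := by
  filter_upwards [h.sphere] with x hx
  have := EuclideanSpace.real_norm_sq_eq (m x)
  rw [hx] at this
  linarith

theorem MemH1.abs_le (h : MemH1 m) (j : Fin 3) : ∀ᵐ x ∂volCyl, |m x j| ≤ 1 := by
  filter_upwards [h.sphere] with x hx
  rw [← hx]
  exact PiLp.norm_apply_le (m x) j

theorem MemH1.memLp_wire (h : MemH1 m) (p : Params) (j : Fin 3) :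
    MemLp ((wire p).indicator fun x => m x j) 2 volume := by
  rw [memLp_indicator_iff_restrict (measurableSet_wire p)]
  have : IsFiniteMeasure (volume.restrict (wire p)) := ⟨by
    rw [Measure.restrict_apply_univ]
    refine (measure_mono (t := Metric.ball (0 : E3) (p.len + 1)) ?_).trans_lt measure_ball_lt_top
    rintro x ⟨hx, hx0⟩
    have hl := p.len_pos
    rw [mem_ball_zero_iff, EuclideanSpace.norm_eq, Real.sqrt_lt' (by linarith),
      Fin.sum_univ_three]
    simp only [Real.norm_eq_abs, sq_abs]
    have h1 : x 1 ^ 2 + x 2 ^ 2 < 1 := hx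
    have h2 : x 0 ^ 2 ≤ p.len ^ 2 := sq_le_sq' (by linarith [(abs_lt.1 hx0).1]) (abs_lt.1 hx0).2.le
    nlinarith⟩
  exact MemLp.of_bound ((h.meas_coord j).mono_measure
    (Measure.restrict_mono (wire_subset p) le_rfl)) 1
    (ae_mono (Measure.restrict_mono (wire_subset p) le_rfl) (h.abs_le j))

theorem MemH1.sum_integral_wire_le (h : MemH1 m) (p : Params) :
    ∑ j, ∫ x, (wire p).indicator (fun x => m x j) x ^ 2 ≤ area * (2 * p.len) := by
  rw [← integral_finsetSum _ fun j _ => (h.memLp_wire p j).integrable_sq,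
    ← integral_tube p.len_pos.le, ← integral_indicator measurableSet_cyl]
  refine integral_mono_ae (integrable_finsetSum _ fun j _ => (h.memLp_wire p j).integrable_sq)
    ((integrable_indicator_iff measurableSet_cyl).2 (integrableOn_tube p.len)) ?_
  have := h.sum_sq
  rw [ae_restrict_iff' measurableSet_cyl] at this
  filter_upwards [this] with x hx
  by_cases hw : x ∈ wire p
  · have h2 : x 0 ∈ Icc (-p.len) p.len := ⟨(abs_lt.1 hw.2).1.le, (abs_lt.1 hw.2).2.le⟩
    simp [hw, hw.1, h2, hx hw.1]
  · simp only [indicator_of_notMem hw]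
    simp only [ne_eq, OfNat.ofNat_ne_zero, not_false_eq_true, zero_pow, Finset.sum_const_zero]
    exact indicator_nonneg (fun y _ => indicator_nonneg (fun _ _ => zero_le_one) _) x

/-- The equation is tested with smooth approximations of `U`. In the limit the energy equals `η⁻¹`
times the pairing of `m` with the rescaled gradient of `U`. Young's inequality absorbs half of it
and leaves `η⁻²` times the volume of the wire, since `|m| = 1`. -/
theorem IsStrayPotential.energy_le {U : E3 → ℝ} {G : Fin 3 → E3 → ℝ}
    (h : IsStrayPotential p m U G) (hm : MemH1 m) :
    ∫ x, ∑ i, (p.scale i * G i x) ^ 2 ≤ (1 / p.eta) ^ 2 * (area * (2 * p.len)) := by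
  obtain ⟨ζ, hζ, -, hlim⟩ := h.sobolev.approx
  have hG := h.sobolev.memLp_grad
  have hk := hm.memLp_wire p
  have hd : ∀ n i, MemLp (partialD i (ζ n)) 2 volume := fun n i => ((hζ n).partialD i).memLp 2 _
  have e : ∀ n, ∑ i, p.scale i ^ 2 * ∫ x, partialD i (ζ n) x * G i x =
      1 / p.eta * ∑ i, p.scale i * ∫ x, partialD i (ζ n) x *
        (wire p).indicator (fun x => m x i) x := by
    intro n
    have h1 := h.eqn (ζ n) (hζ n)
    rw [← integral_indicator (measurableSet_wire p)] at h1
    have h2 : ∀ i, p.scale i ^ 2 * ∫ x, partialD i (ζ n) x * G i x =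
        ∫ x, (p.scale i * G i x) * (p.scale i * partialD i (ζ n) x) := fun i => by
      rw [← integral_const_mul]
      exact integral_congr_ae (Eventually.of_forall fun x => by ring)
    have h3 : ∀ i, p.scale i * ∫ x, partialD i (ζ n) x * (wire p).indicator (fun x => m x i) x =
        ∫ x, (wire p).indicator (fun x => m x i) x * (p.scale i * partialD i (ζ n) x) := fun i => by
      rw [← integral_const_mul]
      exact integral_congr_ae (Eventually.of_forall fun x => by ring)
    simp_rw [h2, h3]
    rw [← integral_finsetSum, h1, ← integral_finsetSum]
    · congr 2
      ext x
      by_cases hx : x ∈ wire p <;> simp [hx]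
    · exact fun i _ => MemLp_mul_integrable (hk i) ((hd n i).const_mul _)
    · exact fun i _ => MemLp_mul_integrable ((hG i).const_mul _) ((hd n i).const_mul _)
  have l1 : Tendsto (fun n => ∑ i, p.scale i ^ 2 * ∫ x, partialD i (ζ n) x * G i x) atTop
      (𝓝 (∑ i, p.scale i ^ 2 * ∫ x, G i x * G i x)) := tendsto_finsetSum _ fun i _ =>
    (tendsto_integral_mul_of_eLpNorm (fun n => hd n i) (hG i) (hG i) (hlim i)).const_mul _
  have l2 : Tendsto (fun n => 1 / p.eta * ∑ i, p.scale i * ∫ x, partialD i (ζ n) x *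
      (wire p).indicator (fun x => m x i) x) atTop (𝓝 (1 / p.eta * ∑ i, p.scale i * ∫ x, G i x *
      (wire p).indicator (fun x => m x i) x)) := (tendsto_finsetSum _ fun i _ =>
    (tendsto_integral_mul_of_eLpNorm (fun n => hd n i) (hG i) (hk i) (hlim i)).const_mul _).const_mul _
  simp_rw [e] at l1
  have key := tendsto_nhds_unique l1 l2
  have hA : ∫ x, ∑ i, (p.scale i * G i x) ^ 2 = ∑ i, p.scale i ^ 2 * ∫ x, G i x * G i x := by
    rw [integral_finsetSum _ fun i _ => ((hG i).const_mul _).integrable_sq]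
    refine Finset.sum_congr rfl fun i _ => ?_
    rw [← integral_const_mul]
    exact integral_congr_ae (Eventually.of_forall fun x => by ring)
  have hB : ∀ i, 1 / p.eta * (p.scale i * ∫ x, G i x * (wire p).indicator (fun x => m x i) x) ≤
      (p.scale i ^ 2 * ∫ x, G i x * G i x) / 2 +
        (1 / p.eta) ^ 2 * (∫ x, (wire p).indicator (fun x => m x i) x ^ 2) / 2 := by
    intro i
    have i1 := (MemLp_mul_integrable (hG i) (hG i)).const_mul (p.scale i ^ 2)
    have i2 := (hk i).integrable_sq.const_mul ((1 / p.eta) ^ 2)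
    rw [← integral_const_mul, ← integral_const_mul, ← integral_const_mul, ← integral_const_mul,
      ← integral_div, ← integral_div, ← integral_add (i1.div_const 2) (i2.div_const 2)]
    refine integral_mono (((MemLp_mul_integrable (hG i) (hk i)).const_mul _).const_mul _)
      ((i1.div_const 2).add (i2.div_const 2)) fun x => ?_
    simp only
    nlinarith [sq_nonneg (p.scale i * G i x -
      1 / p.eta * (wire p).indicator (fun x => m x i) x)]
  have hC := Finset.sum_le_sum fun i (_ : i ∈ Finset.univ) => hB i
  rw [← Finset.mul_sum, ← key, Finset.sum_add_distrib, ← Finset.sum_div, ← Finset.sum_div,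
    ← Finset.mul_sum] at hC
  rw [hA]
  have hD := mul_le_mul_of_nonneg_left (hm.sum_integral_wire_le p) (sq_nonneg (1 / p.eta))
  linarith

theorem strayEnergy_nonneg (p : Params) (m : E3 → E3) : 0 ≤ strayEnergy p m := by
  unfold strayEnergy
  split_ifs
  · exact integral_nonneg fun x => Finset.sum_nonneg fun i _ => sq_nonneg _
  · exact le_rfl

/-- The bound holds for every potential and for the default value `0`, so neither existence nor
uniqueness of the potential is used. -/
theorem MemH1.strayEnergy_le (hm : MemH1 m) (p : Params) :
    strayEnergy p m ≤ (1 / p.eta) ^ 2 * (area * (2 * p.len)) := by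
  unfold strayEnergy
  split_ifs with h
  · obtain ⟨U, hU⟩ := h.choose_spec
    exact hU.energy_le hm
  · have := area_pos
    have := p.len_pos
    positivity

/-- Since `R/η = ρ` and the wire has length `2L/ρ`, the prefactor turns the bound into the quantity
`ρL/d²` that the regime sends to zero. -/
theorem MemH1.stray_term_le (hm : MemH1 m) (p : Params) :
    p.R ^ 2 / p.d ^ 2 * strayEnergy p m ≤ 2 * area * (p.rho * p.L / p.d ^ 2) := by
  have h1 := mul_le_mul_of_nonneg_left (hm.strayEnergy_le p)
    (show 0 ≤ p.R ^ 2 / p.d ^ 2 by positivity)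
  refine h1.trans (le_of_eq ?_)
  have hR := p.R_pos.ne'
  have hr := p.rho_pos.ne'
  have hd := p.d_pos.ne'
  simp only [Params.eta, Params.len]
  field_simp

end stray

end Nanowire

namespace Nanowire

/-! ### Estimates of the energies -/

section energy

variable {γ : ℝ} {p : Params} {m : E3 → E3}

theorem MemH1.bddH1 (h : MemH1 m) (j : Fin 3) :
    BddH1 (fun x => m x j) fun i => wD i fun x => m x j where
  meas := h.meas_coord j
  bdd := h.abs_le j
  weak i := by
    obtain ⟨g, hg, -⟩ := h.grad i j
    exact hg.congr ae_eq_rfl hg.wD_ae_eq.symm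
  sq i := by
    obtain ⟨g, hg, hg2⟩ := h.grad i j
    exact hg2.ae_eq hg.wD_ae_eq.symm

theorem MemH1.memLp_wD (h : MemH1 m) (i j : Fin 3) : MemLp (wD i fun x => m x j) 2 volCyl :=
  (h.bddH1 j).sq i

theorem MemH1.anisotropy_ae (h : MemH1 m) :
    ∀ᵐ x ∂volCyl, 1 - m x 0 ^ 2 = m x 1 ^ 2 + m x 2 ^ 2 := by
  filter_upwards [h.sum_sq] with x hx
  rw [Fin.sum_univ_three] at hx
  linarith

theorem MemH1.integrable_anisotropy (h : MemH1 m) :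
    Integrable (fun x => 1 - m x 0 ^ 2) volCyl := by
  refine ((h.transverse 1 (by decide)).integrable_sq.add
    (h.transverse 2 (by decide)).integrable_sq).congr ?_
  filter_upwards [h.anisotropy_ae] with x hx
  exact hx.symm

theorem dkCross_zero (k : Fin 3) (m : E3 → E3) (x : E3) :
    dkCross k m x 0 = wD k (fun y => m y 1) x * m x 2 - wD k (fun y => m y 2) x * m x 1 := by
  simp [dkCross, cross_apply]

theorem dkCross_one (k : Fin 3) (m : E3 → E3) (x : E3) :
    dkCross k m x 1 = wD k (fun y => m y 2) x * m x 0 - wD k (fun y => m y 0) x * m x 2 := by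
  simp [dkCross, cross_apply]

theorem dkCross_two (k : Fin 3) (m : E3 → E3) (x : E3) :
    dkCross k m x 2 = wD k (fun y => m y 0) x * m x 1 - wD k (fun y => m y 1) x * m x 0 := by
  simp [dkCross, cross_apply]

/-- The exchange and anisotropy energy. -/
noncomputable def exAnis (p : Params) (m : E3 → E3) : ℝ :=
  ∫ x in cyl, ((∑ i, ∑ j, (p.scale i * wD i (fun y => m y j) x) ^ 2) + (1 - m x 0 ^ 2))

theorem MemH1.integrable_grad_sq (h : MemH1 m) (p : Params) (i : Fin 3) :
    Integrable (fun x => ∑ j, (p.scale i * wD i (fun y => m y j) x) ^ 2) volCyl :=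
  integrable_finsetSum _ fun j _ => ((h.memLp_wD i j).const_mul _).integrable_sq

theorem MemH1.integrable_exAnis (h : MemH1 m) (p : Params) :
    Integrable (fun x => (∑ i, ∑ j, (p.scale i * wD i (fun y => m y j) x) ^ 2) +
      (1 - m x 0 ^ 2)) volCyl :=
  (integrable_finsetSum _ fun i _ => h.integrable_grad_sq p i).add h.integrable_anisotropy

theorem MemH1.integrable_dkCross_zero (h : MemH1 m) (k : Fin 3) :
    Integrable (fun x => dkCross k m x 0) volCyl := by
  simp_rw [dkCross_zero]
  exact (MemLp_mul_integrable (h.memLp_wD k 1) (h.transverse 2 (by decide))).sub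
    (MemLp_mul_integrable (h.memLp_wD k 2) (h.transverse 1 (by decide)))

theorem abs_integral_le_of_ae {F G : E3 → ℝ} (hG : Integrable G volCyl)
    (h : ∀ᵐ x ∂volCyl, |F x| ≤ G x) : |∫ x in cyl, F x| ≤ ∫ x in cyl, G x :=
  (Real.norm_eq_abs _).symm.trans_le (norm_integral_le_of_norm_le hG h)

/-- The contribution of `∂ₖm ∧ m` along `eₗ`. -/
noncomputable def crossInt (p : Params) (m : E3 → E3) (k l : Fin 3) : ℝ :=
  ∫ x in cyl, p.scale k * dkCross k m x l

theorem exAnis_nonneg (h : MemH1 m) (p : Params) : 0 ≤ exAnis p m := by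
  refine integral_nonneg_of_ae ?_
  filter_upwards [h.anisotropy_ae] with x hx
  simp only [Pi.zero_apply]
  rw [hx]
  have : 0 ≤ ∑ i, ∑ j, (p.scale i * wD i (fun y => m y j) x) ^ 2 :=
    Finset.sum_nonneg fun i _ => Finset.sum_nonneg fun j _ => sq_nonneg _
  positivity

theorem sum_sq_ge_two (p : Params) (m : E3 → E3) (x : E3) (k a b : Fin 3) (hab : a ≠ b) :
    (p.scale k * wD k (fun y => m y a) x) ^ 2 + (p.scale k * wD k (fun y => m y b) x) ^ 2 ≤
      ∑ i, ∑ j, (p.scale i * wD i (fun y => m y j) x) ^ 2 := by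
  have h1 : ∑ j, (p.scale k * wD k (fun y => m y j) x) ^ 2 ≤
      ∑ i, ∑ j, (p.scale i * wD i (fun y => m y j) x) ^ 2 :=
    Finset.single_le_sum (f := fun i => ∑ j, (p.scale i * wD i (fun y => m y j) x) ^ 2)
      (fun i _ => Finset.sum_nonneg fun j _ => sq_nonneg _) (Finset.mem_univ k)
  refine le_trans ?_ h1
  rw [← Finset.sum_pair (f := fun j => (p.scale k * wD k (fun y => m y j) x) ^ 2) hab]
  exact Finset.sum_le_sum_of_subset_of_nonneg (Finset.subset_univ _) fun j _ _ => sq_nonneg _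

/-- The `e₁` component involves only `m₂`, `m₃` and their derivatives. Young's inequality against
exchange and anisotropy suffices, with no factor from the length of the wire. -/
theorem abs_crossInt_zero_le (h : MemH1 m) (p : Params) (k : Fin 3) :
    |crossInt p m k 0| ≤ exAnis p m := by
  refine abs_integral_le_of_ae (h.integrable_exAnis p) ?_
  filter_upwards [h.anisotropy_ae] with x hx
  rw [hx, dkCross_zero]
  have h1 := sum_sq_ge_two p m x k 1 2 (by decide)
  rw [abs_le]
  set a := wD k (fun y => m y 1) x
  set b := wD k (fun y => m y 2) x
  constructor <;>
  nlinarith [sq_nonneg (p.scale k * a - m x 2), sq_nonneg (p.scale k * b - m x 1),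
    sq_nonneg (p.scale k * a + m x 2), sq_nonneg (p.scale k * b + m x 1)]

/-- Components that vanish near the ends of the wire can be integrated by parts. -/
theorem MEta.integral_parts (hm : m ∈ MEta p) {j : Fin 3} (hj : j ≠ 0) :
    ∫ x in cyl, (wD 0 (fun y => m y j) x * m x 0 + wD 0 (fun y => m y 0) x * m x j) = 0 := by
  have h := (hm.1.bddH1 j).integral_parts (hm.1.bddH1 0) p.len_pos.le (by
    filter_upwards [hm.2] with x hx hl
    have : j = 1 ∨ j = 2 := by omega
    rcases this with rfl | rfl
    · exact (hx hl).1
    · exact (hx hl).2)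
  rw [← h]
  exact integral_congr_ae (Eventually.of_forall fun x => by ring)

theorem MEta.wD_eq_zero (hm : m ∈ MEta p) {j : Fin 3} (hj : j ≠ 0) (i : Fin 3) :
    ∀ᵐ x ∂volCyl, p.len < |x 0| → wD i (fun y => m y j) x = 0 := by
  refine ((hm.1.bddH1 j).weak i).ae_eq_zero_of_const (isOpen_far p.len) (c := 0) ?_
  filter_upwards [hm.2] with x hx hl
  have : j = 1 ∨ j = 2 := by omega
  rcases this with rfl | rfl
  · exact (hx (le_of_lt hl)).1
  · exact (hx (le_of_lt hl)).2

/-- `m₁` is not square integrable on the cylinder, but the derivative of a transverse component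
vanishes beyond the ends of the wire, so only a bounded tube contributes. -/
theorem MEta.memLp_tube_mul (hm : m ∈ MEta p) {j : Fin 3} (hj : j ≠ 0) (i : Fin 3) :
    Integrable (fun x => wD i (fun y => m y j) x * m x 0) volCyl := by
  have h1 := MemLp_mul_integrable (hm.1.memLp_wD i j)
    ((hm.1.bddH1 0).memLp_mul_test (memLp_tube p.len))
  refine h1.congr ?_
  filter_upwards [MEta.wD_eq_zero hm hj i] with x hx
  by_cases hx0 : x 0 ∈ Icc (-p.len) p.len
  · simp [hx0]
  · rw [hx (by
      by_contra hc
      exact hx0 (abs_le.1 (not_lt.1 hc)))]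
    simp

theorem MEta.integrable_dkCross (hm : m ∈ MEta p) (k l : Fin 3) :
    Integrable (fun x => dkCross k m x l) volCyl := by
  have h1 : l = 0 ∨ l = 1 ∨ l = 2 := by omega
  rcases h1 with rfl | rfl | rfl
  · exact hm.1.integrable_dkCross_zero k
  · simp_rw [dkCross_one]
    exact (MEta.memLp_tube_mul hm (by decide) k).sub
      (MemLp_mul_integrable (hm.1.memLp_wD k 0) (hm.1.transverse 2 (by decide)))
  · simp_rw [dkCross_two]
    exact (MemLp_mul_integrable (hm.1.memLp_wD k 0) (hm.1.transverse 1 (by decide))).sub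
      (MEta.memLp_tube_mul hm (by decide) k)

/-- The product `m₁ ∂₁mⱼ` is only linear in small quantities. Because `mⱼ` vanishes beyond the ends,
the axial derivative can be moved to `m₁`, and the result `mⱼ ∂₁m₁` is quadratic and controlled by
exchange and anisotropy. -/
theorem MEta.abs_crossInt_axis_le (hm : m ∈ MEta p) {l : Fin 3} (hl : l ≠ 0) :
    |crossInt p m 0 l| ≤ exAnis p m := by
  have key : ∀ j : Fin 3, j ≠ 0 → |∫ x in cyl, 2 * (wD 0 (fun y => m y 0) x * m x j)| ≤
      exAnis p m := by
    intro j hj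
    refine abs_integral_le_of_ae (hm.1.integrable_exAnis p) ?_
    filter_upwards [hm.1.anisotropy_ae] with x hx
    rw [hx]
    have h1 := sum_sq_ge_two p m x 0 0 1 (by decide)
    rw [p.scale_zero, one_mul, one_mul] at h1
    have h2 : m x j ^ 2 ≤ m x 1 ^ 2 + m x 2 ^ 2 := by
      have : j = 1 ∨ j = 2 := by omega
      rcases this with rfl | rfl
      · linarith [sq_nonneg (m x 2)]
      · linarith [sq_nonneg (m x 1)]
    set a := wD 0 (fun y => m y 0) x
    rw [abs_le]
    constructor <;>
    nlinarith [sq_nonneg (a - m x j), sq_nonneg (a + m x j), sq_nonneg (wD 0 (fun y => m y 1) x)]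
  have i1 : ∀ j : Fin 3, j ≠ 0 → Integrable (fun x => wD 0 (fun y => m y 0) x * m x j) volCyl :=
    fun j hj => MemLp_mul_integrable (hm.1.memLp_wD 0 0) (hm.1.transverse j hj)
  have e : ∀ j : Fin 3, j ≠ 0 → ∫ x in cyl, (wD 0 (fun y => m y j) x * m x 0 -
      wD 0 (fun y => m y 0) x * m x j) = -∫ x in cyl, 2 * (wD 0 (fun y => m y 0) x * m x j) := by
    intro j hj
    have h1 := MEta.integral_parts hm hj
    rw [integral_add (MEta.memLp_tube_mul hm hj 0) (i1 j hj)] at h1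
    rw [integral_sub (MEta.memLp_tube_mul hm hj 0) (i1 j hj), integral_const_mul]
    linarith
  have h1 : l = 1 ∨ l = 2 := by omega
  unfold crossInt
  simp_rw [p.scale_zero, one_mul]
  rcases h1 with rfl | rfl
  · simp_rw [dkCross_one]
    rw [e 2 (by decide), abs_neg]
    exact key 2 (by decide)
  · simp_rw [dkCross_two]
    have : ∫ x in cyl, (wD 0 (fun y => m y 0) x * m x 1 - wD 0 (fun y => m y 1) x * m x 0) =
        -∫ x in cyl, (wD 0 (fun y => m y 1) x * m x 0 - wD 0 (fun y => m y 0) x * m x 1) := by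
      rw [← integral_neg]
      exact integral_congr_ae (Eventually.of_forall fun x => by ring)
    rw [this, e 1 (by decide), neg_neg]
    exact key 1 (by decide)

/-- The terms that are linear in the gradient are integrated over the tube of length `2L/ρ`, which
costs the square root of the length. For transverse `k` this loss is paid for by the stronger
hypothesis on the transverse block of `D`. -/
theorem MEta.abs_crossInt_transverse_le (hm : m ∈ MEta p) (k : Fin 3) {l : Fin 3} (hl : l ≠ 0) :
    |crossInt p m k l| ≤ √p.len * ((1 + 2 * area) * (1 + exAnis p m)) := by
  set r := √p.len with hr
  have hr0 : 0 < r := Real.sqrt_pos.2 p.len_pos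
  have hrr : p.len = r * r := (Real.mul_self_sqrt p.len_pos.le).symm
  let T : E3 → ℝ := fun x => (Icc (-p.len) p.len).indicator (fun _ => (1 : ℝ)) (x 0)
  let S : E3 → ℝ := fun x => (∑ i, ∑ j, (p.scale i * wD i (fun y => m y j) x) ^ 2) +
    (1 - m x 0 ^ 2)
  have hS : Integrable S volCyl := hm.1.integrable_exAnis p
  have hT : Integrable T volCyl := integrableOn_tube p.len
  have key : ∀ j : Fin 3, j ≠ 0 → ∀ᵐ x ∂volCyl, |p.scale k * (wD k (fun y => m y j) x * m x 0 -
      wD k (fun y => m y 0) x * m x j)| ≤ r * S x + r⁻¹ * T x := by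
    intro j hj
    filter_upwards [hm.1.anisotropy_ae, MEta.wD_eq_zero hm hj k, hm.2, hm.1.abs_le 0,
      hm.1.abs_le j] with x hx h1 h2 h3 h4
    have hS1 := sum_sq_ge_two p m x k 0 j hj.symm
    have hS2 : (p.scale k * wD k (fun y => m y 0) x) ^ 2 +
        (p.scale k * wD k (fun y => m y j) x) ^ 2 ≤ S x := by
      simp only [S]
      rw [hx]
      linarith [sq_nonneg (m x 1), sq_nonneg (m x 2)]
    set a := p.scale k * wD k (fun y => m y 0) x with ha
    set b := p.scale k * wD k (fun y => m y j) x with hb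
    have e : p.scale k * (wD k (fun y => m y j) x * m x 0 - wD k (fun y => m y 0) x * m x j) =
        b * m x 0 - a * m x j := by rw [ha, hb]; ring
    rw [e]
    by_cases hx0 : x 0 ∈ Icc (-p.len) p.len
    · have hT1 : T x = 1 := indicator_of_mem hx0 _
      have b1 : |b * m x 0 - a * m x j| ≤ |b| + |a| := by
        refine (abs_sub _ _).trans ?_
        rw [abs_mul b, abs_mul a]
        exact add_le_add (mul_le_of_le_one_right (abs_nonneg _) h3)
          (mul_le_of_le_one_right (abs_nonneg _) h4)
      -- Young's inequality weighted by `r = √(L/ρ)`, which balances the gradient term against the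
      -- volume of the tube: both contribute order `r`.
      have b2 : ∀ c : ℝ, |c| ≤ r * c ^ 2 + r⁻¹ / 4 := by
        intro c
        have h5 : r * c ^ 2 + r⁻¹ / 4 - |c| = r * (|c| - r⁻¹ / 2) ^ 2 := by
          rw [← sq_abs c]
          field_simp
          ring
        nlinarith [mul_nonneg hr0.le (sq_nonneg (|c| - r⁻¹ / 2))]
      have h6 := b2 a
      have h7 := b2 b
      have h8 : 0 < r⁻¹ := inv_pos.2 hr0
      rw [hT1]
      nlinarith [mul_le_mul_of_nonneg_left hS2 hr0.le]
    · have h5 : p.len < |x 0| := by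
        by_contra hc
        exact hx0 (abs_le.1 (not_lt.1 hc))
      have h6 : m x j = 0 := by
        have : j = 1 ∨ j = 2 := by omega
        rcases this with rfl | rfl
        · exact (h2 h5.le).1
        · exact (h2 h5.le).2
      have hT0 : T x = 0 := indicator_of_notMem hx0 _
      have hS0 : 0 ≤ S x := le_trans (by positivity) hS2
      rw [hb, h1 h5, h6, hT0]
      simp only [mul_zero, zero_mul, sub_zero, abs_zero, add_zero]
      positivity
  have hI : ∫ x in cyl, (r * S x + r⁻¹ * T x) = r * (exAnis p m + 2 * area) := by
    rw [integral_add (hS.const_mul r) (hT.const_mul _), integral_const_mul, integral_const_mul]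
    change r * exAnis p m + r⁻¹ * (∫ x in cyl, (Icc (-p.len) p.len).indicator
      (fun _ => (1 : ℝ)) (x 0)) = _
    rw [integral_tube p.len_pos.le, hrr]
    field_simp
  have hmain : |crossInt p m k l| ≤ r * (exAnis p m + 2 * area) := by
    rw [← hI]
    refine abs_integral_le_of_ae ((hS.const_mul r).add (hT.const_mul _)) ?_
    have h1 : l = 1 ∨ l = 2 := by omega
    rcases h1 with rfl | rfl
    · filter_upwards [key 2 (by decide)] with x hx
      rwa [dkCross_one]
    · filter_upwards [key 1 (by decide)] with x hx
      rw [dkCross_two, ← abs_neg]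
      refine le_trans (le_of_eq ?_) hx
      congr 1
      ring
  refine hmain.trans (mul_le_mul_of_nonneg_left ?_ hr0.le)
  have := exAnis_nonneg hm.1 p
  have := area_pos
  nlinarith

/-- The part of the energy that survives in the limit. -/
noncomputable def mainEnergy (γ : ℝ) (p : Params) (m : E3 → E3) : ℝ :=
  exAnis p m - 2 * γ * crossInt p m 0 0

/-- The size of the error terms. -/
noncomputable def errBound (γ : ℝ) (p : Params) : ℝ :=
  |p.rho / p.d ^ 2 * p.D 0 0 + 2 * γ| +
    p.rho / p.d ^ 2 * (|p.D 0 1| + |p.D 0 2| + |p.D 1 0| + |p.D 2 0|) +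
    √(p.rho * p.L) / p.d ^ 2 * (|p.D 1 1| + |p.D 1 2| + |p.D 2 1| + |p.D 2 2|) *
      (1 + 2 * area) + 2 * area * (p.rho * p.L / p.d ^ 2)

theorem errBound_nonneg (γ : ℝ) (p : Params) : 0 ≤ errBound γ p := by
  have := p.rho_pos
  have := p.L_pos
  have := area_pos
  unfold errBound
  positivity

theorem MEta.energyEta_eq (hm : m ∈ MEta p) :
    energyEta p m = exAnis p m + p.rho / p.d ^ 2 * ∑ k, ∑ l, p.D k l * crossInt p m k l +
      p.R ^ 2 / p.d ^ 2 * strayEnergy p m := by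
  unfold energyEta
  congr 1
  have hi : ∀ k, Integrable (fun x => ∑ l, p.D k l * (p.scale k * dkCross k m x l)) volCyl :=
    fun k => integrable_finsetSum _ fun l _ =>
      ((MEta.integrable_dkCross hm k l).const_mul _).const_mul _
  have e : ∀ k x, p.D k ⬝ᵥ (p.scale k • dkCross k m x) =
      ∑ l, p.D k l * (p.scale k * dkCross k m x l) := fun k x => rfl
  simp_rw [e]
  rw [integral_add (hm.1.integrable_exAnis p) ((integrable_finsetSum _ fun k _ => hi k).const_mul _),
    integral_const_mul, integral_finsetSum _ fun k _ => hi k]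
  congr 2
  refine Finset.sum_congr rfl fun k _ => ?_
  rw [integral_finsetSum _ fun l _ => ((MEta.integrable_dkCross hm k l).const_mul _).const_mul _]
  refine Finset.sum_congr rfl fun l _ => ?_
  rw [integral_const_mul]
  rfl

/-- `D₁₁` enters through its deviation from the limit. The entries `D₁₂`, `D₁₃` use integration by
parts, `D₂₁`, `D₃₁` the direct estimate, and the transverse block the estimate with the length
factor. -/
theorem MEta.abs_energyEta_sub_le (hm : m ∈ MEta p) (γ : ℝ) :
    |energyEta p m - mainEnergy γ p m| ≤ errBound γ p * (1 + exAnis p m) := by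
  have hN := exAnis_nonneg hm.1 p
  have hκ : 0 < p.rho / p.d ^ 2 := div_pos p.rho_pos (pow_pos p.d_pos 2)
  have hA := area_pos
  set κ := p.rho / p.d ^ 2 with hκd
  set N := exAnis p m
  have x00 := abs_crossInt_zero_le hm.1 p 0
  have x10 := abs_crossInt_zero_le hm.1 p 1
  have x20 := abs_crossInt_zero_le hm.1 p 2
  have x01 := MEta.abs_crossInt_axis_le hm (l := 1) (by decide)
  have x02 := MEta.abs_crossInt_axis_le hm (l := 2) (by decide)
  have xt := fun (k : Fin 3) {l : Fin 3} (hl : l ≠ 0) => MEta.abs_crossInt_transverse_le hm k hl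
  -- This identity matches the loss of `√(L/ρ)` with the scaling assumed for the transverse block.
  have hsq : √(p.rho * p.L) / p.d ^ 2 = κ * √p.len := by
    have : p.rho * p.L = p.rho ^ 2 * p.len := by
      have := p.rho_pos.ne'
      simp only [Params.len]
      field_simp
    rw [this, Real.sqrt_mul (sq_nonneg _), Real.sqrt_sq p.rho_pos.le, hκd]
    ring
  have e : energyEta p m - mainEnergy γ p m = (κ * p.D 0 0 + 2 * γ) * crossInt p m 0 0 +
      (κ * p.D 0 1 * crossInt p m 0 1 + κ * p.D 0 2 * crossInt p m 0 2 +
        κ * p.D 1 0 * crossInt p m 1 0 + κ * p.D 2 0 * crossInt p m 2 0) +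
      (κ * p.D 1 1 * crossInt p m 1 1 + κ * p.D 1 2 * crossInt p m 1 2 +
        κ * p.D 2 1 * crossInt p m 2 1 + κ * p.D 2 2 * crossInt p m 2 2) +
      p.R ^ 2 / p.d ^ 2 * strayEnergy p m := by
    rw [MEta.energyEta_eq hm, mainEnergy]
    simp only [Fin.sum_univ_three]
    ring
  have tri : ∀ a b c : ℝ, |b| ≤ c → |κ * a * b| ≤ κ * |a| * c := fun a b c h => by
    rw [abs_mul, abs_mul, abs_of_pos hκ]
    gcongr
  have hst0 : 0 ≤ p.R ^ 2 / p.d ^ 2 * strayEnergy p m :=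
    mul_nonneg (by positivity) (strayEnergy_nonneg p m)
  have hst := hm.1.stray_term_le p
  have q0 : |(κ * p.D 0 0 + 2 * γ) * crossInt p m 0 0| ≤ |κ * p.D 0 0 + 2 * γ| * (1 + N) := by
    rw [abs_mul]
    gcongr
    linarith
  have q1 := tri (p.D 0 1) _ (1 + N) (x01.trans (by linarith))
  have q2 := tri (p.D 0 2) _ (1 + N) (x02.trans (by linarith))
  have q3 := tri (p.D 1 0) _ (1 + N) (x10.trans (by linarith))
  have q4 := tri (p.D 2 0) _ (1 + N) (x20.trans (by linarith))
  have q5 := tri (p.D 1 1) _ _ (xt 1 (l := 1) (by decide))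
  have q6 := tri (p.D 1 2) _ _ (xt 1 (l := 2) (by decide))
  have q7 := tri (p.D 2 1) _ _ (xt 2 (l := 1) (by decide))
  have q8 := tri (p.D 2 2) _ _ (xt 2 (l := 2) (by decide))
  have q9 : p.R ^ 2 / p.d ^ 2 * strayEnergy p m ≤
      2 * area * (p.rho * p.L / p.d ^ 2) * (1 + N) := by
    refine hst.trans (le_mul_of_one_le_right ?_ (by linarith))
    have := p.rho_pos
    have := p.L_pos
    positivity
  have e2 : errBound γ p * (1 + N) = |κ * p.D 0 0 + 2 * γ| * (1 + N) +
      (κ * |p.D 0 1| * (1 + N) + κ * |p.D 0 2| * (1 + N) + κ * |p.D 1 0| * (1 + N) +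
        κ * |p.D 2 0| * (1 + N)) +
      (κ * |p.D 1 1| * (√p.len * ((1 + 2 * area) * (1 + N))) +
        κ * |p.D 1 2| * (√p.len * ((1 + 2 * area) * (1 + N))) +
        κ * |p.D 2 1| * (√p.len * ((1 + 2 * area) * (1 + N))) +
        κ * |p.D 2 2| * (√p.len * ((1 + 2 * area) * (1 + N)))) +
      2 * area * (p.rho * p.L / p.d ^ 2) * (1 + N) := by
    rw [errBound, hsq]
    ring
  rw [e, e2]
  rw [abs_le] at *
  constructor <;> linarith [q0.1, q0.2, q1.1, q1.2, q2.1, q2.2, q3.1, q3.2, q4.1, q4.2, q5.1,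
    q5.2, q6.1, q6.2, q7.1, q7.2, q8.1, q8.2]

theorem Regime.tendsto_errBound {P : ℝ → Params} (hP : Regime P γ) :
    Tendsto (fun η => errBound γ (P η)) (𝓝[>] 0) (𝓝 0) := by
  have h1 : Tendsto (fun η => |(P η).rho / (P η).d ^ 2 * (P η).D 0 0 + 2 * γ|) (𝓝[>] 0) (𝓝 0) := by
    have := (hP.D11.add_const (2 * γ)).abs
    simpa using this
  have h2 := ((h1.add hP.D_small).add (hP.D_perp_small.mul_const (1 + 2 * area))).add
    (hP.rho_L_d.const_mul (2 * area))
  simpa [errBound] using h2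

theorem Regime.tendsto_len {P : ℝ → Params} (hP : Regime P γ) :
    Tendsto (fun η => (P η).len) (𝓝[>] 0) atTop := by
  have h1 : Tendsto (fun η => ((P η).rho / (P η).L)⁻¹) (𝓝[>] 0) atTop := by
    refine tendsto_inv_nhdsGT_zero.comp ?_
    rw [tendsto_nhdsWithin_iff]
    exact ⟨hP.rho_L, Eventually.of_forall fun η => div_pos (P η).rho_pos (P η).L_pos⟩
  refine h1.congr fun η => ?_
  rw [inv_div]
  rfl

theorem Regime.tendsto_eta {P : ℝ → Params} (hP : Regime P γ) :
    Tendsto (fun η => (P η).eta) (𝓝[>] 0) (𝓝 0) := by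
  have h : Tendsto (fun η : ℝ => η) (𝓝[>] 0) (𝓝 0) := tendsto_nhdsWithin_of_tendsto_nhds tendsto_id
  exact h.congr' (by filter_upwards [hP.eta_eq] with η h using h.symm)

end energy

end Nanowire

namespace Nanowire

/-! ### The reduced energy -/

section reduced

variable {γ : ℝ} {m : E3 → E3}

theorem MemH1.integrable_reduced (h : MemH1 m) (γ : ℝ) :
    Integrable (fun x => (∑ j, wD 0 (fun y => m y j) x ^ 2) + (1 - m x 0 ^ 2) -
      2 * γ * dkCross 0 m x 0) volCyl :=
  ((integrable_finsetSum _ fun j _ => (h.memLp_wD 0 j).integrable_sq).add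
    h.integrable_anisotropy).sub ((h.integrable_dkCross_zero 0).const_mul _)

/-- The exchange energy of the transverse derivatives. -/
noncomputable def transvEnergy (m : E3 → E3) : ℝ :=
  ∫ x in cyl, ∑ j, (wD 1 (fun y => m y j) x ^ 2 + wD 2 (fun y => m y j) x ^ 2)

theorem MemH1.integrable_transv (h : MemH1 m) : Integrable (fun x =>
    ∑ j, (wD 1 (fun y => m y j) x ^ 2 + wD 2 (fun y => m y j) x ^ 2)) volCyl :=
  integrable_finsetSum _ fun j _ => (h.memLp_wD 1 j).integrable_sq.add (h.memLp_wD 2 j).integrable_sq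

theorem transvEnergy_nonneg (m : E3 → E3) : 0 ≤ transvEnergy m :=
  integral_nonneg fun _ => Finset.sum_nonneg fun _ _ => add_nonneg (sq_nonneg _) (sq_nonneg _)

theorem MemH1.mainEnergy_eq (h : MemH1 m) (γ : ℝ) (p : Params) :
    mainEnergy γ p m = energyZero γ m + (1 / p.eta) ^ 2 * transvEnergy m := by
  rw [mainEnergy, exAnis, crossInt, energyZero, transvEnergy, ← integral_const_mul,
    ← integral_const_mul, ← integral_sub (h.integrable_exAnis p)
    (((h.integrable_dkCross_zero 0).const_mul _).const_mul _),
    ← integral_add (h.integrable_reduced γ) (h.integrable_transv.const_mul _)]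
  refine integral_congr_ae (Eventually.of_forall fun x => ?_)
  simp only [Fin.sum_univ_three, p.scale_zero, p.scale_one, p.scale_two]
  ring

/-- The reduced energy as a sum of squares. -/
theorem MemH1.energyZero_eq (h : MemH1 m) (γ : ℝ) :
    energyZero γ m = (∫ x in cyl, wD 0 (fun y => m y 0) x ^ 2) +
      (∫ x in cyl, (wD 0 (fun y => m y 1) x + -γ * m x 2) ^ 2) +
      (∫ x in cyl, (wD 0 (fun y => m y 2) x + γ * m x 1) ^ 2) +
      ((1 - γ ^ 2) * (∫ x in cyl, m x 1 ^ 2) + (1 - γ ^ 2) * ∫ x in cyl, m x 2 ^ 2) := by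
  have t1 := h.transverse 1 (by decide)
  have t2 := h.transverse 2 (by decide)
  have i0 := (h.memLp_wD 0 0).integrable_sq
  have i1 := ((h.memLp_wD 0 1).add (t2.const_mul (-γ))).integrable_sq
  have i2 := ((h.memLp_wD 0 2).add (t1.const_mul γ)).integrable_sq
  have i3 := t1.integrable_sq.const_mul (1 - γ ^ 2)
  have i4 := t2.integrable_sq.const_mul (1 - γ ^ 2)
  simp only [Pi.add_apply] at i1 i2
  have e1 := integral_add_add i0 i1 i2
  have e3 := integral_add ((i0.add i1).add i2) (i3.add i4)
  simp only [Pi.add_apply] at e3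
  rw [← integral_const_mul, ← integral_const_mul, ← e1, ← integral_add i3 i4,
    ← e3, energyZero]
  refine integral_congr_ae ?_
  filter_upwards [h.anisotropy_ae] with x hx
  simp only [Fin.sum_univ_three, hx, dkCross_zero]
  ring

/-- By Young's inequality the chiral term is at most `|γ|` times the other two, and `|γ| < 1`. -/
theorem MemH1.energyZero_coercive (h : MemH1 m) (γ : ℝ) :
    (1 - |γ|) * ∫ x in cyl, ((∑ j, wD 0 (fun y => m y j) x ^ 2) + (1 - m x 0 ^ 2)) ≤
      energyZero γ m := by
  rw [energyZero, ← integral_const_mul]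
  refine integral_mono_ae (((integrable_finsetSum _ fun j _ => (h.memLp_wD 0 j).integrable_sq).add
    h.integrable_anisotropy).const_mul _) (h.integrable_reduced γ) ?_
  filter_upwards [h.anisotropy_ae] with x hx
  simp only [Fin.sum_univ_three, hx, dkCross_zero]
  set a := wD 0 (fun y => m y 1) x
  set b := wD 0 (fun y => m y 2) x
  have h1 : 2 * γ * (a * m x 2 - b * m x 1) ≤ |γ| * (a ^ 2 + b ^ 2 + (m x 1 ^ 2 + m x 2 ^ 2)) := by
    refine (le_abs_self _).trans ?_
    have : |2 * γ * (a * m x 2 - b * m x 1)| = |γ| * |2 * (a * m x 2 - b * m x 1)| := by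
      rw [← abs_mul]
      congr 1
      ring
    rw [this]
    refine mul_le_mul_of_nonneg_left ?_ (abs_nonneg γ)
    rw [_root_.abs_le]
    constructor <;> nlinarith [sq_nonneg (a - m x 2), sq_nonneg (a + m x 2),
      sq_nonneg (b - m x 1), sq_nonneg (b + m x 1)]
  have h2 : 0 ≤ |γ| * wD 0 (fun y => m y 0) x ^ 2 := by positivity
  nlinarith

/-- The shifts `v = b - γm₂`, `w = c + γm₁` turn the density into `A + (1-γ²)W` with `A = a² + v² +
w²` and `W = m₁² + m₂²`. They are tangent to rotations about the axis, so the orthogonality to `m`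
persists. Cauchy-Schwarz then yields `(1-W)a² ≤ W(v² + w²)`, that is `a² ≤ WA`, and the
arithmetic-geometric mean inequality concludes. -/
theorem two_mul_abs_le_reduced {γ : ℝ} (hγ : γ ∈ Ioo (-1 : ℝ) 1) {m₀ m₁ m₂ a b c : ℝ}
    (hs : m₀ ^ 2 + m₁ ^ 2 + m₂ ^ 2 = 1) (ho : m₀ * a + m₁ * b + m₂ * c = 0) :
    2 * √(1 - γ ^ 2) * |a| ≤
      a ^ 2 + b ^ 2 + c ^ 2 + (1 - m₀ ^ 2) - 2 * γ * (b * m₂ - c * m₁) := by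
  have hγ2 : 0 < 1 - γ ^ 2 := by nlinarith [hγ.1, hγ.2]
  set v := b - γ * m₂ with hv
  set w := c + γ * m₁ with hw
  set W := m₁ ^ 2 + m₂ ^ 2 with hW
  have hW0 : 0 ≤ W := by positivity
  have e : a ^ 2 + b ^ 2 + c ^ 2 + (1 - m₀ ^ 2) - 2 * γ * (b * m₂ - c * m₁) =
      (a ^ 2 + v ^ 2 + w ^ 2) + (1 - γ ^ 2) * W := by
    rw [hv, hw, hW]; linear_combination (-1) * hs
  have h1 : m₁ * v + m₂ * w = -(m₀ * a) := by
    rw [hv, hw]; linear_combination ho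
  have h2 : (m₁ * v + m₂ * w) ^ 2 ≤ W * (v ^ 2 + w ^ 2) := by
    rw [hW]; nlinarith [sq_nonneg (m₁ * w - m₂ * v)]
  have h3 : a ^ 2 ≤ W * (a ^ 2 + v ^ 2 + w ^ 2) := by
    have h4 : (m₁ * v + m₂ * w) ^ 2 = m₀ ^ 2 * a ^ 2 := by rw [h1]; ring
    have h5 : m₀ ^ 2 = 1 - W := by rw [hW]; linarith
    rw [h4, h5] at h2
    linarith
  rw [e]
  refine abs_le_of_sq_le_sq' (a := 2 * √(1 - γ ^ 2) * |a|) ?_ (by positivity) |>.2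
  rw [mul_pow, mul_pow, Real.sq_sqrt hγ2.le, sq_abs]
  have h6 := mul_le_mul_of_nonneg_left h3 hγ2.le
  nlinarith [sq_nonneg ((a ^ 2 + v ^ 2 + w ^ 2) - (1 - γ ^ 2) * W)]

theorem MemH1.two_mul_abs_le (h : MemH1 m) (hγ : γ ∈ Ioo (-1 : ℝ) 1) :
    ∀ᵐ x ∂volCyl, 2 * √(1 - γ ^ 2) * |wD 0 (fun y => m y 0) x| ≤
      (∑ j, wD 0 (fun y => m y j) x ^ 2) + (1 - m x 0 ^ 2) - 2 * γ * dkCross 0 m x 0 := by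
  filter_upwards [h.sum_sq, sum_mul_partial_zero_eq_zero h.bddH1 h.sum_sq] with x h1 h2
  rw [Fin.sum_univ_three] at h1 h2 ⊢
  rw [dkCross_zero]
  exact two_mul_abs_le_reduced hγ h1 h2

theorem sqrt_pos_of_mem (hγ : γ ∈ Ioo (-1 : ℝ) 1) : 0 < √(1 - γ ^ 2) :=
  Real.sqrt_pos.2 (by nlinarith [hγ.1, hγ.2])

theorem MemH1.integrable_wD_zero (h : MemH1 m) (hγ : γ ∈ Ioo (-1 : ℝ) 1) :
    Integrable (wD 0 fun y => m y 0) volCyl := by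
  have hs := sqrt_pos_of_mem hγ
  refine ((h.integrable_reduced γ).const_mul (2 * √(1 - γ ^ 2))⁻¹).mono'
    (h.memLp_wD 0 0).aestronglyMeasurable ?_
  filter_upwards [h.two_mul_abs_le hγ] with x hx
  rw [Real.norm_eq_abs, ← div_eq_inv_mul, le_div_iff₀' (by positivity)]
  exact hx

theorem MemH1.variation_le (h : MemH1 m) (hγ : γ ∈ Ioo (-1 : ℝ) 1) :
    2 * √(1 - γ ^ 2) * ∫ x in cyl, |wD 0 (fun y => m y 0) x| ≤ energyZero γ m := by
  rw [← integral_const_mul, energyZero]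
  exact integral_mono_ae ((h.integrable_wD_zero hγ).abs.const_mul _) (h.integrable_reduced γ)
    (h.two_mul_abs_le hγ)

/-- The increments of the section averages over disjoint intervals are controlled by the total
variation along the axis. -/
theorem sum_increments_le {u : ℝ → ℝ} {g : E3 → ℝ} (hg : Integrable g volCyl)
    (hu : ∀ s t, s ≤ t → u t - u s = area⁻¹ * ∫ x in cyl, g x * (Ioc s t).indicator 1 (x 0))
    {a x y b : ℝ} (h1 : a ≤ x) (h2 : x ≤ y) (h3 : y ≤ b) :
    area * (|u x - u a| + |u y - u x| + |u b - u y|) ≤ ∫ x in cyl, |g x| := by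
  have hA := area_pos
  have hi : ∀ s t : ℝ, Integrable (fun x : E3 => |g x| * (Ioc s t).indicator 1 (x 0)) volCyl := by
    intro s t
    refine (hg.abs.bdd_mul (f := fun x : E3 => (Ioc s t).indicator (1 : ℝ → ℝ) (x 0)) (c := 1)
      (aestronglyMeasurable_axis (stronglyMeasurable_one.indicator
        measurableSet_Ioc).aestronglyMeasurable) (Eventually.of_forall fun x => ?_)).congr
        (Eventually.of_forall fun x => mul_comm _ _)
    by_cases hx : x 0 ∈ Ioc s t <;> simp [hx]
  have key : ∀ s t, s ≤ t →
      area * |u t - u s| ≤ ∫ x in cyl, |g x| * (Ioc s t).indicator 1 (x 0) := by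
    intro s t hst
    rw [hu s t hst, abs_mul, abs_of_pos (inv_pos.2 hA), mul_inv_cancel_left₀ hA.ne']
    refine abs_integral_le_of_ae (hi s t) (Eventually.of_forall fun x => ?_)
    by_cases hx : x 0 ∈ Ioc s t <;> simp [hx]
  rw [mul_add, mul_add]
  refine (add_le_add (add_le_add (key a x h1) (key x y h2)) (key y b h3)).trans ?_
  rw [← integral_add_add (hi a x) (hi x y) (hi y b)]
  refine integral_mono (((hi a x).add (hi x y)).add (hi y b)) hg.abs fun z => ?_
  simp only
  rw [← mul_add, ← mul_add]
  refine mul_le_of_le_one_right (abs_nonneg _) ?_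
  by_cases c1 : z 0 ∈ Ioc a x
  · have c2 : z 0 ∉ Ioc x y := fun h => absurd h.1 (not_lt.2 c1.2)
    have c3 : z 0 ∉ Ioc y b := fun h => absurd h.1 (not_lt.2 (c1.2.trans h2))
    simp [c1, c2, c3]
  · by_cases c2 : z 0 ∈ Ioc x y
    · have c3 : z 0 ∉ Ioc y b := fun h => absurd h.1 (not_lt.2 c2.2)
      simp [c1, c2, c3]
    · by_cases c3 : z 0 ∈ Ioc y b <;> simp [c1, c2, c3]

theorem isMean_of_ae {f : E3 → ℝ} {v : ℝ → ℝ} (hv : Continuous v)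
    (h : ∀ᵐ x ∂volCyl, f x = v (x 0)) : IsMean f v where
  cont := hv
  ae_eq := by
    filter_upwards [ae_ae_join h] with t ht
    have : ∫ y, f (join t y) ∂volDisk = ∫ _, v t ∂volDisk :=
      integral_congr_ae (by filter_upwards [ht] with y hy; rw [hy, join_zero])
    rw [secAvg, this, integral_const, smul_eq_mul]
    exact inv_mul_cancel_left₀ area_pos.ne' _

theorem IsMean.unique {f : E3 → ℝ} {u v : ℝ → ℝ} (hu : IsMean f u) (hv : IsMean f v) : u = v :=
  (hu.cont.ae_eq_iff_eq volume hv.cont).1 (hu.ae_eq.symm.trans hv.ae_eq)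

/-- The energy dominates `2√(1-γ²)` times the total variation of `m₁` along the axis, and passing
from `-1` to `1` costs at least `2` per unit of sectional area. -/
theorem energyZero_ge_of_mem_wallsZero (hγ : γ ∈ Ioo (-1 : ℝ) 1) (hm : m ∈ wallsZero) :
    4 * √(1 - γ ^ 2) * area ≤ energyZero γ m := by
  obtain ⟨⟨h, -⟩, v, ⟨hvc, hvm⟩, htop, hbot⟩ := hm
  have hs := sqrt_pos_of_mem hγ
  obtain ⟨u, hu, hinc⟩ := (h.bddH1 0).exists_isMean
  have huv : u = fun t => v t 0 := hu.unique (isMean_of_ae (by fun_prop) (by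
    filter_upwards [hvm] with x hx
    rw [hx]))
  have hp : Continuous fun z : E3 => z 0 := by fun_prop
  have l1 : Tendsto u atTop (𝓝 1) := by
    have := (hp.tendsto e1).comp htop
    rw [huv]
    simpa [e1, Function.comp_def] using this
  have l2 : Tendsto u atBot (𝓝 (-1)) := by
    have := (hp.tendsto (-e1)).comp hbot
    rw [huv]
    simpa [e1, Function.comp_def] using this
  have l3 : Tendsto (fun T : ℝ => area * (u T - u (-T))) atTop (𝓝 (area * (1 - -1))) :=
    (l1.sub (l2.comp tendsto_neg_atTop_atBot)).const_mul _
  have h1 : area * (1 - -1) ≤ ∫ x in cyl, |wD 0 (fun y => m y 0) x| := by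
    refine le_of_tendsto l3 ?_
    filter_upwards [eventually_ge_atTop 0] with T hT
    have := sum_increments_le (h.integrable_wD_zero hγ) hinc (a := -T) (x := T) (y := T) (b := T)
      (by linarith) le_rfl le_rfl
    refine le_trans ?_ this
    refine mul_le_mul_of_nonneg_left ?_ area_pos.le
    have h5 := le_abs_self (u T - u (-T))
    have h6 := abs_nonneg (u T - u T)
    linarith
  have h2 := h.variation_le hγ
  nlinarith

end reduced

end Nanowire

namespace Nanowire

/-! ### Nearly optimal walls of finite length -/

section profile

open Real in
/-- The angle of the optimal wall. -/
noncomputable def wallAngle (s t : ℝ) : ℝ := arctan (sinh (s * t))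

/-- With `cos_wallAngle` this reads `ψ' = s cos ψ`, the equality case of the pointwise lower bound
when `s = √(1-γ²)`. -/
theorem hasDerivAt_wallAngle (s t : ℝ) :
    HasDerivAt (wallAngle s) (s / Real.cosh (s * t)) t := by
  have h1 : HasDerivAt (fun t : ℝ => s * t) s t := by
    simpa using (hasDerivAt_id t).const_mul s
  have h2 : HasDerivAt (wallAngle s) _ t := (h1.sinh).arctan
  convert h2 using 1
  have hc := Real.cosh_pos (s * t)
  have : 1 + Real.sinh (s * t) ^ 2 = Real.cosh (s * t) ^ 2 := by
    rw [Real.cosh_sq]; ring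
  rw [this]
  field_simp

theorem cos_wallAngle (s t : ℝ) : Real.cos (wallAngle s t) = 1 / Real.cosh (s * t) := by
  have : 1 + Real.sinh (s * t) ^ 2 = Real.cosh (s * t) ^ 2 := by
    rw [Real.cosh_sq]; ring
  rw [wallAngle, Real.cos_arctan, this, Real.sqrt_sq (Real.cosh_pos _).le]

theorem wallAngle_strictMono {s : ℝ} (hs : 0 < s) : StrictMono (wallAngle s) := fun a b hab =>
  Real.arctan_strictMono (Real.sinh_strictMono (by gcongr))

theorem wallAngle_neg (s t : ℝ) : wallAngle s (-t) = -wallAngle s t := by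
  simp [wallAngle]

theorem _root_.LipschitzWith.real_const_mul {f : ℝ → ℝ} {K : NNReal} (hf : LipschitzWith K f)
    (c : ℝ) : LipschitzWith (‖c‖₊ * K) fun t => c * f t :=
  (lipschitzWith_smul c).comp hf

theorem lipschitzWith_wallAngle {s : ℝ} (hs : 0 < s) :
    LipschitzWith s.toNNReal (wallAngle s) := by
  refine lipschitzWith_of_nnnorm_deriv_le
    (fun t => (hasDerivAt_wallAngle s t).differentiableAt) fun t => ?_
  rw [(hasDerivAt_wallAngle s t).deriv, ← NNReal.coe_le_coe, coe_nnnorm, Real.norm_eq_abs,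
    Real.coe_toNNReal _ hs.le, abs_of_nonneg (div_nonneg hs.le (Real.cosh_pos _).le)]
  exact div_le_self hs.le (Real.one_le_cosh _)

/-- The angle of a wall of finite length. -/
noncomputable def cutAngle (s c t : ℝ) : ℝ :=
  max (min (c * wallAngle s t) (Real.pi / 2)) (-(Real.pi / 2))

/-- The half length of the wall with angle `cutAngle s c`. -/
noncomputable def cutLen (s c : ℝ) : ℝ := Real.arsinh (Real.tan (Real.pi / (2 * c))) / s

variable {s c : ℝ}

theorem wallAngle_cutLen (hs : 0 < s) (hc : 1 < c) :
    wallAngle s (cutLen s c) = Real.pi / (2 * c) := by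
  have hpi := Real.pi_pos
  have h1 : Real.pi / (2 * c) < Real.pi / 2 := by
    apply div_lt_div_of_pos_left hpi (by norm_num) (by linarith)
  rw [wallAngle, cutLen, mul_div_cancel₀ _ hs.ne', Real.sinh_arsinh, Real.arctan_tan _ h1]
  have : 0 < Real.pi / (2 * c) := by positivity
  linarith

theorem mul_wallAngle_cutLen (hs : 0 < s) (hc : 1 < c) :
    c * wallAngle s (cutLen s c) = Real.pi / 2 := by
  rw [wallAngle_cutLen hs hc]
  field_simp

theorem cutLen_pos (hs : 0 < s) (hc : 1 < c) : 0 < cutLen s c := by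
  rw [← (wallAngle_strictMono hs).lt_iff_lt, wallAngle_cutLen hs hc]
  have := Real.pi_pos
  simp only [wallAngle, mul_zero, Real.sinh_zero, Real.arctan_zero]
  positivity

theorem cutAngle_of_ge (hs : 0 < s) (hc : 1 < c) {t : ℝ} (ht : cutLen s c ≤ t) :
    cutAngle s c t = Real.pi / 2 := by
  have h1 := mul_le_mul_of_nonneg_left ((wallAngle_strictMono hs).monotone ht) (by linarith : 0 ≤ c)
  rw [mul_wallAngle_cutLen hs hc] at h1
  have := Real.pi_pos
  rw [cutAngle, min_eq_right h1, max_eq_left (by linarith)]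

theorem cutAngle_of_le (hs : 0 < s) (hc : 1 < c) {t : ℝ} (ht : t ≤ -cutLen s c) :
    cutAngle s c t = -(Real.pi / 2) := by
  have h1 := mul_le_mul_of_nonneg_left ((wallAngle_strictMono hs).monotone ht) (by linarith : 0 ≤ c)
  rw [wallAngle_neg, mul_neg, mul_wallAngle_cutLen hs hc] at h1
  have := Real.pi_pos
  rw [cutAngle, max_eq_right]
  exact (min_le_left _ _).trans h1

theorem abs_mul_wallAngle_lt (hs : 0 < s) (hc : 1 < c) {t : ℝ}
    (ht : t ∈ Ioo (-cutLen s c) (cutLen s c)) : |c * wallAngle s t| < Real.pi / 2 := by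
  have hc0 : 0 < c := by linarith
  have h1 := mul_lt_mul_of_pos_left (wallAngle_strictMono hs ht.1) hc0
  have h2 := mul_lt_mul_of_pos_left (wallAngle_strictMono hs ht.2) hc0
  rw [wallAngle_neg, mul_neg, mul_wallAngle_cutLen hs hc] at h1
  rw [mul_wallAngle_cutLen hs hc] at h2
  exact abs_lt.2 ⟨h1, h2⟩

theorem cutAngle_of_mem (hs : 0 < s) (hc : 1 < c) {t : ℝ}
    (ht : t ∈ Ioo (-cutLen s c) (cutLen s c)) : cutAngle s c t = c * wallAngle s t := by
  have h := abs_lt.1 (abs_mul_wallAngle_lt hs hc ht)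
  rw [cutAngle, min_eq_left h.2.le, max_eq_left h.1.le]

theorem hasDerivAt_cutAngle (hs : 0 < s) (hc : 1 < c) {t : ℝ}
    (ht : t ∈ Ioo (-cutLen s c) (cutLen s c)) :
    HasDerivAt (cutAngle s c) (c * (s / Real.cosh (s * t))) t := by
  refine ((hasDerivAt_wallAngle s t).const_mul c).congr_of_eventuallyEq ?_
  filter_upwards [Ioo_mem_nhds ht.1 ht.2] with r hr using cutAngle_of_mem hs hc hr

theorem lipschitzWith_cutAngle (hs : 0 < s) (c : ℝ) :
    ∃ K, LipschitzWith K (cutAngle s c) :=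
  ⟨_, (((lipschitzWith_wallAngle hs).real_const_mul c).min_const _).max_const _⟩

/-- Multiplying the angle by `c > 1` makes it reach `±π/2` at the finite distance `cutLen s c`, and
only lowers the cosine. The price of finite length is thus a factor `c²` on the derivative alone. -/
theorem cos_cutAngle_sq_le (hs : 0 < s) (hc : 1 < c) {t : ℝ}
    (ht : t ∈ Ioo (-cutLen s c) (cutLen s c)) :
    Real.cos (c * wallAngle s t) ^ 2 ≤ (1 / Real.cosh (s * t)) ^ 2 := by
  have h := abs_mul_wallAngle_lt hs hc ht
  have hpi := Real.pi_pos
  rw [← cos_wallAngle, ← Real.cos_abs, ← Real.cos_abs (wallAngle s t)]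
  refine pow_le_pow_left₀ (Real.cos_nonneg_of_mem_Icc ⟨?_, h.le⟩) ?_ 2
  · linarith [abs_nonneg (c * wallAngle s t)]
  · refine Real.cos_le_cos_of_nonneg_of_le_pi (abs_nonneg _) (by linarith) ?_
    rw [abs_mul, abs_of_pos (by linarith : 0 < c)]
    exact le_mul_of_one_le_left (abs_nonneg _) hc.le

/-- The components of a wall of finite length. -/
noncomputable def cutWall (γ s c : ℝ) : Fin 3 → ℝ → ℝ :=
  ![fun t => Real.sin (cutAngle s c t), fun t => Real.cos (cutAngle s c t) * Real.cos (γ * t),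
    fun t => -(Real.cos (cutAngle s c t) * Real.sin (γ * t))]

theorem lipschitzWith_cutWall (γ : ℝ) (hs : 0 < s) (c : ℝ) (j : Fin 3) :
    ∃ K, LipschitzWith K (cutWall γ s c j) := by
  obtain ⟨K, hK⟩ := lipschitzWith_cutAngle hs c
  have hγ : LipschitzWith _ fun t : ℝ => γ * t := LipschitzWith.id.real_const_mul γ
  -- Product-to-sum formulas replace products of trigonometric functions by half sums of Lipschitz
  -- functions.
  have half : ∀ {a b : ℝ → ℝ} {A B : NNReal}, LipschitzWith A a → LipschitzWith B b →
      ∃ K, LipschitzWith K fun t => (1 / 2) * (a t + b t) := fun ha hb =>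
    ⟨_, (ha.add hb).real_const_mul _⟩
  have hp := hK.add hγ
  have hm := hK.sub hγ
  fin_cases j
  · exact ⟨_, Real.lipschitzWith_sin.comp hK⟩
  · obtain ⟨L, hL⟩ := half (Real.lipschitzWith_cos.comp hm) (Real.lipschitzWith_cos.comp hp)
    refine ⟨L, ?_⟩
    convert hL using 1
    ext t
    simp only [cutWall, Fin.mk_one, Matrix.cons_val_one, Matrix.cons_val_zero, Function.comp_apply,
      Real.cos_add, Real.cos_sub]
    ring
  · obtain ⟨L, hL⟩ := half (Real.lipschitzWith_sin.comp hm) (Real.lipschitzWith_sin.comp hp).neg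
    refine ⟨L, ?_⟩
    convert hL using 1
    ext t
    simp only [cutWall, Fin.reduceFinMk, Matrix.cons_val, Pi.neg_apply, Function.comp_apply,
      Real.sin_add, Real.sin_sub]
    ring

theorem cutWall_sum_sq (γ s c t : ℝ) : ∑ j, cutWall γ s c j t ^ 2 = 1 := by
  simp only [cutWall, Fin.sum_univ_three, Matrix.cons_val]
  have h1 := Real.sin_sq_add_cos_sq (cutAngle s c t)
  have h2 := Real.sin_sq_add_cos_sq (γ * t)
  linear_combination h1 + Real.cos (cutAngle s c t) ^ 2 * h2

theorem cutWall_of_ge (γ : ℝ) (hs : 0 < s) (hc : 1 < c) {t : ℝ} (ht : cutLen s c ≤ t) :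
    cutWall γ s c 0 t = 1 ∧ cutWall γ s c 1 t = 0 ∧ cutWall γ s c 2 t = 0 := by
  simp [cutWall, cutAngle_of_ge hs hc ht]

theorem cutWall_of_le (γ : ℝ) (hs : 0 < s) (hc : 1 < c) {t : ℝ} (ht : t ≤ -cutLen s c) :
    cutWall γ s c 0 t = -1 ∧ cutWall γ s c 1 t = 0 ∧ cutWall γ s c 2 t = 0 := by
  simp [cutWall, cutAngle_of_le hs hc ht]

/-- The density of the reduced energy of a curve. -/
noncomputable def density (γ : ℝ) (f : Fin 3 → ℝ → ℝ) (t : ℝ) : ℝ :=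
  (∑ j, deriv (f j) t ^ 2) + (1 - f 0 t ^ 2) -
    2 * γ * (deriv (f 1) t * f 2 t - deriv (f 2) t * f 1 t)

/-- The rotation at rate `γ` about the axis is the optimal twist: its exchange cost `γ² cos²ψ` and
the chiral gain `-2γ² cos²ψ` leave `ψ'² + (1-γ²) cos²ψ`. -/
theorem density_cutWall_of_mem (γ : ℝ) (hs : 0 < s) (hc : 1 < c) {t : ℝ}
    (ht : t ∈ Ioo (-cutLen s c) (cutLen s c)) :
    density γ (cutWall γ s c) t = (c * (s / Real.cosh (s * t))) ^ 2 +
      (1 - γ ^ 2) * Real.cos (c * wallAngle s t) ^ 2 := by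
  have hd := hasDerivAt_cutAngle hs hc ht
  have hγ : HasDerivAt (fun t : ℝ => γ * t) γ t := by
    simpa using (hasDerivAt_id t).const_mul γ
  have d0 : deriv (cutWall γ s c 0) t = _ := hd.sin.deriv
  have d1 : deriv (cutWall γ s c 1) t = _ := (hd.cos.mul hγ.cos).deriv
  have d2 : deriv (cutWall γ s c 2) t = _ := (hd.cos.mul hγ.sin).neg.deriv
  rw [density, Fin.sum_univ_three, d0, d1, d2]
  simp only [cutWall, Matrix.cons_val, cutAngle_of_mem hs hc ht]
  set ψ := c * wallAngle s t
  set w := c * (s / Real.cosh (s * t))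
  have h1 := Real.sin_sq_add_cos_sq ψ
  have h2 := Real.sin_sq_add_cos_sq (γ * t)
  have e1 : Real.sin ψ ^ 2 = 1 - Real.cos ψ ^ 2 := by linarith
  have e2 : Real.sin (γ * t) ^ 2 = 1 - Real.cos (γ * t) ^ 2 := by linarith
  ring_nf
  simp only [e1, e2]
  ring

theorem density_cutWall_of_notMem (γ : ℝ) (hs : 0 < s) (hc : 1 < c) {t : ℝ}
    (ht : t ∉ Icc (-cutLen s c) (cutLen s c)) :
    density γ (cutWall γ s c) t = 0 ∧ ∀ j, deriv (cutWall γ s c j) t = 0 := by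
  have key : ∀ U : Set ℝ, IsOpen U → t ∈ U → (∀ j r, r ∈ U → cutWall γ s c j r =
      cutWall γ s c j t) → ∀ j, deriv (cutWall γ s c j) t = 0 := by
    intro U hU htU h j
    have : cutWall γ s c j =ᶠ[𝓝 t] fun _ => cutWall γ s c j t := by
      filter_upwards [hU.mem_nhds htU] with r hr using h j r hr
    rw [this.deriv_eq, deriv_const]
  have fin3 : ∀ {p : Fin 3 → Prop}, p 0 → p 1 → p 2 → ∀ j, p j := fun h0 h1 h2 j => by
    fin_cases j <;> assumption
  rw [mem_Icc, not_and_or, not_le, not_le] at ht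
  rcases ht with ht | ht
  · have h0 := cutWall_of_le γ hs hc ht.le
    have hd := key (Iio (-cutLen s c)) isOpen_Iio ht fun j r hr => by
      have h1 := cutWall_of_le γ hs hc (le_of_lt hr)
      revert j
      exact fin3 (h1.1.trans h0.1.symm) (h1.2.1.trans h0.2.1.symm) (h1.2.2.trans h0.2.2.symm)
    refine ⟨?_, hd⟩
    simp [density, hd, h0.1]
  · have h0 := cutWall_of_ge γ hs hc ht.le
    have hd := key (Ioi (cutLen s c)) isOpen_Ioi ht fun j r hr => by
      have h1 := cutWall_of_ge γ hs hc (le_of_lt hr)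
      revert j
      exact fin3 (h1.1.trans h0.1.symm) (h1.2.1.trans h0.2.1.symm) (h1.2.2.trans h0.2.2.symm)
    refine ⟨?_, hd⟩
    simp [density, hd, h0.1]

theorem integral_sech_sq_le (hs : 0 < s) (T : ℝ) :
    ∫ t in (-T)..T, (s / Real.cosh (s * t)) ^ 2 ≤ 2 * s := by
  have hd : ∀ t : ℝ, HasDerivAt (fun t => s * (Real.sinh (s * t) / Real.cosh (s * t)))
      ((s / Real.cosh (s * t)) ^ 2) t := by
    intro t
    have h1 : HasDerivAt (fun t : ℝ => s * t) s t := by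
      simpa using (hasDerivAt_id t).const_mul s
    have hc := (Real.cosh_pos (s * t)).ne'
    have h2 : HasDerivAt (fun t => s * (Real.sinh (s * t) / Real.cosh (s * t))) _ t :=
      (h1.sinh.div h1.cosh hc).const_mul s
    convert h2 using 1
    have := Real.cosh_sq (s * t)
    field_simp
    linear_combination (-1) * this
  rw [intervalIntegral.integral_eq_sub_of_hasDerivAt (fun t _ => hd t)
    (Continuous.intervalIntegrable (by
      have : ∀ t, Real.cosh (s * t) ≠ 0 := fun t => (Real.cosh_pos _).ne'
      fun_prop (disch := assumption)) _ _)]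
  have b : ∀ x : ℝ, |Real.sinh x / Real.cosh x| ≤ 1 := by
    intro x
    have hc := Real.cosh_pos x
    rw [abs_div, abs_of_pos hc, div_le_one hc, abs_le]
    have h1 := Real.sinh_lt_cosh x
    have h2 := Real.sinh_lt_cosh (-x)
    rw [Real.sinh_neg, Real.cosh_neg] at h2
    constructor <;> linarith
  have h1 := (abs_le.1 (b (s * T))).2
  have h2 := (abs_le.1 (b (s * -T))).1
  nlinarith

theorem integral_density_cutWall_le {γ : ℝ} (hγ : γ ∈ Ioo (-1 : ℝ) 1) (hc : 1 < c)
    (hs : s = √(1 - γ ^ 2)) :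
    ∫ t, density γ (cutWall γ s c) t ≤ 4 * s * c ^ 2 := by
  have hs0 : 0 < s := hs ▸ sqrt_pos_of_mem hγ
  have hs2 : 1 - γ ^ 2 = s ^ 2 := by
    rw [hs, Real.sq_sqrt]
    nlinarith [hγ.1, hγ.2]
  set T := cutLen s c
  have hT : 0 < T := cutLen_pos hs0 hc
  have hcosh : ∀ t, Real.cosh (s * t) ≠ 0 := fun t => (Real.cosh_pos _).ne'
  have e1 : ∫ t, density γ (cutWall γ s c) t = ∫ t in Icc (-T) T, density γ (cutWall γ s c) t :=
    (setIntegral_eq_integral_of_forall_compl_eq_zero fun t ht =>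
      (density_cutWall_of_notMem γ hs0 hc ht).1).symm
  have hwc : Continuous (wallAngle s) := (lipschitzWith_wallAngle hs0).continuous
  rw [e1, integral_Icc_eq_integral_Ioo,
    setIntegral_congr_fun measurableSet_Ioo fun t ht => density_cutWall_of_mem γ hs0 hc ht]
  -- Both terms of the density are at most `c² (s / cosh)²`, and the integral of `(s / cosh)²` is at
  -- most `2s`.
  have e2 : ∫ t in Ioo (-T) T, 2 * c ^ 2 * (s / Real.cosh (s * t)) ^ 2 ≤ 4 * s * c ^ 2 := by
    rw [integral_const_mul, ← integral_Ioc_eq_integral_Ioo,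
      ← intervalIntegral.integral_of_le (by linarith)]
    have := integral_sech_sq_le hs0 T
    nlinarith [sq_nonneg c]
  refine le_trans (setIntegral_mono_on ?_ ?_ measurableSet_Ioo fun t ht => ?_) e2
  · refine (Continuous.integrableOn_Icc ?_).mono_set Ioo_subset_Icc_self
    fun_prop (disch := assumption)
  · refine (Continuous.integrableOn_Icc ?_).mono_set Ioo_subset_Icc_self
    fun_prop (disch := assumption)
  · have h1 := cos_cutAngle_sq_le hs0 hc ht
    rw [hs2]
    have h2 : s ^ 2 * Real.cos (c * wallAngle s t) ^ 2 ≤ c ^ 2 * (s / Real.cosh (s * t)) ^ 2 := by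
      have h3 : (s / Real.cosh (s * t)) ^ 2 = s ^ 2 * (1 / Real.cosh (s * t)) ^ 2 := by ring
      rw [h3]
      have h4 := mul_le_mul_of_nonneg_left h1 (sq_nonneg s)
      refine h4.trans (le_mul_of_one_le_left (by positivity) ?_)
      nlinarith
    rw [mul_pow]
    linarith

end profile

/-! ### Maps of the axial variable -/

theorem lineDeriv_axis (f : ℝ → ℝ) (x : E3) :
    lineDeriv ℝ (fun x : E3 => f (x 0)) x (EuclideanSpace.single 0 1) = deriv f (x 0) := by
  have : (fun t : ℝ => f ((x + t • EuclideanSpace.single 0 (1 : ℝ) : E3) 0)) =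
      fun t => f (x 0 + t) := by
    ext t; simp
  rw [lineDeriv, this, deriv_comp_const_add, add_zero]

theorem lineDeriv_transverse (f : ℝ → ℝ) (x : E3) {i : Fin 3} (hi : i ≠ 0) :
    lineDeriv ℝ (fun x : E3 => f (x 0)) x (EuclideanSpace.single i 1) = 0 := by
  have : (fun t : ℝ => f ((x + t • EuclideanSpace.single i (1 : ℝ) : E3) 0)) =
      fun _ => f (x 0) := by
    ext t; simp [hi.symm]
  rw [lineDeriv, this, deriv_const]

theorem hasWeakPartial_axis {f : ℝ → ℝ} {K : NNReal} (hf : LipschitzWith K f) (i : Fin 3) :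
    HasWeakPartial cyl i (fun x : E3 => f (x 0)) fun x => if i = 0 then deriv f (x 0) else 0 := by
  have hL : LipschitzWith (K * 1) fun x : E3 => f (x 0) :=
    hf.comp (LipschitzWith.of_dist_le_mul fun x y => by
      rw [NNReal.coe_one, one_mul]
      simpa [dist_eq_norm] using PiLp.norm_apply_le (x - y) 0)
  refine (hasWeakPartial_of_lipschitz cyl i hL).congr ae_eq_rfl (Eventually.of_forall fun x => ?_)
  by_cases hi : i = 0
  · subst hi
    simp [lineDeriv_axis]
  · simp [hi, lineDeriv_transverse f x hi]

theorem memLp_axis {f : ℝ → ℝ} (hf : MemLp f 2 volume) :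
    MemLp (fun x : E3 => f (x 0)) 2 volCyl := by
  rw [memLp_two_iff_integrable_sq (aestronglyMeasurable_axis hf.aestronglyMeasurable)]
  exact integrableOn_axis hf.integrable_sq

theorem memLp_of_bound_of_support {f : ℝ → ℝ} {C T : ℝ} (hf : AEStronglyMeasurable f volume)
    (hC : ∀ t, |f t| ≤ C) (hT : ∀ t, t ∉ Icc (-T) T → f t = 0) : MemLp f 2 volume := by
  have : f = (Icc (-T) T).indicator f := by
    ext t
    by_cases ht : t ∈ Icc (-T) T
    · rw [indicator_of_mem ht]
    · rw [indicator_of_notMem ht, hT t ht]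
  rw [this, memLp_indicator_iff_restrict measurableSet_Icc]
  exact MemLp.of_bound hf.restrict C (Eventually.of_forall hC)

/-- Competitors with nearly optimal energy and walls of finite length. -/
theorem exists_competitor {γ : ℝ} (hγ : γ ∈ Ioo (-1 : ℝ) 1) {ε : ℝ} (hε : 0 < ε) :
    ∃ (m : E3 → E3) (T : ℝ), MemH1 m ∧ (∀ x, T ≤ x 0 → m x = e1) ∧ (∀ x, T ≤ -x 0 → m x = -e1) ∧
      transvEnergy m = 0 ∧ energyZero γ m ≤ 4 * √(1 - γ ^ 2) * area + ε := by
  have hA := area_pos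
  set s := √(1 - γ ^ 2) with hs
  have hs0 : 0 < s := sqrt_pos_of_mem hγ
  -- Chosen so that `4 s c²` times the area equals the minimal value plus exactly `ε`.
  set c := √(1 + ε / (4 * s * area)) with hcdef
  have hδ : 0 < ε / (4 * s * area) := by positivity
  have hc2 : c ^ 2 = 1 + ε / (4 * s * area) := Real.sq_sqrt (by positivity)
  have hc : 1 < c := by
    rw [hcdef, Real.lt_sqrt zero_le_one]
    linarith
  set f := cutWall γ s c with hf
  set T := cutLen s c with hT
  choose K hK using lipschitzWith_cutWall γ hs0 c
  let m : E3 → E3 := fun x => WithLp.toLp 2 fun j => f j (x 0)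
  have hmj : ∀ j, (fun x => m x j) = fun x : E3 => f j (x 0) := fun j => rfl
  have hw : ∀ i j, HasWeakPartial cyl i (fun x => m x j) fun x =>
      if i = 0 then deriv (f j) (x 0) else 0 := fun i j => hasWeakPartial_axis (hK j) i
  have hd : ∀ j, MemLp (deriv (f j)) 2 volume := fun j =>
    memLp_of_bound_of_support (measurable_deriv (f j)).aestronglyMeasurable
      (fun t => norm_deriv_le_of_lipschitz (hK j))
      fun t ht => (density_cutWall_of_notMem γ hs0 hc ht).2 j
  have hout : ∀ t, t ∉ Icc (-T) T → f 1 t = 0 ∧ f 2 t = 0 := by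
    intro t ht
    rw [mem_Icc, not_and_or, not_le, not_le] at ht
    rcases ht with ht | ht
    · exact (cutWall_of_le γ hs0 hc ht.le).2
    · exact (cutWall_of_ge γ hs0 hc ht.le).2
  have hb : ∀ j t, |f j t| ≤ 1 := fun j t => by
    rw [← sq_le_one_iff_abs_le_one, ← cutWall_sum_sq γ s c t]
    exact Finset.single_le_sum (f := fun j => f j t ^ 2) (fun _ _ => sq_nonneg _)
      (Finset.mem_univ j)
  have hf1 : MemLp (f 1) 2 volume := memLp_of_bound_of_support
    (hK 1).continuous.aestronglyMeasurable (hb 1) fun t ht => (hout t ht).1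
  have hf2 : MemLp (f 2) 2 volume := memLp_of_bound_of_support
    (hK 2).continuous.aestronglyMeasurable (hb 2) fun t ht => (hout t ht).2
  have hmem : MemH1 m := by
    refine ⟨?_, ?_, fun i j => ⟨_, hw i j, ?_⟩, ?_⟩
    · refine Continuous.aestronglyMeasurable ?_
      refine (PiLp.continuous_toLp 2 _).comp (continuous_pi fun j => ?_)
      exact (hK j).continuous.comp (by fun_prop)
    · refine Eventually.of_forall fun x => ?_
      rw [EuclideanSpace.norm_eq]
      simp only [m, Real.norm_eq_abs, sq_abs, hf, cutWall_sum_sq, Real.sqrt_one]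
    · by_cases hi : i = 0
      · simp only [hi, if_true]
        exact memLp_axis (hd j)
      · simp only [hi, if_false]
        exact MemLp.zero
    · intro j hj
      have : j = 1 ∨ j = 2 := by omega
      rcases this with rfl | rfl
      · exact memLp_axis hf1
      · exact memLp_axis hf2
  refine ⟨m, T, hmem, fun x hx => ?_, fun x hx => ?_, ?_, ?_⟩
  · have h := cutWall_of_ge γ hs0 hc hx
    ext j
    fin_cases j
    · simpa [m, e1] using h.1
    · simpa [m, e1] using h.2.1
    · simpa [m, e1] using h.2.2
  · have h := cutWall_of_le γ hs0 hc (show x 0 ≤ -T by linarith)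
    ext j
    fin_cases j
    · simpa [m, e1] using h.1
    · simpa [m, e1] using h.2.1
    · simpa [m, e1] using h.2.2
  · rw [transvEnergy, ← integral_zero E3 ℝ (μ := volCyl)]
    refine integral_congr_ae ?_
    have h1 := fun j => (hw 1 j).wD_ae_eq
    have h2 := fun j => (hw 2 j).wD_ae_eq
    filter_upwards [ae_all_iff.2 h1, ae_all_iff.2 h2] with x h1 h2
    simp [h1, h2]
  · have e1 : energyZero γ m = ∫ x in cyl, density γ f (x 0) := by
      rw [energyZero]
      refine integral_congr_ae ?_
      have h0 := fun j => (hw 0 j).wD_ae_eq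
      filter_upwards [ae_all_iff.2 h0] with x h0
      simp only [dkCross_zero, h0, if_true, density]
      rfl
    have hi : Integrable (density γ f) := by
      have hf0 : Integrable fun t => 1 - f 0 t ^ 2 := by
        refine (hf1.integrable_sq.add hf2.integrable_sq).congr (Eventually.of_forall fun t => ?_)
        have := cutWall_sum_sq γ s c t
        rw [Fin.sum_univ_three] at this
        simp only [Pi.add_apply, hf]
        linarith
      exact ((integrable_finsetSum _ fun j _ => (hd j).integrable_sq).add hf0).sub
        (((MemLp_mul_integrable (hd 1) hf2).sub (MemLp_mul_integrable (hd 2) hf1)).const_mul _)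
    rw [e1, setIntegral_axis_fun hi]
    have h1 := mul_le_mul_of_nonneg_left (integral_density_cutWall_le hγ hc hs) hA.le
    refine h1.trans (le_of_eq ?_)
    rw [hc2]
    field_simp

end Nanowire

namespace Nanowire

/-! ### Energy bounds for minimisers -/

variable {m : E3 → E3} {γ : ℝ}

theorem MemH1.exAnis_eq (h : MemH1 m) (p : Params) :
    exAnis p m = (∫ x in cyl, ((∑ j, wD 0 (fun y => m y j) x ^ 2) + (1 - m x 0 ^ 2))) +
      (1 / p.eta) ^ 2 * transvEnergy m := by
  have := h.mainEnergy_eq 0 p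
  simpa [mainEnergy, energyZero] using this

theorem MemH1.mainEnergy_coercive (h : MemH1 m) (γ : ℝ) (p : Params) :
    (1 - |γ|) * exAnis p m ≤ mainEnergy γ p m := by
  rw [h.exAnis_eq p, h.mainEnergy_eq γ p, mul_add]
  have h1 := h.energyZero_coercive γ
  have h2 : 0 ≤ (1 / p.eta) ^ 2 * transvEnergy m := mul_nonneg (sq_nonneg _) (transvEnergy_nonneg m)
  nlinarith [abs_nonneg γ]

theorem one_sub_abs_pos (hγ : γ ∈ Ioo (-1 : ℝ) 1) : 0 < 1 - |γ| := sub_pos.2 (abs_lt.2 hγ)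

theorem e1_apply (j : Fin 3) : e1 j = if j = 0 then 1 else 0 := by
  simp [e1]

theorem mem_wallsEta_of_eq {T : ℝ} (h : MemH1 m) (ht : ∀ x, T ≤ x 0 → m x = e1)
    (hb : ∀ x, T ≤ -x 0 → m x = -e1) {p : Params} (hp : T ≤ p.len) : m ∈ wallsEta p := by
  refine ⟨⟨h, Eventually.of_forall fun x hx => ?_⟩, Eventually.of_forall fun x =>
    ⟨fun hx => ht x (hp.trans hx), fun hx => hb x (hp.trans hx)⟩⟩
  rcases le_abs.1 (hp.trans hx) with h0 | h0
  · simp [ht x h0, e1_apply]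
  · simp [hb x h0, e1_apply]

section bounds

variable {P : ℝ → Params} {η : ℕ → ℝ} {m : ℕ → E3 → E3}

/-- The competitor is fixed independently of `η`. It becomes admissible once the wire is longer than
its wall, and its error term vanishes because its exchange and anisotropy energy is bounded
uniformly in `η`. -/
theorem eventually_energyEta_le (hγ : γ ∈ Ioo (-1 : ℝ) 1) (hP : Regime P γ)
    (hη : Tendsto η atTop (𝓝[>] 0))
    (hm : ∀ n, IsMinimiser (energyEta (P (η n))) (wallsEta (P (η n))) (m n)) {ε : ℝ} (hε : 0 < ε) :
    ∀ᶠ n in atTop, energyEta (P (η n)) (m n) ≤ 4 * √(1 - γ ^ 2) * area + ε := by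
  obtain ⟨w, T, hw, ht, hb, h0, hE⟩ := exists_competitor hγ (half_pos hε)
  have hmain : ∀ p, mainEnergy γ p w = energyZero γ w := fun p => by
    rw [hw.mainEnergy_eq, h0, mul_zero, add_zero]
  set K := energyZero γ w / (1 - |γ|)
  have hN : ∀ p, exAnis p w ≤ K := fun p => by
    rw [le_div_iff₀ (one_sub_abs_pos hγ), mul_comm]
    exact (hw.mainEnergy_coercive γ p).trans_eq (hmain p)
  have h1 : Tendsto (fun n => errBound γ (P (η n)) * (1 + K)) atTop (𝓝 0) := by
    simpa using (hP.tendsto_errBound.comp hη).mul_const (1 + K)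
  filter_upwards [(hP.tendsto_len.comp hη).eventually_ge_atTop T,
    h1.eventually_le_const (half_pos hε)] with n hn hn1
  have hmem := mem_wallsEta_of_eq hw ht hb hn
  have h2 := (abs_le.1 (MEta.abs_energyEta_sub_le hmem.1 γ)).2
  have h3 := mul_le_mul_of_nonneg_left (add_le_add_right (hN (P (η n))) 1)
    (errBound_nonneg γ (P (η n)))
  have h4 := (hm n).2 hmem
  rw [mem_ofPred_eq] at h4
  rw [hmain] at h2
  linarith

theorem exists_eventually_exAnis_le (hγ : γ ∈ Ioo (-1 : ℝ) 1) (hP : Regime P γ)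
    (hη : Tendsto η atTop (𝓝[>] 0))
    (hm : ∀ n, IsMinimiser (energyEta (P (η n))) (wallsEta (P (η n))) (m n)) :
    ∃ C, ∀ᶠ n in atTop, exAnis (P (η n)) (m n) ≤ C := by
  have hc := one_sub_abs_pos hγ
  -- Once the error factor is below `(1 - |γ|)/2`, it is absorbed by half of the coercivity; solving
  -- for the energy gives this constant.
  refine ⟨2 * (4 * √(1 - γ ^ 2) * area + 1 + (1 - |γ|) / 2) / (1 - |γ|), ?_⟩
  filter_upwards [eventually_energyEta_le hγ hP hη hm one_pos,
    (hP.tendsto_errBound.comp hη).eventually_le_const (half_pos hc)] with n h1 h2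
  have h3 := (abs_le.1 (MEta.abs_energyEta_sub_le (hm n).1.1 γ)).1
  have h4 := (hm n).1.1.1.mainEnergy_coercive γ (P (η n))
  have h5 := exAnis_nonneg (hm n).1.1.1 (P (η n))
  have h6 := mul_le_mul_of_nonneg_right h2 (by linarith : 0 ≤ 1 + exAnis (P (η n)) (m n))
  simp only [Function.comp_apply] at h6
  rw [le_div_iff₀ hc]
  linarith

theorem eventually_mainEnergy_le (hγ : γ ∈ Ioo (-1 : ℝ) 1) (hP : Regime P γ)
    (hη : Tendsto η atTop (𝓝[>] 0))
    (hm : ∀ n, IsMinimiser (energyEta (P (η n))) (wallsEta (P (η n))) (m n)) {ε : ℝ} (hε : 0 < ε) :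
    ∀ᶠ n in atTop, mainEnergy γ (P (η n)) (m n) ≤ 4 * √(1 - γ ^ 2) * area + ε := by
  obtain ⟨C, hC⟩ := exists_eventually_exAnis_le hγ hP hη hm
  have h1 : Tendsto (fun n => errBound γ (P (η n)) * (1 + C)) atTop (𝓝 0) := by
    simpa using (hP.tendsto_errBound.comp hη).mul_const (1 + C)
  filter_upwards [eventually_energyEta_le hγ hP hη hm (half_pos hε), hC,
    h1.eventually_le_const (half_pos hε)] with n h2 h3 h4
  have h5 := (abs_le.1 (MEta.abs_energyEta_sub_le (hm n).1.1 γ)).1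
  have h6 := mul_le_mul_of_nonneg_left (add_le_add_right h3 1) (errBound_nonneg γ (P (η n)))
  linarith

/-- The factor `η⁻²` in front of the transverse exchange, together with the uniform energy bound,
makes the transverse gradients vanish. -/
theorem tendsto_transvEnergy (hγ : γ ∈ Ioo (-1 : ℝ) 1) (hP : Regime P γ)
    (hη : Tendsto η atTop (𝓝[>] 0))
    (hm : ∀ n, IsMinimiser (energyEta (P (η n))) (wallsEta (P (η n))) (m n)) :
    Tendsto (fun n => transvEnergy (m n)) atTop (𝓝 0) := by
  obtain ⟨C, hC⟩ := exists_eventually_exAnis_le hγ hP hη hm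
  have h1 : Tendsto (fun n => (P (η n)).eta ^ 2 * C) atTop (𝓝 0) := by
    simpa using ((hP.tendsto_eta.comp hη).pow 2).mul_const C
  refine squeeze_zero' (Eventually.of_forall fun n => transvEnergy_nonneg _) ?_ h1
  filter_upwards [hC] with n hn
  have hp := (P (η n)).eta_pos
  have h2 : 0 ≤ ∫ x in cyl, ((∑ j, wD 0 (fun y => m n y j) x ^ 2) + (1 - m n x 0 ^ 2)) := by
    refine integral_nonneg_of_ae ?_
    filter_upwards [(hm n).1.1.1.anisotropy_ae] with x hx
    rw [hx]
    simp only [Pi.zero_apply]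
    positivity
  rw [(hm n).1.1.1.exAnis_eq] at hn
  have h3 := mul_le_mul_of_nonneg_left ((le_add_of_nonneg_left h2).trans hn) (sq_nonneg (P (η n)).eta)
  rwa [← mul_assoc, ← mul_pow, mul_one_div_cancel hp.ne', one_pow, one_mul] at h3

theorem energyZero_le_mainEnergy {m : E3 → E3} (h : MemH1 m) (γ : ℝ) (p : Params) :
    energyZero γ m ≤ mainEnergy γ p m := by
  rw [h.mainEnergy_eq]
  exact le_add_of_nonneg_right (mul_nonneg (sq_nonneg _) (transvEnergy_nonneg m))

end bounds

/-! ### Translations along the wire -/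

section translation

theorem MemH1.bddH1_comp_axis (h : MemH1 m) (t : ℝ) (j : Fin 3) :
    BddH1 (fun x => m (x + t • e1) j) fun i x => wD i (fun x => m x j) (x + t • e1) :=
  (h.bddH1 j).comp_axis t

theorem MemH1.comp_axis (h : MemH1 m) (t : ℝ) : MemH1 fun x => m (x + t • e1) where
  meas := h.meas.comp_measurePreserving (measurePreserving_axis t)
  sphere := (measurePreserving_axis t).quasiMeasurePreserving.ae h.sphere
  grad i j := ⟨_, (h.bddH1_comp_axis t j).weak i, (h.bddH1_comp_axis t j).sq i⟩
  transverse j hj := MemLp.comp_axis (h.transverse j hj) t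

theorem MemH1.wD_comp_axis (h : MemH1 m) (t : ℝ) (i j : Fin 3) :
    wD i (fun x => m (x + t • e1) j) =ᵐ[volCyl] fun x => wD i (fun x => m x j) (x + t • e1) :=
  ((h.bddH1_comp_axis t j).weak i).wD_ae_eq

theorem MemH1.integral_comp_axis (h : MemH1 m) (t : ℝ) (F : (Fin 3 → Fin 3 → ℝ) → E3 → ℝ) :
    ∫ x in cyl, F (fun i j => wD i (fun x => m (x + t • e1) j) x) (m (x + t • e1)) =
      ∫ x in cyl, F (fun i j => wD i (fun x => m x j) x) (m x) := by
  rw [← setIntegral_axis (fun x => F (fun i j => wD i (fun x => m x j) x) (m x)) t]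
  refine integral_congr_ae ?_
  filter_upwards [ae_all_iff.2 fun i => ae_all_iff.2 fun j => h.wD_comp_axis t i j] with x hx
  simp only [hx]

theorem MemH1.energyZero_comp_axis (h : MemH1 m) (γ t : ℝ) :
    energyZero γ (fun x => m (x + t • e1)) = energyZero γ m := by
  have := h.integral_comp_axis t fun w v => (∑ j, w 0 j ^ 2) + (1 - v 0 ^ 2) -
    2 * γ * (w 0 1 * v 2 - w 0 2 * v 1)
  simpa only [energyZero, dkCross_zero] using this

theorem MemH1.transvEnergy_comp_axis (h : MemH1 m) (t : ℝ) :
    transvEnergy (fun x => m (x + t • e1)) = transvEnergy m :=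
  h.integral_comp_axis t fun w _ => ∑ j, (w 1 j ^ 2 + w 2 j ^ 2)

end translation

end Nanowire

namespace Nanowire

/-! ### Profiles -/

theorem forall_mem_of_ae {u : ℝ → ℝ} (hc : Continuous u) {U K : Set ℝ} (hU : IsOpen U)
    (hK : IsClosed K) (h : ∀ᵐ t : ℝ, t ∈ U → u t ∈ K) {t : ℝ} (ht : t ∈ U) : u t ∈ K := by
  by_contra hn
  have ho : IsOpen (U ∩ u ⁻¹' Kᶜ) := hU.inter (hK.isOpen_compl.preimage hc)
  have h0 : volume (U ∩ u ⁻¹' Kᶜ) = 0 := by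
    refine measure_mono_null (fun r hr => ?_) (ae_iff.1 h)
    exact fun hk => hr.2 (hk hr.1)
  have : (U ∩ u ⁻¹' Kᶜ) = ∅ := (ho.measure_eq_zero_iff volume).1 h0
  exact (this ▸ ⟨ht, hn⟩ : t ∈ (∅ : Set ℝ))

section mean

variable {f : E3 → ℝ} {u : ℝ → ℝ}

theorem volDisk_real_inv_mul (c : ℝ) : area⁻¹ * ∫ _, c ∂volDisk = c := by
  rw [integral_const, smul_eq_mul]
  exact inv_mul_cancel_left₀ area_pos.ne' _

theorem IsMean.abs_le_one (hu : IsMean f u) (h : ∀ᵐ x ∂volCyl, |f x| ≤ 1) (t : ℝ) : |u t| ≤ 1 := by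
  refine abs_le.2 (forall_mem_of_ae hu.cont isOpen_univ isClosed_Icc ?_ (mem_univ t))
  filter_upwards [ae_ae_join h, hu.ae_eq] with r hr hru _
  rw [← hru, mem_Icc, ← abs_le, secAvg, abs_mul, abs_of_pos (inv_pos.2 area_pos)]
  have h1 : |∫ y, f (join r y) ∂volDisk| ≤ ∫ _, (1 : ℝ) ∂volDisk := by
    rw [← Real.norm_eq_abs]
    exact norm_integral_le_of_norm_le (integrable_const _) hr
  exact (mul_le_mul_of_nonneg_left h1 (inv_pos.2 area_pos).le).trans_eq (volDisk_real_inv_mul 1)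

theorem IsMean.eq_of_ae (hu : IsMean f u) {U : Set ℝ} (hU : IsOpen U) {c : ℝ}
    (h : ∀ᵐ x ∂volCyl, x 0 ∈ U → f x = c) {t : ℝ} (ht : t ∈ U) : u t = c := by
  refine forall_mem_of_ae hu.cont hU isClosed_singleton ?_ ht
  filter_upwards [ae_ae_join h, hu.ae_eq] with r hr hru hrU
  have : ∫ y, f (join r y) ∂volDisk = ∫ _, c ∂volDisk :=
    integral_congr_ae (by filter_upwards [hr] with y hy using hy (by rwa [join_zero]))
  rw [mem_singleton_iff, ← hru, secAvg, this, volDisk_real_inv_mul]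

theorem join_add_axis (t a : ℝ) (y : Fin 2 → ℝ) : join t y + a • e1 = join (t + a) y := by
  ext i
  refine Fin.cases ?_ (fun j => ?_) i
  · simp [e1_apply]
  · simp [e1_apply]

theorem IsMean.comp_axis (hu : IsMean f u) (a : ℝ) :
    IsMean (fun x => f (x + a • e1)) fun t => u (t + a) where
  cont := hu.cont.comp (by fun_prop)
  ae_eq := by
    have h := (measurePreserving_add_right volume a).quasiMeasurePreserving.ae_eq hu.ae_eq
    filter_upwards [h] with t ht
    simpa [secAvg, join_add_axis] using ht

/-- Cauchy-Schwarz against the indicator of the slab gives the `1/2`-Hölder estimate, hence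
equicontinuity. -/
theorem abs_increment_le {g : E3 → ℝ} (hg : MemLp g 2 volCyl)
    (hu : ∀ s t, s ≤ t → u t - u s = area⁻¹ * ∫ x in cyl, g x * (Ioc s t).indicator 1 (x 0))
    (s t : ℝ) : |u t - u s| ≤ area⁻¹ * √((∫ x in cyl, g x ^ 2) * area) * √|t - s| := by
  wlog hst : s ≤ t
  · rw [abs_sub_comm, abs_sub_comm t]
    exact this hg hu t s (le_of_not_ge hst)
  have hA := area_pos
  have e : (fun r : ℝ => (Ioc s t).indicator (1 : ℝ → ℝ) r ^ 2) = (Ioc s t).indicator 1 := by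
    ext r
    by_cases hr : r ∈ Ioc s t <;> simp [hr]
  have hi : Integrable ((Ioc s t).indicator (1 : ℝ → ℝ)) :=
    (integrable_indicator_iff measurableSet_Ioc).2 (integrableOn_const (by simp))
  have hm : MemLp (fun x : E3 => (Ioc s t).indicator (1 : ℝ → ℝ) (x 0)) 2 volCyl := by
    rw [memLp_two_iff_integrable_sq (aestronglyMeasurable_axis hi.aestronglyMeasurable)]
    exact integrableOn_axis (v := fun r => (Ioc s t).indicator (1 : ℝ → ℝ) r ^ 2) (e.symm ▸ hi)
  have hI : ∫ x in cyl, (Ioc s t).indicator (1 : ℝ → ℝ) (x 0) ^ 2 = area * |t - s| := by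
    rw [setIntegral_axis_fun (v := fun r : ℝ => (Ioc s t).indicator (1 : ℝ → ℝ) r ^ 2) (e.symm ▸ hi), e,
      integral_indicator_one measurableSet_Ioc, measureReal_def, Real.volume_Ioc,
      ENNReal.toReal_ofReal (sub_nonneg.2 hst), abs_of_nonneg (sub_nonneg.2 hst)]
  have h1 := abs_integral_mul_le hg hm
  rw [hI] at h1
  rw [hu s t hst, abs_mul, abs_of_pos (inv_pos.2 hA), mul_assoc]
  refine mul_le_mul_of_nonneg_left (h1.trans_eq ?_) (inv_pos.2 hA).le
  rw [Real.sqrt_mul hA.le, Real.sqrt_mul' _ hA.le]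
  ring

end mean

/-- Equibounded and equicontinuous sequences of curves converge pointwise along a subsequence. -/
theorem exists_subseq_tendsto {ι : Type*} [Finite ι] {u : ℕ → ι → ℝ → ℝ} {C : ℝ}
    (hb : ∀ n j t, |u n j t| ≤ 1) (hC : ∀ n j s t, |u n j t - u n j s| ≤ C * √|t - s|) :
    ∃ (φ : ℕ → ℕ) (v : ι → ℝ → ℝ), StrictMono φ ∧ (∀ j, Continuous (v j)) ∧
      ∀ j t, Tendsto (fun k => u (φ k) j t) atTop (𝓝 (v j t)) := by
  -- Sequential compactness of this countable product of intervals replaces the diagonal extraction;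
  -- equicontinuity passes from rational to all points.
  let x : ℕ → ι → ℚ → Icc (-1 : ℝ) 1 := fun n j q => ⟨u n j q, abs_le.1 (hb n j q)⟩
  obtain ⟨w, φ, hφ, hlim⟩ := CompactSpace.tendsto_subseq x
  have hq : ∀ j (q : ℚ), CauchySeq fun k => u (φ k) j q := fun j q =>
    ((continuous_subtype_val.tendsto _).comp
      (tendsto_pi_nhds.1 (tendsto_pi_nhds.1 hlim j) q)).cauchySeq
  have hcont : Continuous fun r : ℝ => C * √|r| := by fun_prop
  have hc : ∀ j t, CauchySeq fun k => u (φ k) j t := by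
    intro j t
    rw [Metric.cauchySeq_iff]
    intro ε hε
    obtain ⟨q, hq'⟩ := Rat.denseRange_cast (𝕜 := ℝ).exists_mem_open
      (isOpen_lt (hcont.comp (by fun_prop : Continuous fun r : ℝ => t - r))
        (continuous_const (y := ε / 3))) ⟨t, by simpa using hε⟩
    rw [mem_ofPred_eq] at hq'
    obtain ⟨N, hN⟩ := Metric.cauchySeq_iff.1 (hq j q) (ε / 3) (by positivity)
    refine ⟨N, fun k hk l hl => ?_⟩
    have h1 := (hC (φ k) j q t).trans_lt hq'
    have h2 := (hC (φ l) j q t).trans_lt hq'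
    have h3 := hN k hk l hl
    rw [Real.dist_eq] at h3 ⊢
    rw [abs_lt] at h1 h2 h3 ⊢
    constructor <;> linarith
  choose v hv using fun j t => cauchySeq_tendsto_of_complete (hc j t)
  refine ⟨φ, v, hφ, fun j => ?_, hv⟩
  rw [continuous_iff_continuousAt]
  intro s
  rw [ContinuousAt, tendsto_iff_dist_tendsto_zero]
  have h0 : Tendsto (fun t => C * √|t - s|) (𝓝 s) (𝓝 0) := by
    have := (hcont.comp (by fun_prop : Continuous fun r : ℝ => r - s)).tendsto s
    simpa [Function.comp_def] using this
  refine squeeze_zero (fun _ => dist_nonneg) (fun t => ?_) h0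
  rw [Real.dist_eq]
  exact le_of_tendsto ((hv j t).sub (hv j s)).abs (Eventually.of_forall fun k => hC (φ k) j s t)

end Nanowire

namespace Nanowire

/-! ### Compactness of sequences of walls -/

theorem MemH1.increment {m : E3 → E3} (h : MemH1 m) {j : Fin 3} {u : ℝ → ℝ}
    (hu : IsMean (fun x => m x j) u) (s t : ℝ) (hst : s ≤ t) :
    u t - u s = area⁻¹ * ∫ x in cyl, wD 0 (fun x => m x j) x * (Ioc s t).indicator 1 (x 0) := by
  obtain ⟨u', hu', h'⟩ := (h.bddH1 j).exists_isMean
  rw [hu.unique hu']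
  exact h' s t hst

theorem MemH1.poincare_le {m : E3 → E3} (h : MemH1 m) {j : Fin 3} {u : ℝ → ℝ}
    (hu : IsMean (fun x => m x j) u) :
    ∫ x in cyl, (m x j - u (x 0)) ^ 2 ≤ poincareConst * transvEnergy m := by
  refine ((h.bddH1 j).poincare hu).2.trans
    (mul_le_mul_of_nonneg_left ?_ poincareConst_nonneg)
  refine integral_mono ((h.memLp_wD 1 j).integrable_sq.add (h.memLp_wD 2 j).integrable_sq)
    h.integrable_transv fun x => ?_
  exact Finset.single_le_sum
    (f := fun j => wD 1 (fun y => m y j) x ^ 2 + wD 2 (fun y => m y j) x ^ 2)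
    (fun _ _ => by positivity) (Finset.mem_univ j)

/-- Sequences of walls centred at the origin, with section averages `u n j`, whose reduced energy
tends to the minimal one. -/
structure WallSeq (γ : ℝ) (M : ℕ → E3 → E3) (u : ℕ → Fin 3 → ℝ → ℝ) : Prop where
  mem : ∀ n, MemH1 (M n)
  mean : ∀ n j, IsMean (fun x => M n x j) (u n j)
  transv : Tendsto (fun n => transvEnergy (M n)) atTop (𝓝 0)
  bound : ∃ C, ∀ n, (∀ i j, ∫ x in cyl, wD i (fun x => M n x j) x ^ 2 ≤ C) ∧
    ∀ j, j ≠ 0 → ∫ x in cyl, M n x j ^ 2 ≤ C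
  energy : ∀ ε, 0 < ε → ∀ᶠ n in atTop, energyZero γ (M n) ≤ 4 * √(1 - γ ^ 2) * area + ε
  top : ∀ n, ∀ᶠ t in atTop, u n 0 t = 1
  bot : ∀ n, ∀ᶠ t in atBot, u n 0 t = -1
  zero : ∀ n, u n 0 0 = 0

namespace WallSeq

variable {γ : ℝ} {M : ℕ → E3 → E3} {u : ℕ → Fin 3 → ℝ → ℝ}

theorem comp (H : WallSeq γ M u) {φ : ℕ → ℕ} (hφ : StrictMono φ) :
    WallSeq γ (fun k => M (φ k)) fun k => u (φ k) where
  mem _ := H.mem _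
  mean _ := H.mean _
  transv := H.transv.comp hφ.tendsto_atTop
  bound := let ⟨C, hC⟩ := H.bound; ⟨C, fun _ => hC _⟩
  energy ε hε := hφ.tendsto_atTop.eventually (H.energy ε hε)
  top _ := H.top _
  bot _ := H.bot _
  zero _ := H.zero _

theorem abs_le_one (H : WallSeq γ M u) (n : ℕ) (j : Fin 3) (t : ℝ) : |u n j t| ≤ 1 :=
  (H.mean n j).abs_le_one ((H.mem n).abs_le j) t

theorem exists_subseq (H : WallSeq γ M u) :
    ∃ (φ : ℕ → ℕ) (v : Fin 3 → ℝ → ℝ), StrictMono φ ∧ (∀ j, Continuous (v j)) ∧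
      ∀ j t, Tendsto (fun k => u (φ k) j t) atTop (𝓝 (v j t)) := by
  obtain ⟨C, hC⟩ := H.bound
  refine exists_subseq_tendsto (C := area⁻¹ * √(C * area)) H.abs_le_one fun n j s t => ?_
  refine (abs_increment_le ((H.mem n).memLp_wD 0 j) ((H.mem n).increment (H.mean n j)) s t).trans ?_
  have := area_pos
  have := (hC n).1 0 j
  gcongr

theorem tendsto_sub (H : WallSeq γ M u) (j : Fin 3) :
    Tendsto (fun n => ∫ x in cyl, (M n x j - u n j (x 0)) ^ 2) atTop (𝓝 0) :=
  squeeze_zero (fun n => integral_nonneg fun x => sq_nonneg _)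
    (fun n => (H.mem n).poincare_le (H.mean n j)) (by simpa using H.transv.const_mul poincareConst)

variable {v : Fin 3 → ℝ → ℝ}

/-- Split `M = (M - u) + u`. The first part tends to zero in `L²` by Poincaré, which uses `φ ∈ L²`;
the second converges by dominated convergence, which uses `φ ∈ L¹`. -/
theorem tendsto_integral (H : WallSeq γ M u)
    (hlim : ∀ j t, Tendsto (fun k => u k j t) atTop (𝓝 (v j t))) (j : Fin 3) {φ : E3 → ℝ}
    (h1 : Integrable φ volCyl) (h2 : MemLp φ 2 volCyl) :
    Tendsto (fun n => ∫ x in cyl, M n x j * φ x) atTop (𝓝 (∫ x in cyl, v j (x 0) * φ x)) := by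
  have hm : ∀ n, AEStronglyMeasurable (fun x : E3 => u n j (x 0)) volCyl := fun n =>
    aestronglyMeasurable_axis (H.mean n j).cont.aestronglyMeasurable
  have hb : ∀ n, ∀ x : E3, ‖u n j (x 0) * φ x‖ ≤ ‖φ x‖ := fun n x => by
    rw [norm_mul]
    exact mul_le_of_le_one_left (norm_nonneg _) (H.abs_le_one n j _)
  have hi : ∀ n, Integrable (fun x : E3 => u n j (x 0) * φ x) volCyl := fun n =>
    h1.mono ((hm n).mul h1.aestronglyMeasurable) (Eventually.of_forall (hb n))
  have l1 : Tendsto (fun n => ∫ x in cyl, u n j (x 0) * φ x) atTop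
      (𝓝 (∫ x in cyl, v j (x 0) * φ x)) :=
    tendsto_integral_of_dominated_convergence (fun x => ‖φ x‖) (fun n => (hi n).aestronglyMeasurable)
      h1.norm (fun n => Eventually.of_forall (hb n))
      (Eventually.of_forall fun x => (hlim j (x 0)).mul_const _)
  have l2 : Tendsto (fun n => ∫ x in cyl, (M n x j - u n j (x 0)) * φ x) atTop (𝓝 0) := by
    have h0 := (H.tendsto_sub j).sqrt.mul_const (√(∫ x in cyl, φ x ^ 2))
    rw [Real.sqrt_zero, zero_mul] at h0
    exact squeeze_zero_norm (fun n =>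
      abs_integral_mul_le (((H.mem n).bddH1 j).poincare (H.mean n j)).1 h2) h0
  have l3 := l2.add l1
  rw [zero_add] at l3
  refine l3.congr fun n => ?_
  rw [← integral_add (MemLp_mul_integrable (((H.mem n).bddH1 j).poincare (H.mean n j)).1 h2) (hi n)]
  exact integral_congr_ae (Eventually.of_forall fun x => by simp only; ring)

/-- Averages of unit vectors need not be unit vectors, but `|1 - |u||` is at most `|M - u|`, which
tends to zero in `L²`. Continuity of the limit turns the almost everywhere identity into one at
every point. -/
theorem limit_sum_sq (H : WallSeq γ M u) (hv : ∀ j, Continuous (v j))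
    (hlim : ∀ j t, Tendsto (fun k => u k j t) atTop (𝓝 (v j t))) (t : ℝ) :
    ∑ j, v j t ^ 2 = 1 := by
  let U : ℕ → ℝ → E3 := fun n t => WithLp.toLp 2 fun j => u n j t
  let V : ℝ → E3 := fun t => WithLp.toLp 2 fun j => v j t
  have hUc : ∀ n, Continuous (U n) := fun n =>
    (PiLp.continuous_toLp 2 _).comp (continuous_pi fun j => (H.mean n j).cont)
  have hVc : Continuous V := (PiLp.continuous_toLp 2 _).comp (continuous_pi hv)
  have hUV : ∀ t, Tendsto (fun n => U n t) atTop (𝓝 (V t)) := fun t =>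
    ((PiLp.continuous_toLp 2 _).tendsto _).comp (tendsto_pi_nhds.2 fun j => hlim j t)
  -- An integrable positive weight makes dominated convergence available on the whole line; being at
  -- most `1`, it does not spoil the upper bound.
  let w : ℝ → ℝ := fun t => (1 + t ^ 2)⁻¹
  have hw : Integrable w := integrable_inv_one_add_sq
  have hw0 : ∀ t, 0 < w t := fun t => by positivity
  have hw1 : ∀ t, w t ≤ 1 := fun t => inv_le_one_of_one_le₀ (by linarith [sq_nonneg t])
  have hwc : Continuous w := Continuous.inv₀ (by fun_prop) fun t => by positivity
  have hb : ∀ n t, (1 - ‖U n t‖) ^ 2 ≤ 4 := by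
    intro n t
    have h1 : ‖U n t‖ ^ 2 ≤ 3 := by
      rw [EuclideanSpace.norm_sq_eq, Fin.sum_univ_three]
      have h := fun j => (sq_le_one_iff_abs_le_one _).2 (H.abs_le_one n j t)
      simp only [U, Real.norm_eq_abs, sq_abs]
      linarith [h 0, h 1, h 2]
    nlinarith [norm_nonneg (U n t)]
  have hbw : ∀ n t, ‖w t * (1 - ‖U n t‖) ^ 2‖ ≤ 4 * w t := fun n t => by
    rw [Real.norm_of_nonneg (mul_nonneg (hw0 t).le (sq_nonneg _)), mul_comm]
    exact mul_le_mul_of_nonneg_right (hb n t) (hw0 t).le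
  have hm : ∀ n, AEStronglyMeasurable (fun t => w t * (1 - ‖U n t‖) ^ 2) volume := fun n =>
    (hwc.mul ((continuous_const.sub (hUc n).norm).pow 2)).aestronglyMeasurable
  have hi : ∀ n, Integrable fun t => w t * (1 - ‖U n t‖) ^ 2 := fun n =>
    (hw.const_mul 4).mono' (hm n) (Eventually.of_forall (hbw n))
  have l1 : Tendsto (fun n => area * ∫ t, w t * (1 - ‖U n t‖) ^ 2) atTop
      (𝓝 (area * ∫ t, w t * (1 - ‖V t‖) ^ 2)) := by
    refine (tendsto_integral_of_dominated_convergence (fun t => 4 * w t) hm (hw.const_mul 4)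
      (fun n => Eventually.of_forall (hbw n)) (Eventually.of_forall fun t => ?_)).const_mul area
    exact (((hUV t).norm.const_sub 1).pow 2).const_mul _
  have hle : ∀ n, area * ∫ t, w t * (1 - ‖U n t‖) ^ 2 ≤
      ∑ j, ∫ x in cyl, (M n x j - u n j (x 0)) ^ 2 := by
    intro n
    have hs : ∀ j, Integrable (fun x => (M n x j - u n j (x 0)) ^ 2) volCyl := fun j =>
      (((H.mem n).bddH1 j).poincare (H.mean n j)).1.integrable_sq
    rw [← setIntegral_axis_fun (hi n), ← integral_finsetSum _ fun j _ => hs j]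
    refine integral_mono_ae (integrableOn_axis (hi n)) (integrable_finsetSum _ fun j _ => hs j) ?_
    filter_upwards [(H.mem n).sphere] with x hx
    have h1 : ∑ j, (M n x j - u n j (x 0)) ^ 2 = ‖M n x - U n (x 0)‖ ^ 2 := by
      rw [EuclideanSpace.norm_sq_eq]
      simp [U]
    rw [h1]
    refine (mul_le_of_le_one_left (sq_nonneg _) (hw1 _)).trans ?_
    rw [← hx, ← sq_abs]
    exact pow_le_pow_left₀ (abs_nonneg _) (abs_norm_sub_norm_le _ _) 2
  have l2 : Tendsto (fun n => ∑ j, ∫ x in cyl, (M n x j - u n j (x 0)) ^ 2) atTop (𝓝 0) := by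
    simpa using tendsto_finsetSum Finset.univ fun j _ => H.tendsto_sub j
  have hfin : Integrable fun t => w t * (1 - ‖V t‖) ^ 2 := by
    refine (hw.const_mul 4).mono'
      (hwc.mul ((continuous_const.sub hVc.norm).pow 2)).aestronglyMeasurable
      (Eventually.of_forall fun t => ?_)
    exact le_of_tendsto ((((hUV t).norm.const_sub 1).pow 2).const_mul (w t)).norm
      (Eventually.of_forall fun n => hbw n t)
  have h0 : ∫ t, w t * (1 - ‖V t‖) ^ 2 = 0 := by
    refine le_antisymm ?_ (integral_nonneg fun t => mul_nonneg (hw0 t).le (sq_nonneg _))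
    have := le_of_tendsto_of_tendsto' l1 l2 hle
    exact le_of_mul_le_mul_left (by simpa using this) area_pos
  rw [integral_eq_zero_iff_of_nonneg (fun t => mul_nonneg (hw0 t).le (sq_nonneg _)) hfin] at h0
  have h1 := congrFun ((Continuous.ae_eq_iff_eq volume
    (hwc.mul ((continuous_const.sub hVc.norm).pow 2)) continuous_const).1 h0) t
  have h2 : ‖V t‖ = 1 := by
    have : 1 - ‖V t‖ = 0 := pow_eq_zero_iff (two_ne_zero) |>.1 ((mul_eq_zero.1 h1).resolve_left (hw0 t).ne')
    linarith
  have h3 := EuclideanSpace.norm_sq_eq (V t)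
  rw [h2, one_pow] at h3
  simpa [V] using h3.symm

end WallSeq

end Nanowire

namespace Nanowire

/-! ### The limit wall -/

/-- The map on the cylinder with the axial components `v`. -/
noncomputable def axialMap (v : Fin 3 → ℝ → ℝ) (x : E3) : E3 := WithLp.toLp 2 fun j => v j (x 0)

namespace WallSeq

variable {γ : ℝ} {M : ℕ → E3 → E3} {u : ℕ → Fin 3 → ℝ → ℝ} {v : Fin 3 → ℝ → ℝ}

/-- Integration by parts moves the derivative to the test function, where the convergence of the
maps is already known. The bound in `L²` then upgrades this to weak convergence. -/
theorem exists_grad (H : WallSeq γ M u)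
    (hlim : ∀ j t, Tendsto (fun k => u k j t) atTop (𝓝 (v j t))) (i j : Fin 3) :
    ∃ g, MemLp g 2 volCyl ∧ WeakL2Tendsto (fun n => wD i fun x => M n x j) g ∧
      ∀ φ, IsTestFn cyl φ →
        ∫ x in cyl, v j (x 0) * partialD i φ x = -∫ x in cyl, g x * φ x := by
  obtain ⟨C, hC⟩ := H.bound
  have hl : ∀ φ, IsTestFn cyl φ → Tendsto (fun n => ∫ x in cyl, wD i (fun x => M n x j) x * φ x)
      atTop (𝓝 (-∫ x in cyl, v j (x 0) * partialD i φ x)) := by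
    intro φ hφ
    refine (H.tendsto_integral hlim j ((hφ.partialD i).integrable _)
      ((hφ.partialD i).memLp 2 _)).neg.congr fun n => ?_
    rw [(((H.mem n).bddH1 j).weak i).parts φ hφ, neg_neg]
  obtain ⟨g, hg, hw⟩ := exists_weakL2Tendsto _ (fun n => (H.mem n).memLp_wD i j)
    (fun n => (hC n).1 i j) _ hl
  refine ⟨g, hg, hw, fun φ hφ => ?_⟩
  rw [← tendsto_nhds_unique (hl φ hφ) (hw φ (hφ.memLp 2 _)), neg_neg]

theorem abs_limit_le_one (H : WallSeq γ M u)
    (hlim : ∀ j t, Tendsto (fun k => u k j t) atTop (𝓝 (v j t))) (j : Fin 3) (t : ℝ) :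
    |v j t| ≤ 1 :=
  le_of_tendsto (hlim j t).abs (Eventually.of_forall fun n => H.abs_le_one n j t)

theorem exists_bddH1_limit (H : WallSeq γ M u) (hv : ∀ j, Continuous (v j))
    (hlim : ∀ j t, Tendsto (fun k => u k j t) atTop (𝓝 (v j t))) (j : Fin 3) :
    ∃ g : Fin 3 → E3 → ℝ, BddH1 (fun x => v j (x 0)) g ∧
      ∀ i, WeakL2Tendsto (fun n => wD i fun x => M n x j) (g i) := by
  choose g hg hw hp using fun i => H.exists_grad hlim i j
  exact ⟨g, BddH1.of_parts (aestronglyMeasurable_axis (hv j).aestronglyMeasurable)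
    (Eventually.of_forall fun x => H.abs_limit_le_one hlim j _) hg hp, hw⟩

theorem weak_transverse (H : WallSeq γ M u) (hv : ∀ j, Continuous (v j))
    (hlim : ∀ j t, Tendsto (fun k => u k j t) atTop (𝓝 (v j t))) {j : Fin 3} (hj : j ≠ 0) :
    MemLp (fun x : E3 => v j (x 0)) 2 volCyl ∧
      WeakL2Tendsto (fun n x => M n x j) fun x => v j (x 0) := by
  obtain ⟨C, hC⟩ := H.bound
  have hl : ∀ φ, IsTestFn cyl φ → Tendsto (fun n => ∫ x in cyl, M n x j * φ x)
      atTop (𝓝 (∫ x in cyl, v j (x 0) * φ x)) := fun φ hφ =>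
    H.tendsto_integral hlim j (hφ.integrable _) (hφ.memLp 2 _)
  obtain ⟨h, hh, hw⟩ := exists_weakL2Tendsto _ (fun n => (H.mem n).transverse j hj)
    (fun n => (hC n).2 j hj) _ hl
  obtain ⟨g, hg, -⟩ := H.exists_bddH1_limit hv hlim j
  have e : h =ᵐ[volCyl] fun x => v j (x 0) :=
    ae_eq_of_forall_test isOpen_cyl (locallyIntegrableOn_of_locallyIntegrable_restrict (hh.locallyIntegrable one_le_two))
      (hg.weak 0).locInt fun φ hφ => tendsto_nhds_unique (hw φ (hφ.memLp 2 _)) (hl φ hφ)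
  exact ⟨hh.ae_eq e, hw.congr (fun _ => ae_eq_rfl) e⟩

theorem memH1_limit (H : WallSeq γ M u) (hv : ∀ j, Continuous (v j))
    (hlim : ∀ j t, Tendsto (fun k => u k j t) atTop (𝓝 (v j t))) : MemH1 (axialMap v) where
  meas := by
    refine Continuous.aestronglyMeasurable ?_
    exact (PiLp.continuous_toLp 2 _).comp (continuous_pi fun j => (hv j).comp (by fun_prop))
  sphere := Eventually.of_forall fun x => by
    rw [EuclideanSpace.norm_eq]
    simp only [axialMap, Real.norm_eq_abs, sq_abs, H.limit_sum_sq hv hlim, Real.sqrt_one]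
  grad i j := by
    obtain ⟨g, hg, -⟩ := H.exists_bddH1_limit hv hlim j
    exact ⟨g i, hg.weak i, hg.sq i⟩
  transverse j hj := (H.weak_transverse hv hlim hj).1

theorem weakH1Tendsto (H : WallSeq γ M u) (hv : ∀ j, Continuous (v j))
    (hlim : ∀ j t, Tendsto (fun k => u k j t) atTop (𝓝 (v j t))) :
    WeakH1Tendsto M (axialMap v) := by
  refine ⟨fun i j => ?_, fun j hj => (H.weak_transverse hv hlim hj).2⟩
  obtain ⟨g, hg, hw⟩ := H.exists_bddH1_limit hv hlim j
  exact (hw i).congr (fun _ => ae_eq_rfl) ((hg.weak i).wD_ae_eq).symm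

/-- The chiral term is a product of two weakly convergent factors and has no evident limit. In the
sum-of-squares form every term is the square of a weakly convergent sequence with a nonnegative
coefficient, so each is lower semicontinuous. -/
theorem energyZero_limit_le (H : WallSeq γ M u) (hγ : γ ∈ Ioo (-1 : ℝ) 1)
    (hv : ∀ j, Continuous (v j))
    (hlim : ∀ j t, Tendsto (fun k => u k j t) atTop (𝓝 (v j t))) :
    energyZero γ (axialMap v) ≤ 4 * √(1 - γ ^ 2) * area := by
  have h0 := H.memH1_limit hv hlim
  have hw := H.weakH1Tendsto hv hlim
  have hg : 0 ≤ 1 - γ ^ 2 := by nlinarith [hγ.1, hγ.2]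
  have ne1 : (1 : Fin 3) ≠ 0 := by decide
  have ne2 : (2 : Fin 3) ≠ 0 := by decide
  have mg := fun n j => (H.mem n).memLp_wD 0 j
  have mg0 := fun j => h0.memLp_wD 0 j
  have mt := fun n => (H.mem n).transverse
  refine le_of_forall_pos_le_add fun ε hε => ?_
  -- Five squares and the energy bound share the tolerance `ε`.
  have hδ : 0 < ε / 6 := by positivity
  have t0 := (hw.1 0 0).eventually_le (fun n => mg n 0) (mg0 0) hδ
  have t1 := ((hw.1 0 1).add_const_mul (hw.2 2 ne2) (-γ) (fun n => mg n 1)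
    (fun n => mt n 2 ne2) (mg0 1) (h0.transverse 2 ne2)).eventually_le
    (fun n => (mg n 1).add ((mt n 2 ne2).const_mul (-γ)))
    ((mg0 1).add ((h0.transverse 2 ne2).const_mul (-γ))) hδ
  have t2 := ((hw.1 0 2).add_const_mul (hw.2 1 ne1) γ (fun n => mg n 2)
    (fun n => mt n 1 ne1) (mg0 2) (h0.transverse 1 ne1)).eventually_le
    (fun n => (mg n 2).add ((mt n 1 ne1).const_mul γ))
    ((mg0 2).add ((h0.transverse 1 ne1).const_mul γ)) hδ
  have t3 := (hw.2 1 ne1).eventually_le (fun n => mt n 1 ne1) (h0.transverse 1 ne1) hδ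
  have t4 := (hw.2 2 ne2).eventually_le (fun n => mt n 2 ne2) (h0.transverse 2 ne2) hδ
  obtain ⟨n, t0, t1, t2, t3, t4, hE⟩ :=
    (t0.and (t1.and (t2.and (t3.and (t4.and (H.energy _ hδ)))))).exists
  rw [(H.mem n).energyZero_eq γ] at hE
  rw [h0.energyZero_eq γ]
  have t3' := mul_le_mul_of_nonneg_left t3 hg
  have t4' := mul_le_mul_of_nonneg_left t4 hg
  have hs : (1 - γ ^ 2) * (ε / 6) ≤ ε / 6 := mul_le_of_le_one_left hδ.le (by linarith [sq_nonneg γ])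
  rw [mul_add] at t3' t4'
  linarith

/-- A path from `-1` to `1` through the values at `x` and `y` has variation at least `2`, while the
energy allows at most `2 + ε`. In the limit `|v x + 1| + |v y - v x| + |1 - v y| ≤ 2`, which forces
`v x ≤ v y`. Monotonicity is what later provides the limits at infinity. -/
theorem limit_mono (H : WallSeq γ M u) (hγ : γ ∈ Ioo (-1 : ℝ) 1)
    (hlim : ∀ j t, Tendsto (fun k => u k j t) atTop (𝓝 (v j t))) : Monotone (v 0) := by
  have hs := sqrt_pos_of_mem hγ
  have hA := area_pos
  intro x y hxy
  have key : ∀ ε, 0 < ε → ∀ᶠ n in atTop,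
      |u n 0 x + 1| + |u n 0 y - u n 0 x| + |1 - u n 0 y| ≤ 2 + ε := by
    intro ε hε
    -- This excess becomes exactly `ε` after division by `2√(1-γ²)` times the area.
    filter_upwards [H.energy (2 * √(1 - γ ^ 2) * area * ε) (by positivity)] with n hn
    obtain ⟨b, hb, hyb⟩ := ((H.top n).and (eventually_ge_atTop y)).exists
    obtain ⟨a, ha, hax⟩ := ((H.bot n).and (eventually_le_atBot x)).exists
    have h1 := sum_increments_le ((H.mem n).integrable_wD_zero hγ)
      ((H.mem n).increment (H.mean n 0)) hax hxy hyb
    rw [ha, hb, sub_neg_eq_add] at h1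
    have h2 := ((H.mem n).variation_le hγ).trans hn
    have h3 := mul_le_mul_of_nonneg_left h1 (by positivity : 0 ≤ 2 * √(1 - γ ^ 2))
    have h4 : 2 * √(1 - γ ^ 2) * area *
        (|u n 0 x + 1| + |u n 0 y - u n 0 x| + |1 - u n 0 y|) ≤
        2 * √(1 - γ ^ 2) * area * (2 + ε) := by linarith
    exact le_of_mul_le_mul_left h4 (by positivity)
  have h2 : |v 0 x + 1| + |v 0 y - v 0 x| + |1 - v 0 y| ≤ 2 := by
    refine le_of_forall_pos_le_add fun ε hε => ?_
    exact le_of_tendsto ((((hlim 0 x).add_const 1).abs.add ((hlim 0 y).sub (hlim 0 x)).abs).add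
      ((hlim 0 y).const_sub 1).abs) (key ε hε)
  linarith [le_abs_self (v 0 x + 1), neg_abs_le (v 0 y - v 0 x), le_abs_self (1 - v 0 y),
    neg_le_abs (v 0 y - v 0 x)]

theorem integrable_limit (H : WallSeq γ M u) (hv : ∀ j, Continuous (v j))
    (hlim : ∀ j t, Tendsto (fun k => u k j t) atTop (𝓝 (v j t))) {j : Fin 3} (hj : j ≠ 0) :
    Integrable fun t => v j t ^ 2 := by
  have h := integrable_join (F := fun x : E3 => v j (x 0) ^ 2)
    (H.weak_transverse hv hlim hj).1.integrable_sq
  simp only [join_zero] at h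
  refine (Integrable.comp_fst_iff fun h0 => area_pos.ne' ?_).1 h
  rw [area, h0, measureReal_zero, Pi.zero_apply]

/-- The limit profile connects `-e₁` to `e₁`. -/
theorem tendsto_limit (H : WallSeq γ M u) (hv : ∀ j, Continuous (v j))
    (hlim : ∀ j t, Tendsto (fun k => u k j t) atTop (𝓝 (v j t))) {l : Filter ℝ} {c : ℝ}
    (hl : ∀ s ∈ l, volume s = ⊤) (hc : Tendsto (v 0) l (𝓝 c)) {σ : ℝ} (hσ : σ ^ 2 = 1)
    (hcσ : 0 ≤ σ * c) : Tendsto (fun t => (WithLp.toLp 2 fun j => v j t : E3)) l (𝓝 (σ • e1)) := by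
  have hsq : ∀ t, v 1 t ^ 2 + v 2 t ^ 2 = 1 - v 0 t ^ 2 := fun t => by
    have := H.limit_sum_sq hv hlim t
    rw [Fin.sum_univ_three] at this
    linarith
  have hi : Integrable fun t => 1 - v 0 t ^ 2 :=
    ((H.integrable_limit hv hlim (j := 1) (by decide)).add
      (H.integrable_limit hv hlim (j := 2) (by decide))).congr (Eventually.of_forall hsq)
  -- An integrable function can converge along sets of infinite measure only to zero. Hence `c =
  -- ±1`, and the sign condition on `σ c` selects `c = σ`.
  have h0 : 1 - c ^ 2 = 0 := IntegrableAtFilter.eq_zero_of_tendsto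
    ⟨univ, univ_mem, hi.integrableOn⟩ hl ((hc.pow 2).const_sub 1)
  have hcs : c = σ := by
    have : (c - σ) * (c + σ) = 0 := by linarith
    rcases mul_eq_zero.1 this with h | h
    · linarith
    · nlinarith
  have ht : ∀ j : Fin 3, j ≠ 0 → Tendsto (v j) l (𝓝 0) := by
    intro j hj
    have h1 : Tendsto (fun t => √(1 - v 0 t ^ 2)) l (𝓝 0) := by
      have := ((hc.pow 2).const_sub 1).sqrt
      rwa [h0, Real.sqrt_zero] at this
    refine squeeze_zero_norm (fun t => Real.abs_le_sqrt ?_) h1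
    rw [← hsq]
    have : j = 1 ∨ j = 2 := by omega
    rcases this with rfl | rfl
    · linarith [sq_nonneg (v 2 t)]
    · linarith [sq_nonneg (v 1 t)]
  have e : σ • e1 = WithLp.toLp 2 fun j : Fin 3 => if j = 0 then σ else 0 := by
    ext j
    simp [e1_apply]
  rw [e]
  refine ((PiLp.continuous_toLp 2 _).tendsto _).comp (tendsto_pi_nhds.2 fun j => ?_)
  by_cases hj : j = 0
  · subst hj
    simpa [← hcs] using hc
  · simpa [hj] using ht j hj

/-- A bounded monotone function has limits at both ends. The value `0` at the origin makes them
nonnegative and nonpositive respectively, which fixes their signs. -/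
theorem limit_mem_wallsZero (H : WallSeq γ M u) (hγ : γ ∈ Ioo (-1 : ℝ) 1)
    (hv : ∀ j, Continuous (v j))
    (hlim : ∀ j t, Tendsto (fun k => u k j t) atTop (𝓝 (v j t))) :
    axialMap v ∈ wallsZero := by
  have hmono := H.limit_mono hγ hlim
  have hb := H.abs_limit_le_one hlim 0
  have hz : v 0 0 = 0 := tendsto_nhds_unique (hlim 0 0) (by simp [H.zero])
  have hA : BddAbove (range (v 0)) := ⟨1, by rintro _ ⟨t, rfl⟩; exact (abs_le.1 (hb t)).2⟩
  have hB : BddBelow (range (v 0)) := ⟨-1, by rintro _ ⟨t, rfl⟩; exact (abs_le.1 (hb t)).1⟩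
  refine ⟨⟨H.memH1_limit hv hlim, fun t => WithLp.toLp 2 fun j => v j t,
    Eventually.of_forall fun x => rfl⟩, fun t => WithLp.toLp 2 fun j => v j t,
    ⟨(PiLp.continuous_toLp 2 _).comp (continuous_pi hv), Eventually.of_forall fun x => rfl⟩, ?_, ?_⟩
  · have := H.tendsto_limit hv hlim (fun s hs => ?_) (tendsto_atTop_ciSup hmono hA)
      (σ := 1) (by norm_num) ?_
    · simpa using this
    · obtain ⟨a, ha⟩ := mem_atTop_sets.1 hs
      exact measure_mono_top (fun r hr => ha r hr) (Real.volume_Ici (a := a))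
    · rw [one_mul, ← hz]
      exact le_ciSup hA 0
  · have := H.tendsto_limit hv hlim (fun s hs => ?_) (tendsto_atBot_ciInf hmono hB)
      (σ := -1) (by norm_num) ?_
    · simpa using this
    · obtain ⟨a, ha⟩ := mem_atBot_sets.1 hs
      exact measure_mono_top (fun r hr => ha r hr) (Real.volume_Iic (a := a))
    · have := ciInf_le hB 0
      rw [hz] at this
      linarith

end WallSeq

end Nanowire

namespace Nanowire

/-! ### Convergence of minimisers -/

/-! ### Centring the walls -/

section centre

variable {m : E3 → E3} {p : Params} {u : ℝ → ℝ}

theorem profile_eq_one (hm : m ∈ wallsEta p) (hu : IsMean (fun x => m x 0) u) {t : ℝ}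
    (ht : p.len < t) : u t = 1 :=
  hu.eq_of_ae isOpen_Ioi (by
    filter_upwards [hm.2] with x hx h
    rw [hx.1 (le_of_lt h)]
    simp [e1_apply]) (mem_Ioi.2 ht)

theorem profile_eq_neg_one (hm : m ∈ wallsEta p) (hu : IsMean (fun x => m x 0) u) {t : ℝ}
    (ht : t < -p.len) : u t = -1 :=
  hu.eq_of_ae isOpen_Iio (by
    filter_upwards [hm.2] with x hx h
    rw [hx.2 (by linarith [mem_Iio.1 h])]
    simp [e1_apply]) (mem_Iio.2 ht)

/-- The averages are known beyond the ends of the wire, hence at the ends by continuity. The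
intermediate value theorem then gives a zero strictly inside. -/
theorem exists_centre (hm : m ∈ wallsEta p) (hu : IsMean (fun x => m x 0) u) :
    ∃ a ∈ Ioo (-p.len) p.len, u a = 0 := by
  have hlen := p.len_pos
  have hr : u p.len = 1 := by
    have h1 : Tendsto u (𝓝[>] p.len) (𝓝 (u p.len)) := hu.cont.continuousWithinAt
    refine tendsto_nhds_unique h1 (tendsto_const_nhds.congr' ?_)
    filter_upwards [self_mem_nhdsWithin] with t ht using (profile_eq_one hm hu ht).symm
  have hl : u (-p.len) = -1 := by
    have h1 : Tendsto u (𝓝[<] (-p.len)) (𝓝 (u (-p.len))) := hu.cont.continuousWithinAt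
    refine tendsto_nhds_unique h1 (tendsto_const_nhds.congr' ?_)
    filter_upwards [self_mem_nhdsWithin] with t ht using (profile_eq_neg_one hm hu ht).symm
  obtain ⟨a, ha, h0⟩ := intermediate_value_Ioo (by linarith : -p.len ≤ p.len) hu.cont.continuousOn
    (show (0 : ℝ) ∈ Ioo (u (-p.len)) (u p.len) by rw [hr, hl]; constructor <;> norm_num)
  exact ⟨a, ha, h0⟩

end centre

theorem MemH1.integral_wD_zero_sq_le {m : E3 → E3} (h : MemH1 m) (j : Fin 3) :
    ∫ x in cyl, wD 0 (fun x => m x j) x ^ 2 ≤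
      ∫ x in cyl, ((∑ j, wD 0 (fun y => m y j) x ^ 2) + (1 - m x 0 ^ 2)) := by
  refine integral_mono_ae (h.memLp_wD 0 j).integrable_sq
    ((integrable_finsetSum _ fun j _ => (h.memLp_wD 0 j).integrable_sq).add
      h.integrable_anisotropy) ?_
  filter_upwards [h.anisotropy_ae] with x hx
  rw [hx]
  have := Finset.single_le_sum (f := fun j => wD 0 (fun y => m y j) x ^ 2)
    (fun _ _ => sq_nonneg _) (Finset.mem_univ j)
  simp only at this
  linarith [sq_nonneg (m x 1), sq_nonneg (m x 2)]

theorem MemH1.integral_transverse_sq_le {m : E3 → E3} (h : MemH1 m) {j : Fin 3} (hj : j ≠ 0) :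
    ∫ x in cyl, m x j ^ 2 ≤
      ∫ x in cyl, ((∑ j, wD 0 (fun y => m y j) x ^ 2) + (1 - m x 0 ^ 2)) := by
  refine integral_mono_ae (h.transverse j hj).integrable_sq
    ((integrable_finsetSum _ fun j _ => (h.memLp_wD 0 j).integrable_sq).add
      h.integrable_anisotropy) ?_
  filter_upwards [h.anisotropy_ae] with x hx
  rw [hx]
  have h1 : 0 ≤ ∑ j, wD 0 (fun y => m y j) x ^ 2 := Finset.sum_nonneg fun _ _ => sq_nonneg _
  have : j = 1 ∨ j = 2 := by omega
  rcases this with rfl | rfl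
  · linarith [sq_nonneg (m x 2)]
  · linarith [sq_nonneg (m x 1)]

theorem MemH1.integral_wD_transverse_sq_le {m : E3 → E3} (h : MemH1 m) {i : Fin 3} (hi : i ≠ 0)
    (j : Fin 3) : ∫ x in cyl, wD i (fun x => m x j) x ^ 2 ≤ transvEnergy m := by
  refine integral_mono (h.memLp_wD i j).integrable_sq h.integrable_transv fun x => ?_
  have h1 := Finset.single_le_sum
    (f := fun j => wD 1 (fun y => m y j) x ^ 2 + wD 2 (fun y => m y j) x ^ 2)
    (fun _ _ => by positivity) (Finset.mem_univ j)
  refine le_trans ?_ h1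
  have : i = 1 ∨ i = 2 := by omega
  rcases this with rfl | rfl
  · exact le_add_of_nonneg_right (sq_nonneg _)
  · exact le_add_of_nonneg_left (sq_nonneg _)

theorem MemH1.reduced_le {m : E3 → E3} (h : MemH1 m) {γ : ℝ} (hγ : γ ∈ Ioo (-1 : ℝ) 1) :
    ∫ x in cyl, ((∑ j, wD 0 (fun y => m y j) x ^ 2) + (1 - m x 0 ^ 2)) ≤
      energyZero γ m / (1 - |γ|) := by
  rw [le_div_iff₀ (one_sub_abs_pos hγ), mul_comm]
  exact h.energyZero_coercive γ

/-- The translated minimisers, from some index on, form a sequence of centred walls. -/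
theorem exists_wallSeq {γ : ℝ} (hγ : γ ∈ Ioo (-1 : ℝ) 1) {P : ℝ → Params} (hP : Regime P γ)
    {η : ℕ → ℝ} (hη : Tendsto η atTop (𝓝[>] 0)) {m : ℕ → E3 → E3}
    (hm : ∀ n, IsMinimiser (energyEta (P (η n))) (wallsEta (P (η n))) (m n)) :
    ∃ (N : ℕ) (a : ℕ → ℝ) (u : ℕ → Fin 3 → ℝ → ℝ),
      (∀ n, a n ∈ Ioo (-(P (η n)).len) (P (η n)).len) ∧
      WallSeq γ (fun k x => m (k + N) (x + a (k + N) • e1)) fun k => u (k + N) := by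
  have hmem : ∀ n, MemH1 (m n) := fun n => (hm n).1.1.1
  choose w hw using fun n j => ((hmem n).bddH1 j).exists_isMean
  choose a ha ha0 using fun n => exists_centre (hm n).1 (hw n 0).1
  have hE : ∀ ε, 0 < ε → ∀ᶠ n in atTop,
      energyZero γ (fun x => m n (x + a n • e1)) ≤ 4 * √(1 - γ ^ 2) * area + ε := fun ε hε => by
    filter_upwards [eventually_mainEnergy_le hγ hP hη hm hε] with n hn
    rw [(hmem n).energyZero_comp_axis]
    exact (energyZero_le_mainEnergy (hmem n) γ _).trans hn
  have hT : Tendsto (fun n => transvEnergy fun x => m n (x + a n • e1)) atTop (𝓝 0) :=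
    (tendsto_transvEnergy hγ hP hη hm).congr fun n => ((hmem n).transvEnergy_comp_axis _).symm
  -- The energy bounds hold only from some index on; dropping the first `N` terms makes them uniform
  -- in the whole sequence.
  obtain ⟨N, hN⟩ := eventually_atTop.1 ((hE 1 one_pos).and (hT.eventually_le_const one_pos))
  have hs : Tendsto (fun k => k + N) atTop atTop := tendsto_add_atTop_nat N
  refine ⟨N, a, fun n j t => w n j (t + a n), ha, ?_⟩
  refine
    { mem := fun n => (hmem _).comp_axis _
      mean := fun n j => (hw _ j).1.comp_axis _
      transv := hT.comp hs
      bound := ?_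
      energy := fun ε hε => hs.eventually (hE ε hε)
      top := fun n => ?_
      bot := fun n => ?_
      zero := fun n => by simp only [zero_add, ha0] }
  · have h1 := one_sub_abs_pos hγ
    refine ⟨max ((4 * √(1 - γ ^ 2) * area + 1) / (1 - |γ|)) 1, fun n => ?_⟩
    have h2 := hN (n + N) (Nat.le_add_left _ _)
    have hM := (hmem (n + N)).comp_axis (a (n + N))
    have h3 := (hM.reduced_le hγ).trans (div_le_div_of_nonneg_right h2.1 h1.le)
    refine ⟨fun i j => ?_, fun j hj => ?_⟩
    · by_cases hi : i = 0
      · subst hi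
        exact ((hM.integral_wD_zero_sq_le j).trans h3).trans (le_max_left _ _)
      · exact ((hM.integral_wD_transverse_sq_le hi j).trans h2.2).trans (le_max_right _ _)
    · exact ((hM.integral_transverse_sq_le hj).trans h3).trans (le_max_left _ _)
  · filter_upwards [eventually_gt_atTop ((P (η (n + N))).len - a (n + N))] with t ht
    exact profile_eq_one (hm _).1 (hw _ 0).1 (by linarith)
  · filter_upwards [eventually_lt_atBot (-(P (η (n + N))).len - a (n + N))] with t ht
    exact profile_eq_neg_one (hm _).1 (hw _ 0).1 (by linarith)

end Nanowire

/-! ### Conclusion -/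

theorem mainTheorem6 (γ : ℝ) (hγ : γ ∈ Set.Ioo (-1 : ℝ) 1)
    (P : ℝ → Nanowire.Params) (hP : Nanowire.Regime P γ)
    (η : ℕ → ℝ) (hη : Filter.Tendsto η Filter.atTop (𝓝[>] 0))
    (m : ℕ → Nanowire.E3 → Nanowire.E3)
    (hm : ∀ n, Nanowire.IsMinimiser (Nanowire.energyEta (P (η n)))
      (Nanowire.wallsEta (P (η n))) (m n)) :
    ∃ (φ : ℕ → ℕ) (a : ℕ → ℝ) (m₀ : Nanowire.E3 → Nanowire.E3),
      StrictMono φ ∧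
      (∀ k, a k ∈ Set.Ioo (-(P (η (φ k))).len) (P (η (φ k))).len) ∧
      Nanowire.WeakH1Tendsto (fun k x => m (φ k) (x + a k • Nanowire.e1)) m₀ ∧
      Nanowire.IsMinimiser (Nanowire.energyZero γ) Nanowire.wallsZero m₀ ∧
      ∃ u, Nanowire.IsProfile m₀ u ∧ u 0 0 = 0 := by
  obtain ⟨N, a, u, ha, H⟩ := Nanowire.exists_wallSeq hγ hP hη hm
  obtain ⟨φ, v, hφ, hv, hlim⟩ := H.exists_subseq
  have H' := H.comp hφ
  refine ⟨fun k => φ k + N, fun k => a (φ k + N), Nanowire.axialMap v, hφ.add_const N,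
    fun k => ha _, H'.weakH1Tendsto hv hlim, ⟨H'.limit_mem_wallsZero hγ hv hlim, fun w hw => ?_⟩,
    fun t => WithLp.toLp 2 fun j => v j t, ⟨?_, Eventually.of_forall fun x => rfl⟩, ?_⟩
  -- The energy of the limit is at most the number that bounds every competitor from below, so
  -- existence of a minimiser of `E₀` comes as a by-product.
  · exact (H'.energyZero_limit_le hγ hv hlim).trans (Nanowire.energyZero_ge_of_mem_wallsZero hγ hw)
  · exact (PiLp.continuous_toLp 2 _).comp (continuous_pi hv)
  · exact tendsto_nhds_unique (hlim 0 0) (by simp [H'.zero])
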